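/- **Setting.** Let $\mathcal{H}$ be the Heisenberg Lie algebra over $\mathbb{C}$ with basis $\kappa, b_n$ ($n\in\mathbb{Z}$), $[b_n,b_m]=n\delta_{n+m,0}\kappa$, $\kappa$ central. For $\lambda\in\mathbb{R}$ let $\mathcal{F}_\lambda=\mathbb{C}[b_n]_{n<0}|\lambda\rangle$ be the Fock module: $\kappa=1$, $b_0=\lambda$, and $b_n$ acts by multiplication for $n<0$ and by $n\,\partial/\partial b_{-n}$ for $n>0$. Let $\mathcal{C}$ be the category with objects $\mathcal{F}_\lambda$ ($\lambda\in\mathbb{R}$), whose morphisms are the $\mathcal{H}$-module maps, with the $\mathbb{C}$-linear braided monoidal structure and twist $$\mathcal{F}_\lambda\otimes\mathcal{F}_\mu=\mathcal{F}_{\lambda+\mu},\qquad a_{\mathcal{F}_\lambda,\mathcal{F}_\mu,\mathcal{F}_\nu}=\mathrm{Id},\qquad c_{\mathcal{F}_\lambda,\mathcal{F}_\mu}=e^{\pi i\lambda\mu}\,\mathrm{Id},\qquad \theta_{\mathcal{F}_\lambda}=e^{\pi i\lambda^2}\,\mathrm{Id}.$$ Let $\mathcal{C}_\oplus$ be its direct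 sum completion: objects are formal direct sums $\bigoplus_{s\in S}X_s$ over arbitrary index sets, a morphism $\bigoplus_s X_s\to\bigoplus_t Y_t$ is a matrix of morphisms $X_s\to Y_t$ with, for each $s$, only finitely many nonzero entries, and $\otimes$, $a$, $c$, $\theta$ are extended summand by summand. Let $N\ge 1$ be an integer, $L=\sqrt{2N}\,\mathbb{Z}$, and let $V_L=\bigoplus_{\lambda\in L}\mathcal{F}_\lambda\in\mathcal{C}_\oplus$ be the commutative algebra with multiplication $\mathrm{Id}:\mathcal{F}_\lambda\otimes\mathcal{F}_\mu\to\mathcal{F}_{\lambda+\mu}$ and unit $\mathrm{Id}:\mathcal{F}_0\to\mathcal{F}_0$ on components. A $V_L$-module $(M,\mu_M)$ in $\mathcal{C}_\oplus$ is local if $\mu_M\circ c_{M,V_L}\circ c_{V_L,M}=\mu_M$; let $\mathrm{Rep}^0V_L$ be the category of local modules. For local modules, $M\otimes_{V_L}N$ is the quotient (cokernel) of $M\otimes N$ by the image of $$(\mu_M\otimes\mathrm{Id}_N)(c_{M,V_L}\otimes\mathrm{Id}_N)a^{-1}_{M,V_L,N}-\mathrm{Id}_M\otimes\mu_N:\ M\otimes(V_L\otimes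 N)\to M\otimes N,$$ with $V_L$ acting through $M$. The functor $\mathscr{F}(X)=V_L\otimes X$ is induction to $V_L$-modules. Let $$R=\left\{\tfrac{a}{\sqrt{2N}}:a=0,\dots,2N-1\right\},\qquad k(x,y)=\begin{cases}\sqrt{2N}&\text{if }x+y\ge\sqrt{2N},\\0&\text{otherwise}\end{cases}\qquad(x,y\in R),$$ so that $x+y-k(x,y)\in R$. A skeleton of a category is a full subcategory containing exactly one object of each isomorphism class. **Theorem.** The modules $\mathscr{F}(\mathcal{F}_x)$, $x\in R$, are local, simple in $\mathrm{Rep}^0V_L$ and pairwise non-isomorphic, and every simple object of $\mathrm{Rep}^0V_L$ is isomorphic to one of them. The tensor product $\otimes_{V_L}$, with unit object $V_L$ and with the constraints, braiding and twist induced from $\mathcal{C}_\oplus$, makes $\mathrm{Rep}^0V_L$ a braided monoidal category with twist. There is a skeleton $\mathcal{S}$ of $\mathrm{Rep}^0V_L$ that contains all $\mathscr{F}(\mathcal{F}_x)$, $x\in R$, and a structure of braided monoidal category with twist on $\mathcal{S}$ for which the inclusion $\mathcal{S}\to\mathrm{Rep}^0V_L$ is a braided monoidal functor compatible with the twists, such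 that: 1. the full subcategory of $\mathcal{S}$ of finite direct sums of simple objects is closed under tensor products, contains the unit object, and is rigid (every object has a left and a right dual); 2. for all $x,y,z\in R$, $$\mathscr{F}(\mathcal{F}_x)\otimes\mathscr{F}(\mathcal{F}_y)=\mathscr{F}(\mathcal{F}_{x+y-k(x,y)}),$$ and the associativity constraint $(X\otimes Y)\otimes Z\to X\otimes(Y\otimes Z)$, braiding and twist of $\mathcal{S}$ are $$a_{\mathscr{F}(\mathcal{F}_x),\mathscr{F}(\mathcal{F}_y),\mathscr{F}(\mathcal{F}_z)}=(-1)^{x\cdot k(y,z)}\,\mathrm{Id},\qquad c_{\mathscr{F}(\mathcal{F}_x),\mathscr{F}(\mathcal{F}_y)}=e^{\pi i xy}\,\mathrm{Id},\qquad \theta_{\mathscr{F}(\mathcal{F}_x)}=e^{\pi i x^2}\,\mathrm{Id}.$$ -/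

import Mathlib

open CategoryTheory MonoidalCategory

noncomputable section

namespace HeisenbergLattice

/-! ### The Heisenberg Lie algebra and its Fock modules -/

/-- The Heisenberg Lie algebra over `ℂ` with basis `κ, b n` (`n : ℤ`): the element `(c, f)` is
`c κ + ∑ n, f n • b n`. -/
def Heisenberg : Type := ℂ × (ℤ →₀ ℂ)

namespace Heisenberg

instance : AddCommGroup Heisenberg := inferInstanceAs (AddCommGroup (ℂ × (ℤ →₀ ℂ)))
instance : Module ℂ Heisenberg := inferInstanceAs (Module ℂ (ℂ × (ℤ →₀ ℂ)))

/-- The central element `κ`. -/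
def kappa : Heisenberg := ((1 : ℂ), (0 : ℤ →₀ ℂ))

/-- The basis element `b n`. -/
def b (n : ℤ) : Heisenberg := ((0 : ℂ), Finsupp.single n (1 : ℂ))

/-- The bilinear form with `cocycle (b n) (b m) = n δ_{n+m,0}`. -/
def cocycle : (ℤ →₀ ℂ) →ₗ[ℂ] (ℤ →₀ ℂ) →ₗ[ℂ] ℂ :=
  Finsupp.lsum ℂ fun n : ℤ => LinearMap.toSpanSingleton ℂ _ ((n : ℂ) • Finsupp.lapply (-n))

theorem cocycle_single (n m : ℤ) (a c : ℂ) :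
    cocycle (Finsupp.single n a) (Finsupp.single m c) = if n + m = 0 then n * a * c else 0 := by
  by_cases h : n + m = 0
  · obtain rfl : m = -n := by omega
    simp [cocycle]; ring
  · have : m ≠ -n := by omega
    simp [cocycle, h, this]

theorem cocycle_swap (f g : ℤ →₀ ℂ) : cocycle f g = -cocycle g f := by
  induction f using Finsupp.induction_linear with
  | zero => simp
  | add f₁ f₂ h₁ h₂ => simp [h₁, h₂]; ring
  | single n a =>
    induction g using Finsupp.induction_linear with
    | zero => simp
    | add g₁ g₂ h₁ h₂ => simp [h₁, h₂]; ring
    | single m c =>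
      rw [cocycle_single, cocycle_single]
      by_cases h : n + m = 0
      · obtain rfl : m = -n := by omega
        simp; ring
      · have : m + n ≠ 0 := by omega
        simp [h, this]

@[simp] theorem fst_add (x y : Heisenberg) : (x + y).1 = x.1 + y.1 := rfl
@[simp] theorem snd_add (x y : Heisenberg) : (x + y).2 = x.2 + y.2 := rfl
@[simp] theorem fst_smul (c : ℂ) (x : Heisenberg) : (c • x).1 = c * x.1 := rfl
@[simp] theorem snd_smul (c : ℂ) (x : Heisenberg) : (c • x).2 = c • x.2 := rfl
@[simp] theorem fst_zero : (0 : Heisenberg).1 = 0 := rfl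
@[simp] theorem snd_zero : (0 : Heisenberg).2 = 0 := rfl

theorem ext {x y : Heisenberg} (h₁ : x.1 = y.1) (h₂ : x.2 = y.2) : x = y := Prod.ext h₁ h₂

/-- The Lie bracket: `[b n, b m] = n δ_{n+m,0} κ` and `κ` is central. -/
instance : Bracket Heisenberg Heisenberg := ⟨fun x y => (cocycle x.2 y.2, (0 : ℤ →₀ ℂ))⟩

@[simp] theorem fst_lie (x y : Heisenberg) : ⁅x, y⁆.1 = cocycle x.2 y.2 := rfl
@[simp] theorem snd_lie (x y : Heisenberg) : ⁅x, y⁆.2 = 0 := rfl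

instance : LieRing Heisenberg where
  add_lie x y z := ext (by simp) (by simp)
  lie_add x y z := ext (by simp) (by simp)
  lie_self x := ext (by
    have h := cocycle_swap x.2 x.2
    have : cocycle x.2 x.2 = 0 := by linear_combination h / 2
    simpa using this) (by simp)
  leibniz_lie x y z := ext (by simp) (by simp)

instance : LieAlgebra ℂ Heisenberg where
  lie_smul c x y := ext (by simp) (by simp)

@[simp] theorem fst_b (n : ℤ) : (b n).1 = 0 := rfl
@[simp] theorem snd_b (n : ℤ) : (b n).2 = Finsupp.single n 1 := rfl
@[simp] theorem fst_kappa : kappa.1 = 1 := rfl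
@[simp] theorem snd_kappa : kappa.2 = 0 := rfl

theorem lie_b_b (n m : ℤ) : ⁅b n, b m⁆ = if n + m = 0 then (n : ℂ) • kappa else 0 := by
  refine ext ?_ ?_
  · by_cases h : n + m = 0 <;> simp [cocycle_single, h]
  · by_cases h : n + m = 0 <;> simp [h]

theorem lie_kappa (x : Heisenberg) : ⁅kappa, x⁆ = 0 := ext (by simp) (by simp)

end Heisenberg

/-- The Fock space `F_lam = ℂ[b n]_{n < 0} |lam⟩`. The variable `X j` is `b (-(j+1))`, and
`1` is the highest weight vector `|lam⟩`. -/
def Fock (_lam : ℂ) : Type := MvPolynomial ℕ ℂ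

namespace Fock

variable (lam : ℂ)

instance : AddCommGroup (Fock lam) := inferInstanceAs (AddCommGroup (MvPolynomial ℕ ℂ))
instance : Module ℂ (Fock lam) := inferInstanceAs (Module ℂ (MvPolynomial ℕ ℂ))

/-- The action of `b n` on `F_lam`: multiplication by the variable `b n` for `n < 0`, the scalar
`lam` for `n = 0`, and `n ∂/∂(b (-n))` for `n > 0`. -/
def mode : ℤ → Module.End ℂ (MvPolynomial ℕ ℂ)
  | Int.negSucc j => LinearMap.mulLeft ℂ (MvPolynomial.X j)
  | Int.ofNat 0 => lam • LinearMap.id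
  | Int.ofNat (j + 1) => ((j : ℂ) + 1) • (MvPolynomial.pderiv j).toLinearMap

theorem mode_comm (n m : ℤ) :
    mode lam n * mode lam m - mode lam m * mode lam n = if n + m = 0 then (n : ℂ) • (1 : Module.End ℂ _) else 0 := by
  have hpp : ∀ (i j : ℕ) (p : MvPolynomial ℕ ℂ), MvPolynomial.pderiv i (MvPolynomial.pderiv j p) =
      MvPolynomial.pderiv j (MvPolynomial.pderiv i p) := by
    intro i j p
    ext d
    simp only [MvPolynomial.coeff_pderiv]
    by_cases hij : i = j
    · subst hij; rfl
    · rw [add_right_comm]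
      simp [hij, Ne.symm hij]
      ring
  apply LinearMap.ext
  intro p
  rcases n with (_ | n) | n <;> rcases m with (_ | m) | m
  · simp [mode]
  · have : ¬ ((Int.ofNat 0) + (Int.ofNat (m + 1)) = 0) := by simp; omega
    rw [if_neg this]
    simp [mode, smul_smul, mul_comm]
  · simp [mode]
  · have : ¬ ((Int.ofNat (n + 1)) + (Int.ofNat 0) = 0) := by simp; omega
    rw [if_neg this]
    simp [mode, smul_smul, mul_comm]
  · have : ¬ (((n + 1 : ℕ) : ℤ) + ((m + 1 : ℕ) : ℤ) = 0) := by omega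
    simp only [Int.ofNat_eq_natCast, this, if_false]
    simp [mode, hpp n m, smul_comm ((n : ℂ) + 1)]
  · by_cases h : n = m
    · subst h
      have : Int.ofNat (n + 1) + Int.negSucc n = 0 := by simp [Int.negSucc_eq]
      rw [if_pos this]
      simp [mode, Derivation.leibniz, smul_add]
    · have : ¬ (Int.ofNat (n + 1) + Int.negSucc m = 0) := by simp [Int.negSucc_eq]; omega
      rw [if_neg this]
      simp [mode, Derivation.leibniz,
        MvPolynomial.pderiv_X_of_ne (R := ℂ) (Ne.symm h)]
  · simp [mode]
  · by_cases h : n = m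
    · subst h
      have : Int.negSucc n + Int.ofNat (n + 1) = 0 := by simp [Int.negSucc_eq]
      rw [if_pos this]
      simp [mode, Derivation.leibniz, smul_add]
      simp [Algebra.smul_def]
      ring
    · have : ¬ (Int.negSucc n + Int.ofNat (m + 1) = 0) := by simp [Int.negSucc_eq]; omega
      rw [if_neg this]
      simp [mode, Derivation.leibniz,
        MvPolynomial.pderiv_X_of_ne (R := ℂ) h]
  · have : ¬ (Int.negSucc n + Int.negSucc m = 0) := by simp [Int.negSucc_eq]; omega
    rw [if_neg this]
    simp [mode]
    ring

/-- The representation of the Heisenberg Lie algebra on `F_lam`; `κ` acts as the identity. -/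
def rep : Heisenberg →ₗ[ℂ] Module.End ℂ (MvPolynomial ℕ ℂ) where
  toFun x := x.1 • (1 : Module.End ℂ (MvPolynomial ℕ ℂ)) +
    Finsupp.linearCombination ℂ (mode lam) x.2
  map_add' x y := by simp [add_smul]; abel
  map_smul' c x := by simp [mul_smul]

theorem rep_apply (x : Heisenberg) : rep lam x = x.1 • (1 : Module.End ℂ (MvPolynomial ℕ ℂ)) +
    Finsupp.linearCombination ℂ (mode lam) x.2 := rfl

theorem rep_lie (x y : Heisenberg) :
    rep lam ⁅x, y⁆ = rep lam x * rep lam y - rep lam y * rep lam x := by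
  have key : ∀ f g : ℤ →₀ ℂ, Heisenberg.cocycle f g • (1 : Module.End ℂ (MvPolynomial ℕ ℂ)) =
      Finsupp.linearCombination ℂ (mode lam) f * Finsupp.linearCombination ℂ (mode lam) g -
      Finsupp.linearCombination ℂ (mode lam) g * Finsupp.linearCombination ℂ (mode lam) f := by
    intro f g
    induction f using Finsupp.induction_linear with
    | zero => simp
    | add f₁ f₂ e₁ e₂ =>
      simp only [map_add, LinearMap.add_apply, add_smul, e₁, e₂, add_mul, mul_add]; abel
    | single n a =>
      induction g using Finsupp.induction_linear with
      | zero => simp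
      | add g₁ g₂ e₁ e₂ => simp only [map_add, add_smul, e₁, e₂, add_mul, mul_add]; abel
      | single m c =>
        rw [Heisenberg.cocycle_single, Finsupp.linearCombination_single,
          Finsupp.linearCombination_single, smul_mul_smul_comm, smul_mul_smul_comm, mul_comm c a,
          ← smul_sub, mode_comm]
        by_cases h : n + m = 0
        · simp only [h, if_true, smul_smul]
          congr 1; ring
        · simp [h]
  rw [rep_apply, rep_apply, rep_apply, Heisenberg.fst_lie, Heisenberg.snd_lie, map_zero, add_zero,
    key]
  simp only [add_mul, mul_add, smul_mul_assoc, mul_smul_comm, one_mul, mul_one, smul_add]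
  module

instance : LieRingModule Heisenberg (Fock lam) where
  bracket x v := (rep lam x (v : MvPolynomial ℕ ℂ) : MvPolynomial ℕ ℂ)
  add_lie x y v := LinearMap.congr_fun (map_add (rep lam) x y) v
  lie_add x v w := map_add (rep lam x) v w
  leibniz_lie x y v := by
    have h := LinearMap.congr_fun (rep_lie lam x y) v
    exact (eq_add_of_sub_eq h.symm)

instance : LieModule ℂ Heisenberg (Fock lam) where
  smul_lie c x v := LinearMap.congr_fun (map_smul (rep lam) c x) v
  lie_smul c x v := map_smul (rep lam x) c v

/-- The underlying polynomial of a vector in a Fock space. -/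
def poly : Fock lam ≃ₗ[ℂ] MvPolynomial ℕ ℂ := LinearEquiv.refl ℂ (MvPolynomial ℕ ℂ)

/-- The highest weight vector `|lam⟩`. -/
def vac : Fock lam := (poly lam).symm 1

@[simp] theorem poly_vac : poly lam (vac lam) = 1 := rfl

theorem poly_lie (x : Heisenberg) (v : Fock lam) : poly lam ⁅x, v⁆ = rep lam x (poly lam v) := rfl

theorem rep_kappa : rep lam Heisenberg.kappa = 1 := by simp [rep_apply]

theorem rep_b (n : ℤ) : rep lam (Heisenberg.b n) = mode lam n := by simp [rep_apply]

variable {lam} {mu nu : ℂ}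

/-- The scalar by which a module map acts on highest weight vectors: the coefficient of `|mu⟩` in
the image of `|lam⟩`. -/
def coef (f : Fock lam →ₗ⁅ℂ, Heisenberg⁆ Fock mu) : ℂ :=
  MvPolynomial.coeff 0 (poly mu (f (vac lam)))

theorem poly_map_b (f : Fock lam →ₗ⁅ℂ, Heisenberg⁆ Fock mu) (n : ℤ) (p : MvPolynomial ℕ ℂ) :
    poly mu (f ((poly lam).symm (mode lam n p))) =
      mode mu n (poly mu (f ((poly lam).symm p))) := by
  have h := congrArg (poly mu) (f.map_lie (Heisenberg.b n) ((poly lam).symm p))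
  rw [poly_lie, rep_b] at h
  rw [← h]
  congr 2
  apply (poly lam).injective
  rw [poly_lie, rep_b]
  simp

theorem poly_map_vac (f : Fock lam →ₗ⁅ℂ, Heisenberg⁆ Fock mu) :
    poly mu (f (vac lam)) = coef f • 1 := by
  have hd : ∀ j : ℕ, MvPolynomial.pderiv j (poly mu (f (vac lam))) = 0 := by
    intro j
    have h := poly_map_b f (Int.ofNat (j + 1)) 1
    have h0 : mode lam (Int.ofNat (j + 1)) 1 = 0 := by simp [mode]
    rw [h0, map_zero, map_zero, map_zero] at h
    have h2 : ((j : ℂ) + 1) • MvPolynomial.pderiv j (poly mu (f (vac lam))) = 0 := h.symm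
    exact (smul_eq_zero.1 h2).resolve_left (by exact_mod_cast Nat.succ_ne_zero j)
  ext d
  by_cases hd0 : d = 0
  · subst hd0; simp [coef]
  · obtain ⟨j, hj⟩ : ∃ j, d j ≠ 0 := by
      by_contra hcon; push Not at hcon; exact hd0 (Finsupp.ext hcon)
    have h := congrArg (MvPolynomial.coeff (d - Finsupp.single j 1)) (hd j)
    rw [MvPolynomial.coeff_pderiv, tsub_add_cancel_of_le] at h
    · have hz : MvPolynomial.coeff d (poly mu (f (vac lam))) = 0 := by
        rcases mul_eq_zero.1 (h.trans (MvPolynomial.coeff_zero _)) with h | h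
        · exact h
        · exact absurd h (Nat.cast_add_one_ne_zero _)
      rw [hz]
      simp [MvPolynomial.coeff_one, Ne.symm hd0]
    · rw [Finsupp.single_le_iff]; omega

/-- A module map between Fock spaces multiplies every polynomial by the same scalar. -/
theorem poly_map (f : Fock lam →ₗ⁅ℂ, Heisenberg⁆ Fock mu) (p : MvPolynomial ℕ ℂ) :
    poly mu (f ((poly lam).symm p)) = coef f • p := by
  induction p using MvPolynomial.induction_on with
  | C a =>
    have : (MvPolynomial.C a : MvPolynomial ℕ ℂ) = a • 1 := by
      simp [MvPolynomial.smul_eq_C_mul]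
    rw [this, map_smul, map_smul, map_smul, smul_comm]
    exact congrArg _ (poly_map_vac f)
  | add p q hp hq => rw [map_add, map_add, map_add, hp, hq, smul_add]
  | mul_X p j hp =>
    have h := poly_map_b f (Int.negSucc j) p
    rw [hp] at h
    simpa [mode, mul_comm] using h

theorem hom_ext {f g : Fock lam →ₗ⁅ℂ, Heisenberg⁆ Fock mu} (h : coef f = coef g) : f = g := by
  ext v
  apply (poly mu).injective
  have hf := poly_map f (poly lam v)
  have hg := poly_map g (poly lam v)
  rw [LinearEquiv.symm_apply_apply] at hf hg
  rw [hf, hg, h]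

theorem coef_eq_zero (f : Fock lam →ₗ⁅ℂ, Heisenberg⁆ Fock mu) (h : lam ≠ mu) : coef f = 0 := by
  have e := poly_map_b f (Int.ofNat 0) 1
  rw [poly_map, poly_map] at e
  have e4 := congrArg (MvPolynomial.coeff (0 : ℕ →₀ ℕ)) e
  simp only [mode, LinearMap.smul_apply, LinearMap.id_apply, MvPolynomial.coeff_smul,
    MvPolynomial.coeff_zero_one, smul_eq_mul, mul_one] at e4
  have : (lam - mu) * coef f = 0 := by linear_combination e4
  exact (mul_eq_zero.1 this).resolve_left (sub_ne_zero.2 h)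

@[simp] theorem coef_id : coef (LieModuleHom.id : Fock lam →ₗ⁅ℂ, Heisenberg⁆ Fock lam) = 1 := by
  simp [coef]

theorem coef_comp (g : Fock mu →ₗ⁅ℂ, Heisenberg⁆ Fock nu)
    (f : Fock lam →ₗ⁅ℂ, Heisenberg⁆ Fock mu) : coef (g.comp f) = coef f * coef g := by
  have h := poly_map g (poly mu (f (vac lam)))
  rw [LinearEquiv.symm_apply_apply, poly_map_vac] at h
  show MvPolynomial.coeff 0 (poly nu (g (f (vac lam)))) = _
  rw [h]
  simp [mul_comm]

@[simp] theorem coef_zero : coef (0 : Fock lam →ₗ⁅ℂ, Heisenberg⁆ Fock mu) = 0 := by simp [coef]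

@[simp] theorem coef_add (f g : Fock lam →ₗ⁅ℂ, Heisenberg⁆ Fock mu) :
    coef (f + g) = coef f + coef g := by simp [coef]

@[simp] theorem coef_smul (c : ℂ) (f : Fock lam →ₗ⁅ℂ, Heisenberg⁆ Fock mu) :
    coef (c • f) = c * coef f := by simp [coef]

end Fock

/-! ### The braided tensor category of Fock modules with real weight -/

/-- The skeletal category of the Fock modules `F_lam`, `lam ∈ ℝ`. Morphisms are the morphisms of
modules over the Heisenberg Lie algebra. -/
structure FockCat where
  /-- The weight `lam` of the Fock module `F_lam`. -/
  wt : ℝ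

namespace FockCat

/-- A morphism `F_lam ⟶ F_mu` is a morphism of modules over the Heisenberg Lie algebra. -/
@[ext] structure Hom (X Y : FockCat) where
  /-- The underlying module map. -/
  map : Fock (X.wt : ℂ) →ₗ⁅ℂ, Heisenberg⁆ Fock (Y.wt : ℂ)

instance : Category FockCat where
  Hom := Hom
  id X := ⟨(LieModuleHom.id : Fock (X.wt : ℂ) →ₗ⁅ℂ, Heisenberg⁆ Fock (X.wt : ℂ))⟩
  comp f g := ⟨g.map.comp f.map⟩
  id_comp _ := Hom.ext (LieModuleHom.ext fun _ => rfl)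
  comp_id _ := Hom.ext (LieModuleHom.ext fun _ => rfl)
  assoc _ _ _ := Hom.ext (LieModuleHom.ext fun _ => rfl)

/-- The scalar of a morphism between Fock modules, see `Fock.coef`. -/
def coef {X Y : FockCat} (f : X ⟶ Y) : ℂ := Fock.coef (Hom.map f)

@[ext] theorem hom_ext {X Y : FockCat} {f g : X ⟶ Y} (h : coef f = coef g) : f = g :=
  Hom.ext (Fock.hom_ext h)

@[simp] theorem coef_id (X : FockCat) : coef (𝟙 X) = 1 := Fock.coef_id

@[simp] theorem coef_comp {X Y Z : FockCat} (f : X ⟶ Y) (g : Y ⟶ Z) :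
    coef (f ≫ g) = coef f * coef g := Fock.coef_comp (Hom.map g) (Hom.map f)

@[simp] theorem coef_eqToHom {X Y : FockCat} (h : X = Y) : coef (eqToHom h) = 1 := by
  subst h; simp

theorem coef_eq_zero {X Y : FockCat} (f : X ⟶ Y) (h : X.wt ≠ Y.wt) : coef f = 0 :=
  Fock.coef_eq_zero (Hom.map f) (by simpa using h)

section Linear

variable (X Y : FockCat)

instance : Zero (X ⟶ Y) := ⟨⟨0⟩⟩
instance : Add (X ⟶ Y) := ⟨fun f g => ⟨Hom.map f + Hom.map g⟩⟩
instance : Neg (X ⟶ Y) := ⟨fun f => ⟨-Hom.map f⟩⟩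
instance : Sub (X ⟶ Y) := ⟨fun f g => ⟨Hom.map f - Hom.map g⟩⟩
instance : SMul ℕ (X ⟶ Y) := ⟨fun n f => ⟨n • Hom.map f⟩⟩
instance : SMul ℤ (X ⟶ Y) := ⟨fun n f => ⟨n • Hom.map f⟩⟩
instance : SMul ℂ (X ⟶ Y) := ⟨fun c f => ⟨c • Hom.map f⟩⟩

/-- The underlying module map of a morphism. -/
def toMap (f : X ⟶ Y) : Fock (X.wt : ℂ) →ₗ⁅ℂ, Heisenberg⁆ Fock (Y.wt : ℂ) := Hom.map f

theorem toMap_injective : Function.Injective (toMap X Y) := fun _ _ h => Hom.ext h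

instance : AddCommGroup (X ⟶ Y) :=
  (toMap_injective X Y).addCommGroup _ rfl (fun _ _ => rfl) (fun _ => rfl) (fun _ _ => rfl)
    (fun _ _ => rfl) (fun _ _ => rfl)

/-- The underlying module map, as an additive homomorphism. -/
def toMapHom : (X ⟶ Y) →+ (Fock (X.wt : ℂ) →ₗ⁅ℂ, Heisenberg⁆ Fock (Y.wt : ℂ)) where
  toFun := toMap X Y
  map_zero' := rfl
  map_add' _ _ := rfl

instance : Module ℂ (X ⟶ Y) :=
  Function.Injective.module ℂ (toMapHom X Y) (toMap_injective X Y) (fun _ _ => rfl)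

@[simp] theorem coef_zero : coef (0 : X ⟶ Y) = 0 := Fock.coef_zero

variable {X Y}

@[simp] theorem coef_add (f g : X ⟶ Y) : coef (f + g) = coef f + coef g :=
  Fock.coef_add (Hom.map f) (Hom.map g)

@[simp] theorem coef_smul (c : ℂ) (f : X ⟶ Y) : coef (c • f) = c * coef f :=
  Fock.coef_smul c (Hom.map f)

end Linear

attribute [irreducible] coef

instance : Preadditive FockCat where
  add_comp X Y Z f f' g := hom_ext (by simp only [coef_comp, coef_add, add_mul])
  comp_add X Y Z f g g' := hom_ext (by simp only [coef_comp, coef_add, mul_add])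

instance : Linear ℂ FockCat where
  smul_comp _ _ _ c f g := hom_ext (by simp only [coef_comp, coef_smul, mul_assoc])
  comp_smul _ _ _ f c g := hom_ext (by simp only [coef_comp, coef_smul, mul_left_comm])

/-- The scalar multiple `c • Id` between equal Fock modules (and `0` between distinct ones). -/
def scalar (X Y : FockCat) (c : ℂ) : X ⟶ Y :=
  open Classical in if h : X = Y then c • eqToHom h else 0

theorem coef_scalar {X Y : FockCat} (h : X.wt = Y.wt) (c : ℂ) : coef (scalar X Y c) = c := by
  obtain ⟨x⟩ := X
  obtain ⟨y⟩ := Y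
  obtain rfl : x = y := h
  simp [scalar]

/-- A nonzero scalar as an isomorphism of equal Fock modules. -/
@[simps] def scalarIso (X Y : FockCat) (h : X.wt = Y.wt) (c : ℂ) (hc : c ≠ 0) : X ≅ Y where
  hom := scalar X Y c
  inv := scalar Y X c⁻¹
  hom_inv_id := hom_ext (by simp [coef_scalar h, coef_scalar h.symm, hc])
  inv_hom_id := hom_ext (by simp [coef_scalar h, coef_scalar h.symm, hc])

/-- The tensor product `F_lam ⊗ F_mu = F_{lam+mu}`. On morphisms it is the bilinear operation with
`(a • Id) ⊗ (c • Id) = (a c) • Id`. The associativity and unit constraints are identities. -/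
instance : MonoidalCategoryStruct FockCat where
  tensorObj X Y := ⟨X.wt + Y.wt⟩
  tensorHom {X₁ Y₁ X₂ Y₂} f g := scalar ⟨X₁.wt + X₂.wt⟩ ⟨Y₁.wt + Y₂.wt⟩ (coef f * coef g)
  whiskerLeft X {Y₁ Y₂} f := scalar ⟨X.wt + Y₁.wt⟩ ⟨X.wt + Y₂.wt⟩ (coef f)
  whiskerRight {X₁ X₂} f Y := scalar ⟨X₁.wt + Y.wt⟩ ⟨X₂.wt + Y.wt⟩ (coef f)
  tensorUnit := ⟨0⟩
  associator X Y Z := scalarIso _ _ (add_assoc X.wt Y.wt Z.wt) 1 one_ne_zero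
  leftUnitor X := scalarIso _ _ (zero_add X.wt) 1 one_ne_zero
  rightUnitor X := scalarIso _ _ (add_zero X.wt) 1 one_ne_zero

@[simp] theorem tensorObj_wt (X Y : FockCat) : (X ⊗ Y).wt = X.wt + Y.wt := rfl
@[simp] theorem tensorUnit_wt : (𝟙_ FockCat).wt = 0 := rfl

theorem coef_scalar_of (X Y : FockCat) (c : ℂ) (h : X.wt ≠ Y.wt → c = 0) :
    coef (scalar X Y c) = c := by
  by_cases e : X.wt = Y.wt
  · exact coef_scalar e c
  · rw [h e, scalar]
    split_ifs with e'
    · exact absurd (congrArg wt e') e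
    · simp

@[simp] theorem coef_tensorHom {X₁ Y₁ X₂ Y₂ : FockCat} (f : X₁ ⟶ Y₁) (g : X₂ ⟶ Y₂) :
    coef (f ⊗ₘ g) = coef f * coef g := by
  refine coef_scalar_of _ _ _ fun h => ?_
  by_cases h₁ : X₁.wt = Y₁.wt
  · by_cases h₂ : X₂.wt = Y₂.wt
    · exact absurd (congrArg₂ (· + ·) h₁ h₂) h
    · rw [coef_eq_zero g h₂, mul_zero]
  · rw [coef_eq_zero f h₁, zero_mul]

@[simp] theorem coef_whiskerLeft (X : FockCat) {Y₁ Y₂ : FockCat} (f : Y₁ ⟶ Y₂) :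
    coef (X ◁ f) = coef f := by
  refine coef_scalar_of _ _ _ fun h => coef_eq_zero f fun e => h ?_
  exact congrArg (X.wt + ·) e

@[simp] theorem coef_whiskerRight {X₁ X₂ : FockCat} (f : X₁ ⟶ X₂) (Y : FockCat) :
    coef (f ▷ Y) = coef f := by
  refine coef_scalar_of _ _ _ fun h => coef_eq_zero f fun e => h ?_
  exact congrArg (· + Y.wt) e

@[simp] theorem coef_associator_hom (X Y Z : FockCat) : coef (α_ X Y Z).hom = 1 :=
  coef_scalar (add_assoc X.wt Y.wt Z.wt) 1
@[simp] theorem coef_associator_inv (X Y Z : FockCat) : coef (α_ X Y Z).inv = 1 :=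
  (coef_scalar (add_assoc X.wt Y.wt Z.wt).symm 1⁻¹).trans inv_one
@[simp] theorem coef_leftUnitor_hom (X : FockCat) : coef (λ_ X).hom = 1 :=
  coef_scalar (zero_add X.wt) 1
@[simp] theorem coef_leftUnitor_inv (X : FockCat) : coef (λ_ X).inv = 1 :=
  (coef_scalar (zero_add X.wt).symm 1⁻¹).trans inv_one
@[simp] theorem coef_rightUnitor_hom (X : FockCat) : coef (ρ_ X).hom = 1 :=
  coef_scalar (add_zero X.wt) 1
@[simp] theorem coef_rightUnitor_inv (X : FockCat) : coef (ρ_ X).inv = 1 :=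
  (coef_scalar (add_zero X.wt).symm 1⁻¹).trans inv_one

instance : MonoidalCategory FockCat where
  tensorHom_def _ _ := hom_ext (by simp)
  id_tensorHom_id _ _ := hom_ext (by simp)
  tensorHom_comp_tensorHom _ _ _ _ := hom_ext (by simp; ring)
  whiskerLeft_id _ _ := hom_ext (by simp)
  id_whiskerRight _ _ := hom_ext (by simp)
  associator_naturality _ _ _ := hom_ext (by simp; ring)
  leftUnitor_naturality _ := hom_ext (by simp)
  rightUnitor_naturality _ := hom_ext (by simp)
  pentagon _ _ _ _ := hom_ext (by simp)
  triangle _ _ := hom_ext (by simp)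

instance : MonoidalPreadditive FockCat where
  whiskerLeft_zero := hom_ext (by simp)
  zero_whiskerRight := hom_ext (by simp)
  whiskerLeft_add _ _ := hom_ext (by simp)
  add_whiskerRight _ _ := hom_ext (by simp)

instance : MonoidalLinear ℂ FockCat where
  whiskerLeft_smul _ _ _ _ _ := hom_ext (by simp)
  smul_whiskerRight _ _ _ _ _ := hom_ext (by simp)

/-- The braiding scalar `e^{π i x y}`. -/
def braidScalar (x y : ℝ) : ℂ := Complex.exp (Real.pi * Complex.I * x * y)

theorem braidScalar_ne_zero (x y : ℝ) : braidScalar x y ≠ 0 := Complex.exp_ne_zero _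

/-- The isomorphism `e^{π i lam mu} Id : F_lam ⊗ F_mu ⟶ F_mu ⊗ F_lam`. -/
def braid (X Y : FockCat) : X ⊗ Y ≅ Y ⊗ X :=
  scalarIso _ _ (add_comm X.wt Y.wt) (braidScalar X.wt Y.wt) (braidScalar_ne_zero _ _)

@[simp] theorem coef_braid_hom (X Y : FockCat) :
    coef (braid X Y).hom = braidScalar X.wt Y.wt := coef_scalar (add_comm X.wt Y.wt) _
@[simp] theorem coef_braid_inv (X Y : FockCat) :
    coef (braid X Y).inv = (braidScalar X.wt Y.wt)⁻¹ := coef_scalar (add_comm X.wt Y.wt).symm _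

/-- The braiding is `e^{π i lam mu} Id` on `F_lam ⊗ F_mu`. -/
instance : BraidedCategory FockCat where
  braiding := braid
  braiding_naturality_right X Y Z f := hom_ext (by
    by_cases h : Y.wt = Z.wt
    · simp [h, mul_comm]
    · simp [coef_eq_zero f h])
  braiding_naturality_left {X Y} f Z := hom_ext (by
    by_cases h : X.wt = Y.wt
    · simp [h, mul_comm]
    · simp [coef_eq_zero f h])
  hexagon_forward X Y Z := hom_ext (by
    simp only [coef_comp, coef_associator_hom, coef_braid_hom, coef_whiskerLeft,
      coef_whiskerRight, tensorObj_wt, braidScalar, one_mul, mul_one, ← Complex.exp_add]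
    congr 1; push_cast; ring)
  hexagon_reverse X Y Z := hom_ext (by
    simp only [coef_comp, coef_associator_inv, coef_braid_hom, coef_whiskerLeft,
      coef_whiskerRight, tensorObj_wt, braidScalar, one_mul, mul_one, ← Complex.exp_add]
    congr 1; push_cast; ring)

@[simp] theorem coef_braiding_hom (X Y : FockCat) :
    coef (β_ X Y).hom = braidScalar X.wt Y.wt := coef_braid_hom X Y

end FockCat

/-- A twist on a braided monoidal category: a natural automorphism of the identity functor which
satisfies the balancing axiom. -/
structure Twist (D : Type*) [Category D] [MonoidalCategory D] [BraidedCategory D] where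
  /-- The component at an object. -/
  app (X : D) : X ≅ X
  naturality {X Y : D} (f : X ⟶ Y) : f ≫ (app Y).hom = (app X).hom ≫ f
  balancing (X Y : D) : (app (X ⊗ Y)).hom =
    ((app X).hom ⊗ₘ (app Y).hom) ≫ (β_ X Y).hom ≫ (β_ Y X).hom

/-- The twist `e^{π i lam²} Id` on `F_lam`. -/
def fockTwist : Twist FockCat where
  app X := FockCat.scalarIso X X rfl (FockCat.braidScalar X.wt X.wt)
    (FockCat.braidScalar_ne_zero _ _)
  naturality {X Y} f := FockCat.hom_ext (by
    by_cases h : X.wt = Y.wt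
    · rw [FockCat.coef_comp, FockCat.coef_comp, FockCat.scalarIso_hom, FockCat.scalarIso_hom,
        FockCat.coef_scalar rfl, FockCat.coef_scalar rfl, h, mul_comm]
    · simp [FockCat.coef_eq_zero f h])
  balancing X Y := FockCat.hom_ext (by
    simp only [FockCat.scalarIso_hom, FockCat.coef_scalar, FockCat.coef_comp,
      FockCat.coef_tensorHom, FockCat.coef_braiding_hom, FockCat.tensorObj_wt,
      FockCat.braidScalar, ← Complex.exp_add]
    congr 1; push_cast; ring)

/-! ### The direct sum completion of a category -/

/-- An object of the direct sum completion of `C`: a formal direct sum `⨁ s, X s` of objects of `C`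
indexed by a set. -/
structure SumCompletion (C : Type*) where
  /-- The index set. -/
  ι : Type
  /-- The summands. -/
  X : ι → C

namespace SumCompletion

universe v u

variable {C : Type u} [Category.{v} C] [Preadditive C]

/-- A morphism `⨁ s, X s ⟶ ⨁ t, Y t`: a matrix of morphisms `X s ⟶ Y t` in which for every `s`
only finitely many entries are nonzero. -/
@[ext] structure Hom (A B : SumCompletion C) where
  /-- The matrix entries. -/
  app (s : A.ι) (t : B.ι) : A.X s ⟶ B.X t
  finite (s : A.ι) : {t | app s t ≠ 0}.Finite

/-- The matrix supported on the graph of a function `e` of index sets. -/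
def ofMap {A B : SumCompletion C} (e : A.ι → B.ι) (φ : ∀ s, A.X s ⟶ B.X (e s)) : Hom A B where
  app s t := open Classical in if h : e s = t then φ s ≫ eqToHom (congrArg B.X h) else 0
  finite s := (Set.finite_singleton (e s)).subset fun t ht => by
    by_contra hne
    exact ht (dif_neg fun h => hne h.symm)

/-- Composition is matrix multiplication. -/
def Hom.comp {A B D : SumCompletion C} (f : Hom A B) (g : Hom B D) : Hom A D where
  app s r := ∑ t ∈ (f.finite s).toFinset, f.app s t ≫ g.app t r
  finite s := ((f.finite s).biUnion fun t _ => g.finite t).subset fun r hr => by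
    obtain ⟨t, ht, h⟩ := Finset.exists_ne_zero_of_sum_ne_zero hr
    refine Set.mem_biUnion ((f.finite s).mem_toFinset.1 ht) ?_
    intro h0
    exact h (by rw [h0, Limits.comp_zero])

theorem Hom.comp_app_of_subset {A B D : SumCompletion C} (f : Hom A B) (g : Hom B D) (s : A.ι)
    (r : D.ι) (F : Finset B.ι) (hF : ∀ t, f.app s t ≠ 0 → t ∈ F) :
    (f.comp g).app s r = ∑ t ∈ F, f.app s t ≫ g.app t r := by
  refine Finset.sum_subset (fun t ht => hF t ((f.finite s).mem_toFinset.1 ht)) ?_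
  intro t _ ht
  have h0 : f.app s t = 0 := by
    by_contra h
    exact ht ((f.finite s).mem_toFinset.2 h)
  rw [h0, Limits.zero_comp]

theorem ofMap_app_self {A B : SumCompletion C} (e : A.ι → B.ι) (φ : ∀ s, A.X s ⟶ B.X (e s))
    (s : A.ι) : (ofMap e φ).app s (e s) = φ s := by simp [ofMap]

theorem ofMap_app_of_ne {A B : SumCompletion C} (e : A.ι → B.ι) (φ : ∀ s, A.X s ⟶ B.X (e s))
    {s : A.ι} {t : B.ι} (h : e s ≠ t) : (ofMap e φ).app s t = 0 := dif_neg h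

theorem ofMap_comp_app {A B D : SumCompletion C} (e : A.ι → B.ι) (φ : ∀ s, A.X s ⟶ B.X (e s))
    (g : Hom B D) (s : A.ι) (r : D.ι) :
    ((ofMap e φ).comp g).app s r = φ s ≫ g.app (e s) r := by
  rw [Hom.comp_app_of_subset _ _ _ _ {e s}, Finset.sum_singleton, ofMap_app_self]
  intro t ht
  by_contra hne
  exact ht (ofMap_app_of_ne e φ fun h => hne (Finset.mem_singleton.2 h.symm))

theorem comp_ofMap_app {A B D : SumCompletion C} (f : Hom A B) (e : B.ι → D.ι)
    (φ : ∀ s, B.X s ⟶ D.X (e s)) (he : Function.Injective e) (s : A.ι) (t : B.ι) :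
    (f.comp (ofMap e φ)).app s (e t) = f.app s t ≫ φ t := by
  classical
  rw [Hom.comp_app_of_subset _ _ _ _ (insert t (f.finite s).toFinset)
    (fun t ht => Finset.mem_insert_of_mem ((f.finite s).mem_toFinset.2 ht)),
    Finset.sum_eq_single t, ofMap_app_self]
  · intro t' _ ht'
    rw [ofMap_app_of_ne e φ fun h => ht' (he h), Limits.comp_zero]
  · intro h
    exact absurd (Finset.mem_insert_self _ _) h

instance : Category (SumCompletion C) where
  Hom := Hom
  id A := ofMap id fun s => 𝟙 (A.X s)
  comp f g := f.comp g
  id_comp f := Hom.ext (funext fun s => funext fun r => by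
    rw [ofMap_comp_app]; exact Category.id_comp _)
  comp_id {A B} f := Hom.ext (funext fun s => funext fun r =>
    (comp_ofMap_app f (id : B.ι → B.ι) (fun s => 𝟙 (B.X s)) Function.injective_id s r).trans
      (Category.comp_id _))
  assoc {A B D E} f g h := Hom.ext (funext fun s => funext fun q => by
    classical
    set F := (f.finite s).toFinset with hF
    set G := F.biUnion fun t => (g.finite t).toFinset with hG
    have hfF : ∀ t, f.app s t ≠ 0 → t ∈ F := fun t ht => (f.finite s).mem_toFinset.2 ht
    have hgG : ∀ t ∈ F, ∀ r, g.app t r ≠ 0 → r ∈ G := fun t ht r hr =>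
      Finset.mem_biUnion.2 ⟨t, ht, (g.finite t).mem_toFinset.2 hr⟩
    have hfg : ∀ r, (f.comp g).app s r ≠ 0 → r ∈ G := by
      intro r hr
      obtain ⟨t, ht, h'⟩ := Finset.exists_ne_zero_of_sum_ne_zero hr
      exact hgG t ht r fun h0 => h' (by rw [h0, Limits.comp_zero])
    rw [Hom.comp_app_of_subset _ _ _ _ G hfg, Hom.comp_app_of_subset _ _ _ _ F hfF,
      Finset.sum_congr rfl fun r _ => by
        rw [Hom.comp_app_of_subset f g s r F hfF, Preadditive.sum_comp],
      Finset.sum_comm]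
    refine Finset.sum_congr rfl fun t ht => ?_
    rw [Hom.comp_app_of_subset g h t q G (hgG t ht), Preadditive.comp_sum]
    exact Finset.sum_congr rfl fun r _ => Category.assoc _ _ _)

/-- The matrix entries of a morphism. -/
def entry {A B : SumCompletion C} (f : A ⟶ B) (s : A.ι) (t : B.ι) : A.X s ⟶ B.X t := Hom.app f s t

/-- `ofMap` as a morphism of the category. -/
def graph {A B : SumCompletion C} (e : A.ι → B.ι) (φ : ∀ s, A.X s ⟶ B.X (e s)) : A ⟶ B := ofMap e φ

@[ext] theorem hom_ext {A B : SumCompletion C} {f g : A ⟶ B}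
    (h : ∀ s t, entry f s t = entry g s t) : f = g :=
  Hom.ext (funext fun s => funext fun t => h s t)

theorem entry_finite {A B : SumCompletion C} (f : A ⟶ B) (s : A.ι) : {t | entry f s t ≠ 0}.Finite :=
  Hom.finite f s

theorem entry_comp {A B D : SumCompletion C} (f : A ⟶ B) (g : B ⟶ D) (s : A.ι) (r : D.ι)
    (F : Finset B.ι) (hF : ∀ t, entry f s t ≠ 0 → t ∈ F) :
    entry (f ≫ g) s r = ∑ t ∈ F, entry f s t ≫ entry g t r :=
  Hom.comp_app_of_subset f g s r F hF

theorem entry_graph_self {A B : SumCompletion C} (e : A.ι → B.ι) (φ : ∀ s, A.X s ⟶ B.X (e s))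
    (s : A.ι) : entry (graph e φ) s (e s) = φ s := ofMap_app_self e φ s

theorem entry_graph {A B : SumCompletion C} (e : A.ι → B.ι) (φ : ∀ s, A.X s ⟶ B.X (e s))
    {s : A.ι} {t : B.ι} (h : e s = t) :
    entry (graph e φ) s t = φ s ≫ eqToHom (congrArg B.X h) := dif_pos h

theorem entry_graph_of_ne {A B : SumCompletion C} (e : A.ι → B.ι) (φ : ∀ s, A.X s ⟶ B.X (e s))
    {s : A.ι} {t : B.ι} (h : e s ≠ t) : entry (graph e φ) s t = 0 := dif_neg h

theorem entry_graph_comp {A B D : SumCompletion C} (e : A.ι → B.ι) (φ : ∀ s, A.X s ⟶ B.X (e s))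
    (g : B ⟶ D) (s : A.ι) (r : D.ι) : entry (graph e φ ≫ g) s r = φ s ≫ entry g (e s) r :=
  ofMap_comp_app e φ g s r

theorem entry_comp_graph {A B D : SumCompletion C} (f : A ⟶ B) (e : B.ι → D.ι)
    (φ : ∀ s, B.X s ⟶ D.X (e s)) (he : Function.Injective e) (s : A.ι) (t : B.ι) :
    entry (f ≫ graph e φ) s (e t) = entry f s t ≫ φ t :=
  comp_ofMap_app f e φ he s t

theorem id_eq_graph (A : SumCompletion C) : 𝟙 A = graph id fun s => 𝟙 (A.X s) := rfl

attribute [irreducible] entry graph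

theorem graph_ext {A B : SumCompletion C} {e e' : A.ι → B.ι} {φ : ∀ s, A.X s ⟶ B.X (e s)}
    {φ' : ∀ s, A.X s ⟶ B.X (e' s)} (he : ∀ s, e s = e' s)
    (hφ : ∀ s, φ s ≫ eqToHom (congrArg B.X (he s)) = φ' s) : graph e φ = graph e' φ' := by
  obtain rfl : e = e' := funext he
  obtain rfl : φ = φ' := funext fun s => by simpa using hφ s
  rfl

theorem graph_congr {A B : SumCompletion C} {e : A.ι → B.ι} {φ φ' : ∀ s, A.X s ⟶ B.X (e s)}
    (hφ : ∀ s, φ s = φ' s) : graph e φ = graph e φ' := by rw [funext hφ]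

theorem graph_comp_graph {A B D : SumCompletion C} (e : A.ι → B.ι) (φ : ∀ s, A.X s ⟶ B.X (e s))
    (e' : B.ι → D.ι) (φ' : ∀ s, B.X s ⟶ D.X (e' s)) :
    graph e φ ≫ graph e' φ' =
      graph (A := A) (B := D) (fun s => e' (e s)) fun s => φ s ≫ φ' (e s) := by
  refine hom_ext fun s r => ?_
  rw [entry_graph_comp]
  by_cases h : e' (e s) = r
  · rw [entry_graph (A := A) (B := D) (fun s => e' (e s)) _ h, entry_graph e' φ' h, Category.assoc]
  · rw [entry_graph_of_ne (A := A) (B := D) (fun s => e' (e s)) _ h, entry_graph_of_ne e' φ' h,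
      Limits.comp_zero]

/-- An isomorphism given by a bijection of index sets and isomorphisms of the summands. -/
def graphIso {A B : SumCompletion C} (e : A.ι ≃ B.ι) (φ : ∀ s, A.X s ≅ B.X (e s)) : A ≅ B where
  hom := graph e fun s => (φ s).hom
  inv := graph e.symm fun t =>
    eqToHom (congrArg B.X (e.apply_symm_apply t).symm) ≫ (φ (e.symm t)).inv
  hom_inv_id := by
    rw [graph_comp_graph, id_eq_graph]
    refine graph_ext (fun s => e.symm_apply_apply s) fun s => ?_
    have key : ∀ (s' : A.ι) (hs : s' = s), (φ s).hom ≫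
        (eqToHom (by rw [hs]) ≫ (φ s').inv) ≫ eqToHom (congrArg A.X hs) = 𝟙 (A.X s) := by
      intro s' hs; subst hs; simp
    exact (Category.assoc _ _ _).trans (key _ (e.symm_apply_apply s))
  inv_hom_id := by
    rw [graph_comp_graph, id_eq_graph]
    refine graph_ext (fun t => e.apply_symm_apply t) fun t => ?_
    simp

theorem entry_graphIso_inv_comp {A B D : SumCompletion C} (e : A.ι ≃ B.ι)
    (φ : ∀ s, A.X s ≅ B.X (e s)) (g : A ⟶ D) (s : A.ι) (r : D.ι) :
    entry ((graphIso e φ).inv ≫ g) (e s) r = (φ s).inv ≫ entry g s r := by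
  have h : entry ((graphIso e φ).hom ≫ (graphIso e φ).inv ≫ g) s r = entry g s r := by
    rw [Iso.hom_inv_id_assoc]
  rw [← h]
  have h2 : entry ((graphIso e φ).hom ≫ (graphIso e φ).inv ≫ g) s r =
      (φ s).hom ≫ entry ((graphIso e φ).inv ≫ g) (e s) r :=
    entry_graph_comp _ _ _ _ _
  rw [h2, Iso.inv_hom_id_assoc]

/-! #### Linear structure -/

section Linear

variable (A B : SumCompletion C)

/-- Morphisms as a subgroup of the group of all matrices. -/
def homSubgroup : AddSubgroup (∀ (s : A.ι) (t : B.ι), A.X s ⟶ B.X t) where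
  carrier := {f | ∀ s, {t | f s t ≠ 0}.Finite}
  zero_mem' s := by simp
  add_mem' {f g} hf hg s := ((hf s).union (hg s)).subset fun t ht => by
    by_contra hcon
    simp only [Set.mem_union, Set.mem_ofPred_eq, not_or, not_not] at hcon
    exact ht (by simp [hcon.1, hcon.2])
  neg_mem' {f} hf s := by simpa using hf s

/-- The identification of morphisms with matrices. -/
def homEquiv : (A ⟶ B) ≃ homSubgroup A B where
  toFun f := ⟨entry f, entry_finite f⟩
  invFun f := (⟨f.1, f.2⟩ : Hom A B)
  left_inv f := hom_ext fun s t => by simp [entry]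
  right_inv f := by ext; simp [entry]

instance : AddCommGroup (A ⟶ B) := (homEquiv A B).addCommGroup

variable {A B}

@[simp] theorem entry_zero (s : A.ι) (t : B.ι) : entry (0 : A ⟶ B) s t = 0 := by
  have : homEquiv A B 0 = 0 := (homEquiv A B).apply_symm_apply 0
  exact congrFun (congrFun (congrArg Subtype.val this) s) t

@[simp] theorem entry_add (f g : A ⟶ B) (s : A.ι) (t : B.ι) :
    entry (f + g) s t = entry f s t + entry g s t := by
  have : homEquiv A B (f + g) = homEquiv A B f + homEquiv A B g :=
    (homEquiv A B).apply_symm_apply _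
  exact congrFun (congrFun (congrArg Subtype.val this) s) t

variable {R : Type*} [CommRing R] [Linear R C]

instance : SMul R (A ⟶ B) :=
  ⟨fun c f => (⟨fun s t => c • entry f s t, fun s => (entry_finite f s).subset fun t ht h0 =>
    ht (by rw [h0, smul_zero])⟩ : Hom A B)⟩

@[simp] theorem entry_smul (c : R) (f : A ⟶ B) (s : A.ι) (t : B.ι) :
    entry (c • f) s t = c • entry f s t := by
  conv_lhs => unfold entry
  rfl

instance : Module R (A ⟶ B) where
  one_smul f := hom_ext fun s t => by simp
  mul_smul c d f := hom_ext fun s t => by simp [mul_smul]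
  smul_zero c := hom_ext fun s t => by simp
  smul_add c f g := hom_ext fun s t => by simp
  add_smul c d f := hom_ext fun s t => by simp [add_smul]
  zero_smul f := hom_ext fun s t => by simp

end Linear

instance : Preadditive (SumCompletion C) where
  add_comp A B D f f' g := hom_ext fun s r => by
    classical
    have h : ∀ f : A ⟶ B, ∀ t, entry f s t ≠ 0 → t ∈ (entry_finite f s).toFinset :=
      fun f t ht => (entry_finite f s).mem_toFinset.2 ht
    set F := (entry_finite f s).toFinset ∪ (entry_finite f' s).toFinset ∪
      (entry_finite (f + f') s).toFinset with hF
    rw [entry_add, entry_comp _ _ _ _ F fun t ht => Finset.mem_union_right _ (h _ t ht),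
      entry_comp f _ _ _ F fun t ht => Finset.mem_union_left _ (Finset.mem_union_left _ (h _ t ht)),
      entry_comp f' _ _ _ F fun t ht =>
        Finset.mem_union_left _ (Finset.mem_union_right _ (h _ t ht)), ← Finset.sum_add_distrib]
    exact Finset.sum_congr rfl fun t _ => by rw [entry_add, Preadditive.add_comp]
  comp_add A B D f g g' := hom_ext fun s r => by
    have h : ∀ t, entry f s t ≠ 0 → t ∈ (entry_finite f s).toFinset :=
      fun t ht => (entry_finite f s).mem_toFinset.2 ht
    rw [entry_add, entry_comp _ _ _ _ _ h, entry_comp _ _ _ _ _ h, entry_comp _ _ _ _ _ h,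
      ← Finset.sum_add_distrib]
    exact Finset.sum_congr rfl fun t _ => by rw [entry_add, Preadditive.comp_add]

instance {R : Type*} [CommRing R] [Linear R C] : Linear R (SumCompletion C) where
  smul_comp A B D c f g := hom_ext fun s r => by
    have h : ∀ t, entry f s t ≠ 0 → t ∈ (entry_finite f s).toFinset :=
      fun t ht => (entry_finite f s).mem_toFinset.2 ht
    have h' : ∀ t, entry (c • f) s t ≠ 0 → t ∈ (entry_finite f s).toFinset :=
      fun t ht => h t fun h0 => ht (by rw [entry_smul, h0, smul_zero])
    rw [entry_smul, entry_comp _ _ _ _ _ h', entry_comp _ _ _ _ _ h, Finset.smul_sum]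
    exact Finset.sum_congr rfl fun t _ => by rw [entry_smul, Linear.smul_comp]
  comp_smul A B D f c g := hom_ext fun s r => by
    have h : ∀ t, entry f s t ≠ 0 → t ∈ (entry_finite f s).toFinset :=
      fun t ht => (entry_finite f s).mem_toFinset.2 ht
    rw [entry_smul, entry_comp _ _ _ _ _ h, entry_comp _ _ _ _ _ h, Finset.smul_sum]
    exact Finset.sum_congr rfl fun t _ => by rw [entry_smul, Linear.comp_smul]

variable (C) in
/-- The inclusion of `C` into its direct sum completion. -/
def inclusion : C ⥤ SumCompletion C where
  obj X := ⟨Unit, fun _ => X⟩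
  map {X Y} f := graph (A := ⟨Unit, fun _ => X⟩) (B := ⟨Unit, fun _ => Y⟩) id fun _ => f
  map_id _ := (id_eq_graph _).symm
  map_comp {X Y Z} f g := (graph_comp_graph (A := ⟨Unit, fun _ => X⟩) (B := ⟨Unit, fun _ => Y⟩)
    (D := ⟨Unit, fun _ => Z⟩) id (fun _ => f) id (fun _ => g)).symm

/-! #### Tensor structure -/

section Monoidal

variable [MonoidalCategory C] [MonoidalPreadditive C]

/-- The tensor product of two matrices. -/
def tensorHomAux {A A' B B' : SumCompletion C} (f : A ⟶ A') (g : B ⟶ B') :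
    Hom (⟨A.ι × B.ι, fun p => A.X p.1 ⊗ B.X p.2⟩ : SumCompletion C)
      ⟨A'.ι × B'.ι, fun p => A'.X p.1 ⊗ B'.X p.2⟩ where
  app p q := entry f p.1 q.1 ⊗ₘ entry g p.2 q.2
  finite p := ((entry_finite f p.1).prod (entry_finite g p.2)).subset fun q hq =>
    ⟨fun h => hq (by
      show entry f p.1 q.1 ⊗ₘ entry g p.2 q.2 = 0
      rw [h, MonoidalPreadditive.zero_tensor]), fun h => hq (by
      show entry f p.1 q.1 ⊗ₘ entry g p.2 q.2 = 0
      rw [h, MonoidalPreadditive.tensor_zero])⟩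

/-- The tensor product `(⨁ s, X s) ⊗ (⨁ t, Y t) = ⨁ (s, t), X s ⊗ Y t`. -/
instance : MonoidalCategoryStruct (SumCompletion C) where
  tensorObj A B := ⟨A.ι × B.ι, fun p => A.X p.1 ⊗ B.X p.2⟩
  tensorHom f g := tensorHomAux f g
  whiskerLeft A _ _ f := tensorHomAux (𝟙 A) f
  whiskerRight f B := tensorHomAux f (𝟙 B)
  tensorUnit := ⟨Unit, fun _ => 𝟙_ C⟩
  associator A B D := graphIso (A := ⟨(A.ι × B.ι) × D.ι, fun p => (A.X p.1.1 ⊗ B.X p.1.2) ⊗ D.X p.2⟩)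
    (B := ⟨A.ι × B.ι × D.ι, fun p => A.X p.1 ⊗ B.X p.2.1 ⊗ D.X p.2.2⟩)
    (Equiv.prodAssoc A.ι B.ι D.ι) fun p => α_ (A.X p.1.1) (B.X p.1.2) (D.X p.2)
  leftUnitor A := graphIso (A := ⟨Unit × A.ι, fun p => 𝟙_ C ⊗ A.X p.2⟩) (B := A)
    (Equiv.punitProd A.ι) fun p => λ_ (A.X p.2)
  rightUnitor A := graphIso (A := ⟨A.ι × Unit, fun p => A.X p.1 ⊗ 𝟙_ C⟩) (B := A)
    (Equiv.prodPUnit A.ι) fun p => ρ_ (A.X p.1)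

theorem entry_tensorHom {A A' B B' : SumCompletion C} (f : A ⟶ A') (g : B ⟶ B')
    (s : A.ι) (t : B.ι) (s' : A'.ι) (t' : B'.ι) :
    entry (A := A ⊗ B) (B := A' ⊗ B') (f ⊗ₘ g) (s, t) (s', t') = entry f s s' ⊗ₘ entry g t t' := by
  conv_lhs => unfold entry
  rfl

theorem associator_hom_eq (A B D : SumCompletion C) : (α_ A B D).hom =
    graph (A := (A ⊗ B) ⊗ D) (B := A ⊗ B ⊗ D) (fun p => (p.1.1, p.1.2, p.2))
      fun p => (α_ (A.X p.1.1) (B.X p.1.2) (D.X p.2)).hom := rfl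

theorem leftUnitor_hom_eq (A : SumCompletion C) : (λ_ A).hom =
    graph (A := 𝟙_ (SumCompletion C) ⊗ A) (B := A) (fun p => p.2) fun p => (λ_ (A.X p.2)).hom := rfl

theorem rightUnitor_hom_eq (A : SumCompletion C) : (ρ_ A).hom =
    graph (A := A ⊗ 𝟙_ (SumCompletion C)) (B := A) (fun p => p.1) fun p => (ρ_ (A.X p.1)).hom := rfl

theorem entry_associator_inv_comp {A B D E : SumCompletion C} (g : (A ⊗ B) ⊗ D ⟶ E)
    (s : A.ι) (t : B.ι) (r : D.ι) (q : E.ι) :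
    entry (A := A ⊗ B ⊗ D) (B := E) ((α_ A B D).inv ≫ g) (s, t, r) q =
      (α_ (A.X s) (B.X t) (D.X r)).inv ≫ entry (A := (A ⊗ B) ⊗ D) (B := E) g ((s, t), r) q :=
  entry_graphIso_inv_comp (A := (A ⊗ B) ⊗ D) (B := A ⊗ B ⊗ D) _ _ g ((s, t), r) q

theorem graph_tensorHom_graph {A A' B B' : SumCompletion C}
    (e : A.ι → A'.ι) (φ : ∀ s, A.X s ⟶ A'.X (e s)) (e' : B.ι → B'.ι)
    (φ' : ∀ s, B.X s ⟶ B'.X (e' s)) :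
    graph e φ ⊗ₘ graph e' φ' = graph (A := A ⊗ B) (B := A' ⊗ B') (fun p => (e p.1, e' p.2))
      fun p => φ p.1 ⊗ₘ φ' p.2 := by
  refine hom_ext ?_
  rintro ⟨s, t⟩ ⟨s', t'⟩
  rw [entry_tensorHom]
  by_cases h : e s = s'
  · by_cases h' : e' t = t'
    · subst h; subst h'
      rw [entry_graph_self, entry_graph_self]
      exact (entry_graph_self (A := A ⊗ B) (B := A' ⊗ B') (fun p => (e p.1, e' p.2))
        (fun p => φ p.1 ⊗ₘ φ' p.2) (s, t)).symm
    · rw [entry_graph_of_ne e' φ' h', MonoidalPreadditive.tensor_zero,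
        entry_graph_of_ne (A := A ⊗ B) (B := A' ⊗ B')]
      intro h''; exact h' (congrArg Prod.snd h'')
  · rw [entry_graph_of_ne e φ h, MonoidalPreadditive.zero_tensor,
      entry_graph_of_ne (A := A ⊗ B) (B := A' ⊗ B')]
    intro h''; exact h (congrArg Prod.fst h'')

theorem tensorHom_comp_tensorHom' {A A' A'' B B' B'' : SumCompletion C} (f : A ⟶ A') (g : B ⟶ B')
    (f' : A' ⟶ A'') (g' : B' ⟶ B'') : (f ⊗ₘ g) ≫ (f' ⊗ₘ g') = (f ≫ f') ⊗ₘ (g ≫ g') := by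
  refine hom_ext ?_
  rintro ⟨s, t⟩ ⟨s', t'⟩
  have hf : ∀ r, entry f s r ≠ 0 → r ∈ (entry_finite f s).toFinset :=
    fun r hr => (entry_finite f s).mem_toFinset.2 hr
  have hg : ∀ r, entry g t r ≠ 0 → r ∈ (entry_finite g t).toFinset :=
    fun r hr => (entry_finite g t).mem_toFinset.2 hr
  rw [entry_tensorHom, entry_comp f f' _ _ _ hf, entry_comp g g' _ _ _ hg,
    entry_comp (A := A ⊗ B) (B := A' ⊗ B') (D := A'' ⊗ B'') _ _ _ _
      ((entry_finite f s).toFinset ×ˢ (entry_finite g t).toFinset), sum_tensor]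
  · refine (Finset.sum_product (entry_finite f s).toFinset (entry_finite g t).toFinset _).trans ?_
    refine Finset.sum_congr rfl fun r _ => ?_
    rw [tensor_sum]
    refine Finset.sum_congr rfl fun r' _ => ?_
    rw [entry_tensorHom, entry_tensorHom]
    exact MonoidalCategory.tensorHom_comp_tensorHom _ _ _ _
  · rintro ⟨r, r'⟩ h
    rw [entry_tensorHom] at h
    refine Finset.mem_product.2 ⟨hf r fun h0 => h ?_, hg r' fun h0 => h ?_⟩
    · show entry f s r ⊗ₘ entry g t r' = 0
      rw [h0, MonoidalPreadditive.zero_tensor]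
    · show entry f s r ⊗ₘ entry g t r' = 0
      rw [h0, MonoidalPreadditive.tensor_zero]

theorem id_tensorHom_id' (A B : SumCompletion C) : 𝟙 A ⊗ₘ 𝟙 B = 𝟙 (A ⊗ B) := by
  rw [id_eq_graph, id_eq_graph, graph_tensorHom_graph, id_eq_graph]
  exact graph_congr fun p => MonoidalCategory.id_tensorHom_id _ _

instance : MonoidalCategory (SumCompletion C) :=
  MonoidalCategory.ofTensorHom
    (id_tensorHom_id := id_tensorHom_id')
    (id_tensorHom := fun _ _ _ _ => rfl)
    (tensorHom_id := fun _ _ => rfl)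
    (tensorHom_comp_tensorHom := fun f g f' g' => tensorHom_comp_tensorHom' f g f' g')
    (associator_naturality := fun {A B D A' B' D'} f g h => by
      rw [associator_hom_eq, associator_hom_eq]
      refine hom_ext ?_
      rintro ⟨⟨s, t⟩, r⟩ ⟨s', t', r'⟩
      refine (entry_comp_graph (A := (A ⊗ B) ⊗ D) (B := (A' ⊗ B') ⊗ D') (D := A' ⊗ B' ⊗ D') _ _ _
        (Equiv.prodAssoc A'.ι B'.ι D'.ι).injective ((s, t), r) ((s', t'), r')).trans ?_
      rw [entry_graph_comp, entry_tensorHom, entry_tensorHom, entry_tensorHom, entry_tensorHom]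
      exact MonoidalCategory.associator_naturality _ _ _)
    (leftUnitor_naturality := fun {A B} f => by
      rw [leftUnitor_hom_eq, leftUnitor_hom_eq]
      refine hom_ext ?_
      rintro ⟨⟨⟩, s⟩ t
      refine (entry_comp_graph (A := 𝟙_ (SumCompletion C) ⊗ A) (B := 𝟙_ (SumCompletion C) ⊗ B)
        (D := B) _ _ _ (Equiv.punitProd B.ι).injective ((), s) ((), t)).trans ?_
      rw [entry_graph_comp, entry_tensorHom, id_eq_graph]
      refine (congrArg (fun k => (k ⊗ₘ entry f s t) ≫ (λ_ (B.X t)).hom)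
        (entry_graph_self (A := 𝟙_ (SumCompletion C)) (B := 𝟙_ (SumCompletion C)) id
          (fun _ => 𝟙 (𝟙_ C)) ())).trans ?_
      have h : (𝟙 (𝟙_ C) ⊗ₘ entry f s t) ≫ (λ_ (B.X t)).hom = (λ_ (A.X s)).hom ≫ entry f s t := by
        simp
      exact h)
    (rightUnitor_naturality := fun {A B} f => by
      rw [rightUnitor_hom_eq, rightUnitor_hom_eq]
      refine hom_ext ?_
      rintro ⟨s, ⟨⟩⟩ t
      refine (entry_comp_graph (A := A ⊗ 𝟙_ (SumCompletion C)) (B := B ⊗ 𝟙_ (SumCompletion C))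
        (D := B) _ _ _ (Equiv.prodPUnit B.ι).injective (s, ()) (t, ())).trans ?_
      rw [entry_graph_comp, entry_tensorHom, id_eq_graph]
      refine (congrArg (fun k => (entry f s t ⊗ₘ k) ≫ (ρ_ (B.X t)).hom)
        (entry_graph_self (A := 𝟙_ (SumCompletion C)) (B := 𝟙_ (SumCompletion C)) id
          (fun _ => 𝟙 (𝟙_ C)) ())).trans ?_
      have h : (entry f s t ⊗ₘ 𝟙 (𝟙_ C)) ≫ (ρ_ (B.X t)).hom = (ρ_ (A.X s)).hom ≫ entry f s t := by
        simp
      exact h)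
    (pentagon := fun A B D E => by
      simp only [associator_hom_eq, id_eq_graph, graph_tensorHom_graph, graph_comp_graph]
      refine graph_congr fun p => ?_
      have h : ∀ a b c d : C, ((α_ a b c).hom ⊗ₘ 𝟙 d) ≫ (α_ a (b ⊗ c) d).hom ≫
          (𝟙 a ⊗ₘ (α_ b c d).hom) = (α_ (a ⊗ b) c d).hom ≫ (α_ a b (c ⊗ d)).hom := by
        intro a b c d; simp
      exact h (A.X p.1.1.1) (B.X p.1.1.2) (D.X p.1.2) (E.X p.2))
    (triangle := fun A B => by
      simp only [associator_hom_eq, leftUnitor_hom_eq, rightUnitor_hom_eq, id_eq_graph,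
        graph_tensorHom_graph, graph_comp_graph]
      refine graph_congr fun p => ?_
      have h : ∀ a b : C, (α_ a (𝟙_ C) b).hom ≫ (𝟙 a ⊗ₘ (λ_ b).hom) =
          ((ρ_ a).hom ⊗ₘ 𝟙 b) := by
        intro a b; simp
      exact h (A.X p.1.1) (B.X p.2))

theorem entry_whiskerLeft (A : SumCompletion C) {B B' : SumCompletion C} (f : B ⟶ B')
    (s s' : A.ι) (t : B.ι) (t' : B'.ι) :
    entry (A := A ⊗ B) (B := A ⊗ B') (A ◁ f) (s, t) (s', t') = entry (𝟙 A) s s' ⊗ₘ entry f t t' :=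
  entry_tensorHom (𝟙 A) f s t s' t'

theorem entry_whiskerRight {A A' : SumCompletion C} (f : A ⟶ A') (B : SumCompletion C)
    (s : A.ι) (s' : A'.ι) (t t' : B.ι) :
    entry (A := A ⊗ B) (B := A' ⊗ B) (f ▷ B) (s, t) (s', t') = entry f s s' ⊗ₘ entry (𝟙 B) t t' :=
  entry_tensorHom f (𝟙 B) s t s' t'

theorem whiskerLeft_graph (A : SumCompletion C) {B B' : SumCompletion C} (e : B.ι → B'.ι)
    (φ : ∀ s, B.X s ⟶ B'.X (e s)) :
    A ◁ graph e φ = graph (A := A ⊗ B) (B := A ⊗ B') (fun p => (p.1, e p.2))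
      fun p => A.X p.1 ◁ φ p.2 := by
  rw [← MonoidalCategory.id_tensorHom, id_eq_graph, graph_tensorHom_graph]
  exact graph_congr fun p => MonoidalCategory.id_tensorHom _ _

theorem graph_whiskerRight {A A' : SumCompletion C} (e : A.ι → A'.ι)
    (φ : ∀ s, A.X s ⟶ A'.X (e s)) (B : SumCompletion C) :
    graph e φ ▷ B = graph (A := A ⊗ B) (B := A' ⊗ B) (fun p => (e p.1, p.2))
      fun p => φ p.1 ▷ B.X p.2 := by
  rw [← MonoidalCategory.tensorHom_id, id_eq_graph, graph_tensorHom_graph]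
  exact graph_congr fun p => MonoidalCategory.tensorHom_id _ _

instance : MonoidalPreadditive (SumCompletion C) where
  whiskerLeft_zero {A B B'} := hom_ext (A := A ⊗ B) (B := A ⊗ B') fun ⟨s, t⟩ ⟨s', t'⟩ => by
    rw [entry_whiskerLeft, entry_zero, entry_zero, MonoidalPreadditive.tensor_zero]
  zero_whiskerRight {A B B'} := hom_ext (A := B ⊗ A) (B := B' ⊗ A) fun ⟨s, t⟩ ⟨s', t'⟩ => by
    rw [entry_whiskerRight, entry_zero, entry_zero, MonoidalPreadditive.zero_tensor]
  whiskerLeft_add {A B B'} f g := hom_ext (A := A ⊗ B) (B := A ⊗ B') fun ⟨s, t⟩ ⟨s', t'⟩ => by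
    rw [entry_whiskerLeft, entry_add, entry_add, MonoidalPreadditive.tensor_add,
      entry_whiskerLeft, entry_whiskerLeft]
  add_whiskerRight {A B B'} f g := hom_ext (A := B ⊗ A) (B := B' ⊗ A) fun ⟨s, t⟩ ⟨s', t'⟩ => by
    rw [entry_whiskerRight, entry_add, entry_add, MonoidalPreadditive.add_tensor,
      entry_whiskerRight, entry_whiskerRight]

instance {R : Type*} [CommRing R] [Linear R C] [MonoidalLinear R C] :
    MonoidalLinear R (SumCompletion C) where
  whiskerLeft_smul A B B' c f := hom_ext (A := A ⊗ B) (B := A ⊗ B') fun ⟨s, t⟩ ⟨s', t'⟩ => by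
    rw [entry_whiskerLeft, entry_smul, entry_smul, entry_whiskerLeft,
      MonoidalCategory.tensorHom_def, MonoidalCategory.tensorHom_def, MonoidalLinear.whiskerLeft_smul,
      Linear.comp_smul]
  smul_whiskerRight c B B' f A := hom_ext (A := B ⊗ A) (B := B' ⊗ A) fun ⟨s, t⟩ ⟨s', t'⟩ => by
    rw [entry_whiskerRight, entry_smul, entry_smul, entry_whiskerRight,
      MonoidalCategory.tensorHom_def, MonoidalCategory.tensorHom_def,
      MonoidalLinear.smul_whiskerRight, Linear.smul_comp]

variable [BraidedCategory C]

/-- The braiding of `⨁ s, X s` and `⨁ t, Y t`, with components the braidings of `X s` and `Y t`. -/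
def braid (A B : SumCompletion C) : A ⊗ B ≅ B ⊗ A :=
  graphIso (A := A ⊗ B) (B := B ⊗ A) (Equiv.prodComm A.ι B.ι) fun p => β_ (A.X p.1) (B.X p.2)

theorem braid_hom_eq (A B : SumCompletion C) : (braid A B).hom =
    graph (A := A ⊗ B) (B := B ⊗ A) (fun p => (p.2, p.1)) fun p => (β_ (A.X p.1) (B.X p.2)).hom :=
  rfl

theorem braid_naturality {A A' B B' : SumCompletion C} (f : A ⟶ A') (g : B ⟶ B') :
    (f ⊗ₘ g) ≫ (braid A' B').hom = (braid A B).hom ≫ (g ⊗ₘ f) := by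
  rw [braid_hom_eq, braid_hom_eq]
  refine hom_ext (A := A ⊗ B) (B := B' ⊗ A') ?_
  rintro ⟨s, t⟩ ⟨t', s'⟩
  refine (entry_comp_graph (A := A ⊗ B) (B := A' ⊗ B') (D := B' ⊗ A') _ _ _
    (Equiv.prodComm A'.ι B'.ι).injective (s, t) (s', t')).trans ?_
  rw [entry_graph_comp, entry_tensorHom, entry_tensorHom]
  exact BraidedCategory.braiding_naturality _ _

instance : BraidedCategory (SumCompletion C) where
  braiding := braid
  braiding_naturality_right A B B' f := by
    rw [← MonoidalCategory.id_tensorHom, ← MonoidalCategory.tensorHom_id, braid_naturality]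
  braiding_naturality_left f A := by
    rw [← MonoidalCategory.id_tensorHom, ← MonoidalCategory.tensorHom_id, braid_naturality]
  hexagon_forward A B D := by
    simp only [associator_hom_eq, braid_hom_eq, graph_whiskerRight, whiskerLeft_graph,
      graph_comp_graph]
    exact graph_congr fun p => BraidedCategory.hexagon_forward _ _ _
  hexagon_reverse A B D := by
    have h : ∀ (A B D : SumCompletion C), (α_ A B D).inv =
        graph (A := A ⊗ B ⊗ D) (B := (A ⊗ B) ⊗ D) (fun p => ((p.1, p.2.1), p.2.2))
          fun p => (α_ (A.X p.1) (B.X p.2.1) (D.X p.2.2)).inv := by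
      intro A B D
      refine hom_ext (A := A ⊗ B ⊗ D) (B := (A ⊗ B) ⊗ D) ?_
      rintro ⟨s, t, r⟩ q
      rw [← Category.comp_id (α_ A B D).inv, entry_associator_inv_comp,
        ← Category.comp_id (graph _ _), entry_graph_comp]
    simp only [h, braid_hom_eq, graph_whiskerRight, whiskerLeft_graph, graph_comp_graph]
    exact graph_congr fun p => BraidedCategory.hexagon_reverse _ _ _

theorem braiding_hom_eq (A B : SumCompletion C) : (β_ A B).hom =
    graph (A := A ⊗ B) (B := B ⊗ A) (fun p => (p.2, p.1)) fun p => (β_ (A.X p.1) (B.X p.2)).hom :=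
  rfl

/-- The twist of the completion: the twist of `C` on every summand. -/
def twist (θ : Twist C) : Twist (SumCompletion C) where
  app A := graphIso (Equiv.refl A.ι) fun s => θ.app (A.X s)
  naturality {A B} f := hom_ext fun s t =>
    (entry_comp_graph f _ _ (Equiv.refl B.ι).injective s t).trans
      ((θ.naturality _).trans (entry_graph_comp (A := A) (B := A) id
        (fun s => (θ.app (A.X s)).hom) f s t).symm)
  balancing A B := by
    show graph (A := A ⊗ B) (B := A ⊗ B) id (fun p => (θ.app (A.X p.1 ⊗ B.X p.2)).hom) =
      (graph (A := A) (B := A) id (fun s => (θ.app (A.X s)).hom) ⊗ₘ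
        graph (A := B) (B := B) id (fun s => (θ.app (B.X s)).hom)) ≫ _
    simp only [braiding_hom_eq, graph_tensorHom_graph, graph_comp_graph]
    exact graph_congr fun p => θ.balancing _ _

end Monoidal

end SumCompletion

/-! ### Modules over an algebra object -/

section Modules

universe v u

variable {C : Type u} [Category.{v} C] [MonoidalCategory C] (A : C) [MonObj A]

open scoped MonObj

variable {A} in
/-- The action map `A ⊗ M ⟶ M` of an `A`-module. -/
def act (M : Mod C A) : A ⊗ M.X ⟶ M.X := ModObj.smul (M := A) (X := M.X)

variable {A} in
theorem act_comp {M N : Mod C A} (f : M ⟶ N) : act M ≫ f.hom = A ◁ f.hom ≫ act N :=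
  IsModHom.smul_hom (A := A) (f := f.hom)

/-- The `A`-module with underlying object `X` and action map `m`. -/
def mkMod (X : C) (m : A ⊗ X ⟶ X) (one : η ▷ X ≫ m = (λ_ X).hom)
    (mul : μ ▷ X ≫ m = (α_ A A X).hom ≫ A ◁ m ≫ m) : Mod C A :=
  letI : ModObj A X := { smul := m, one_smul := one, mul_smul := mul }
  ⟨X⟩

/-- The induction functor `V ↦ A ⊗ V` to `A`-modules, where `A` acts by multiplication on the left
factor. -/
def induction : C ⥤ Mod C A where
  obj V := mkMod A (A ⊗ V) ((α_ A A V).inv ≫ μ ▷ V)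
    (by
      have h : (λ_ (A ⊗ V)).hom = (α_ (𝟙_ C) A V).inv ≫ (λ_ A).hom ▷ V := by simp
      rw [h, ← MonObj.one_mul A, comp_whiskerRight]
      simp)
    (by
      have h : (α_ A A A).hom ▷ V ≫ (A ◁ (μ : A ⊗ A ⟶ A)) ▷ V ≫ (μ : A ⊗ A ⟶ A) ▷ V =
          ((μ : A ⊗ A ⟶ A) ▷ A) ▷ V ≫ (μ : A ⊗ A ⟶ A) ▷ V := by
        simp only [← comp_whiskerRight, MonObj.mul_assoc]
      have h1 : (μ : A ⊗ A ⟶ A) ▷ (A ⊗ V) ≫ (α_ A A V).inv =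
          (α_ (A ⊗ A) A V).inv ≫ ((μ : A ⊗ A ⟶ A) ▷ A) ▷ V := by simp
      have h2 : A ◁ ((μ : A ⊗ A ⟶ A) ▷ V) ≫ (α_ A A V).inv =
          (α_ A (A ⊗ A) V).inv ≫ (A ◁ (μ : A ⊗ A ⟶ A)) ▷ V := by simp
      rw [MonoidalCategory.whiskerLeft_comp, Category.assoc, reassoc_of% h1, reassoc_of% h2, ← h]
      simp)
  map {V W} f := Mod.Hom.mk' (A ◁ f) (by
    show ((α_ A A V).inv ≫ μ ▷ V) ≫ A ◁ f = A ◁ (A ◁ f) ≫ (α_ A A W).inv ≫ μ ▷ W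
    rw [Category.assoc, ← whisker_exchange]
    simp)
  map_id V := Mod.hom_ext _ _ (whiskerLeft_id A V)
  map_comp f g := Mod.hom_ext _ _ (MonoidalCategory.whiskerLeft_comp A f g)

section Linear

variable [Preadditive C] [MonoidalPreadditive C]

variable {A}

/-- Module morphisms as a subgroup of all morphisms. -/
def modHomSubgroup (M N : Mod C A) : AddSubgroup (M.X ⟶ N.X) where
  carrier := {f | act M ≫ f = A ◁ f ≫ act N}
  zero_mem' := by simp
  add_mem' {f g} hf hg := by
    have hf' : act M ≫ f = A ◁ f ≫ act N := hf
    have hg' : act M ≫ g = A ◁ g ≫ act N := hg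
    show act M ≫ (f + g) = A ◁ (f + g) ≫ act N
    rw [Preadditive.comp_add, hf', hg', MonoidalPreadditive.whiskerLeft_add, Preadditive.add_comp]
  neg_mem' {f} hf := by
    have hf' : act M ≫ f = A ◁ f ≫ act N := hf
    show act M ≫ (-f) = A ◁ (-f) ≫ act N
    have h : A ◁ (-f) = -(A ◁ f) := by
      rw [eq_neg_iff_add_eq_zero, ← MonoidalPreadditive.whiskerLeft_add, neg_add_cancel,
        MonoidalPreadditive.whiskerLeft_zero]
    rw [Preadditive.comp_neg, hf', h, Preadditive.neg_comp]

/-- The identification of module morphisms with morphisms that commute with the actions. -/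
def modHomEquiv (M N : Mod C A) : (M ⟶ N) ≃ modHomSubgroup M N where
  toFun f := ⟨f.hom, act_comp f⟩
  invFun f := Mod.Hom.mk' f.1 f.2
  left_inv _ := rfl
  right_inv _ := rfl

instance (M N : Mod C A) : AddCommGroup (M ⟶ N) := (modHomEquiv M N).addCommGroup

@[simp] theorem mod_add_hom {M N : Mod C A} (f g : M ⟶ N) : (f + g).hom = f.hom + g.hom := rfl
@[simp] theorem mod_zero_hom {M N : Mod C A} : (0 : M ⟶ N).hom = 0 := rfl

instance : Preadditive (Mod C A) where
  add_comp _ _ _ _ _ _ := Mod.hom_ext _ _ (Preadditive.add_comp _ _ _ _ _ _)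
  comp_add _ _ _ _ _ _ := Mod.hom_ext _ _ (Preadditive.comp_add _ _ _ _ _ _)

variable {R : Type*} [CommRing R] [Linear R C] [MonoidalLinear R C]

instance (M N : Mod C A) : SMul R (M ⟶ N) :=
  ⟨fun c f => Mod.Hom.mk' (c • f.hom) (by
    show act M ≫ (c • f.hom) = A ◁ (c • f.hom) ≫ act N
    rw [Linear.comp_smul, act_comp, MonoidalLinear.whiskerLeft_smul, Linear.smul_comp])⟩

@[simp] theorem mod_smul_hom {M N : Mod C A} (c : R) (f : M ⟶ N) : (c • f).hom = c • f.hom := rfl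

instance (M N : Mod C A) : Module R (M ⟶ N) where
  one_smul _ := Mod.hom_ext _ _ (one_smul _ _)
  mul_smul _ _ _ := Mod.hom_ext _ _ (mul_smul _ _ _)
  smul_zero _ := Mod.hom_ext _ _ (smul_zero _)
  smul_add _ _ _ := Mod.hom_ext _ _ (smul_add _ _ _)
  add_smul _ _ _ := Mod.hom_ext _ _ (add_smul _ _ _)
  zero_smul _ := Mod.hom_ext _ _ (zero_smul _ _)

instance : Linear R (Mod C A) where
  smul_comp _ _ _ _ _ _ := Mod.hom_ext _ _ (Linear.smul_comp _ _ _ _ _ _)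
  comp_smul _ _ _ _ _ _ := Mod.hom_ext _ _ (Linear.comp_smul _ _ _ _ _ _)

end Linear

variable [BraidedCategory C]

/-- An `A`-module `M` is local if its action map absorbs the double braiding of `A` and `M`. -/
def IsLocal : ObjectProperty (Mod C A) := fun M =>
  (β_ A M.X).hom ≫ (β_ M.X A).hom ≫ act M = act M

/-- The category `Rep⁰ A` of local `A`-modules. -/
abbrev Rep0 : Type _ := (IsLocal A).FullSubcategory

namespace Rep0

variable {A}

/-- The object of `C` underlying a local module. -/
abbrev carrier (M : Rep0 A) : C := M.obj.X

/-- The morphism of `C` underlying a morphism of local modules. -/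
abbrev toHom {M N : Rep0 A} (f : M ⟶ N) : carrier M ⟶ carrier N := f.hom.hom

/-- The map `M ⊗ (A ⊗ N) ⟶ M ⊗ N` given by the (right) action of `A` on `M`. -/
def mLeft (M N : Rep0 A) : carrier M ⊗ (A ⊗ carrier N) ⟶ carrier M ⊗ carrier N :=
  (α_ (carrier M) A (carrier N)).inv ≫ (β_ (carrier M) A).hom ▷ carrier N ≫
    act M.obj ▷ carrier N

/-- The map `M ⊗ (A ⊗ N) ⟶ M ⊗ N` given by the action of `A` on `N`. -/
def mRight (M N : Rep0 A) : carrier M ⊗ (A ⊗ carrier N) ⟶ carrier M ⊗ carrier N :=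
  carrier M ◁ act N.obj

variable (A) in
/-- A given braided monoidal structure on `Rep⁰ A` is that of the relative tensor product `⊗_A`:
`M ⊗_A N` is the quotient of `M ⊗ N` by the image of `mLeft - mRight`, with the action of `A`
induced by the action on `M`, and the tensor product of morphisms, the unit object `A` and all
constraints are the ones induced from those of the ambient category along the quotient maps. -/
structure RelTensor [MonoidalCategory (Rep0 A)] [BraidedCategory (Rep0 A)] where
  /-- The quotient map `M ⊗ N ⟶ M ⊗_A N`. -/
  proj (M N : Rep0 A) : carrier M ⊗ carrier N ⟶ carrier (M ⊗ N)
  condition (M N : Rep0 A) : mLeft M N ≫ proj M N = mRight M N ≫ proj M N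
  isCoequalizer (M N : Rep0 A) :
    Nonempty (Limits.IsColimit (Limits.Cofork.ofπ (proj M N) (condition M N)))
  act_tensor (M N : Rep0 A) : A ◁ proj M N ≫ act (M ⊗ N).obj =
    (α_ A (carrier M) (carrier N)).inv ≫ act M.obj ▷ carrier N ≫ proj M N
  tensorHom {M M' N N' : Rep0 A} (f : M ⟶ M') (g : N ⟶ N') :
    proj M N ≫ toHom (f ⊗ₘ g) = (toHom f ⊗ₘ toHom g) ≫ proj M' N'
  associator (M N P : Rep0 A) :
    proj M N ▷ carrier P ≫ proj (M ⊗ N) P ≫ toHom (α_ M N P).hom =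
      (α_ (carrier M) (carrier N) (carrier P)).hom ≫ carrier M ◁ proj N P ≫ proj M (N ⊗ P)
  /-- The identification of the unit object with `A`. -/
  unitIso : A ≅ carrier (𝟙_ (Rep0 A))
  act_unit : μ ≫ unitIso.hom = A ◁ unitIso.hom ≫ act (𝟙_ (Rep0 A)).obj
  leftUnitor (M : Rep0 A) :
    unitIso.hom ▷ carrier M ≫ proj (𝟙_ (Rep0 A)) M ≫ toHom (λ_ M).hom = act M.obj
  rightUnitor (M : Rep0 A) :
    carrier M ◁ unitIso.hom ≫ proj M (𝟙_ (Rep0 A)) ≫ toHom (ρ_ M).hom =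
      (β_ (carrier M) A).hom ≫ act M.obj
  braiding (M N : Rep0 A) :
    proj M N ≫ toHom (β_ M N).hom = (β_ (carrier M) (carrier N)).hom ≫ proj N M

end Rep0

end Modules

/-- The objects that are isomorphic to a finite direct sum of simple objects. -/
def isFiniteSumOfSimples (D : Type*) [Category D] [Preadditive D] : ObjectProperty D := fun X =>
  ∃ (n : ℕ) (f : Fin n → D) (b : Limits.Bicone f), (∀ i, Simple (f i)) ∧ Nonempty b.IsBilimit ∧
    Nonempty (b.pt ≅ X)

/-! ### The lattice algebra -/

/-- The even lattice `L = √(2N) ℤ`. -/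
def lattice (N : ℕ) : AddSubgroup ℝ := AddSubgroup.zmultiples (Real.sqrt (2 * N))

/-- The object `V_L = ⨁ F_lam`, `lam ∈ L`, of the direct sum completion. -/
def VL (N : ℕ) : SumCompletion FockCat := ⟨lattice N, fun l => ⟨l⟩⟩

namespace VL

open SumCompletion

variable (N : ℕ)

theorem braidScalar_lattice (x y : lattice N) : FockCat.braidScalar x y = 1 := by
  obtain ⟨_, m, rfl⟩ := x
  obtain ⟨_, n, rfl⟩ := y
  have h : ((Real.sqrt (2 * N) : ℝ) : ℂ) * (Real.sqrt (2 * N) : ℝ) = 2 * N := by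
    rw [← Complex.ofReal_mul, Real.mul_self_sqrt (by positivity)]; push_cast; rfl
  rw [FockCat.braidScalar, Complex.exp_eq_one_iff]
  refine ⟨m * n * N, ?_⟩
  simp only [zsmul_eq_mul]
  push_cast
  linear_combination (Real.pi * Complex.I * m * n : ℂ) * h

/-- The sum in the lattice, as a map of index sets. -/
def add (p : (VL N ⊗ VL N).ι) : (VL N).ι :=
  ((show lattice N from p.1) + (show lattice N from p.2) : lattice N)

/-- The zero of the lattice, as a map of index sets. -/
def zero (_ : (𝟙_ (SumCompletion FockCat)).ι) : (VL N).ι := (0 : lattice N)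

/-- The component `Id : F_lam ⊗ F_mu ⟶ F_{lam + mu}` of the multiplication. -/
def mulComp (p : (VL N ⊗ VL N).ι) : (VL N ⊗ VL N).X p ⟶ (VL N).X (add N p) :=
  FockCat.scalar _ _ 1

/-- The component `Id : F_0 ⟶ F_0` of the unit. -/
def oneComp (p : (𝟙_ (SumCompletion FockCat)).ι) :
    (𝟙_ (SumCompletion FockCat)).X p ⟶ (VL N).X (zero N p) :=
  FockCat.scalar _ _ 1

@[simp] theorem coef_mulComp (p : (VL N ⊗ VL N).ι) : FockCat.coef (mulComp N p) = 1 :=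
  FockCat.coef_scalar rfl 1

@[simp] theorem coef_oneComp (p : (𝟙_ (SumCompletion FockCat)).ι) :
    FockCat.coef (oneComp N p) = 1 :=
  FockCat.coef_scalar rfl 1

/-- The algebra structure of `V_L`: the multiplication has components
`Id : F_lam ⊗ F_mu ⟶ F_{lam + mu}`, and the unit is `Id : F_0 ⟶ F_0`. -/
instance : MonObj (VL N) where
  one := graph (zero N) (oneComp N)
  mul := graph (add N) (mulComp N)
  one_mul := by
    rw [graph_whiskerRight, leftUnitor_hom_eq]
    refine (graph_comp_graph _ _ _ _).trans ?_
    refine graph_ext (A := 𝟙_ (SumCompletion FockCat) ⊗ VL N) (B := VL N)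
      (fun p => zero_add (show lattice N from p.2)) fun p => FockCat.hom_ext ?_
    rw [FockCat.coef_comp, FockCat.coef_eqToHom, FockCat.coef_comp, coef_mulComp]
    refine (congrArg (· * 1 * 1) (FockCat.coef_whiskerRight _ _)).trans ?_
    rw [coef_oneComp, FockCat.coef_leftUnitor_hom, mul_one, mul_one]
  mul_one := by
    rw [whiskerLeft_graph, rightUnitor_hom_eq]
    refine (graph_comp_graph _ _ _ _).trans ?_
    refine graph_ext (A := VL N ⊗ 𝟙_ (SumCompletion FockCat)) (B := VL N)
      (fun p => add_zero (show lattice N from p.1)) fun p => FockCat.hom_ext ?_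
    rw [FockCat.coef_comp, FockCat.coef_eqToHom, FockCat.coef_comp, coef_mulComp]
    refine (congrArg (· * 1 * 1) (FockCat.coef_whiskerLeft _ _)).trans ?_
    rw [coef_oneComp, FockCat.coef_rightUnitor_hom, mul_one, mul_one]
  mul_assoc := by
    rw [graph_whiskerRight, whiskerLeft_graph, associator_hom_eq]
    refine (graph_comp_graph _ _ _ _).trans (Eq.trans ?_
      (congrArg _ (graph_comp_graph _ _ _ _)).symm)
    refine Eq.trans ?_ (graph_comp_graph _ _ _ _).symm
    refine graph_ext (A := (VL N ⊗ VL N) ⊗ VL N) (B := VL N)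
      (fun p => add_assoc (show lattice N from p.1.1) (show lattice N from p.1.2)
        (show lattice N from p.2)) fun p => FockCat.hom_ext ?_
    rw [FockCat.coef_comp, FockCat.coef_eqToHom, FockCat.coef_comp, coef_mulComp]
    refine (congrArg (· * 1 * 1) (FockCat.coef_whiskerRight _ _)).trans ?_
    rw [FockCat.coef_comp, FockCat.coef_comp, coef_mulComp, coef_mulComp,
      FockCat.coef_associator_hom]
    refine Eq.trans ?_ (congrArg (fun c : ℂ => 1 * (c * 1)) (FockCat.coef_whiskerLeft _ _)).symm
    rw [coef_mulComp]
    norm_num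

instance : IsCommMonObj (VL N) where
  mul_comm := by
    show _ ≫ graph (add N) (mulComp N) = graph (add N) (mulComp N)
    rw [braiding_hom_eq]
    refine (graph_comp_graph _ _ _ _).trans ?_
    refine graph_ext (A := VL N ⊗ VL N) (B := VL N)
      (fun p => add_comm (show lattice N from p.2) (show lattice N from p.1))
      fun p => FockCat.hom_ext ?_
    rw [FockCat.coef_comp, FockCat.coef_eqToHom, FockCat.coef_comp, coef_mulComp, coef_mulComp,
      FockCat.coef_braiding_hom]
    refine (congrArg (· * 1 * 1) (braidScalar_lattice N p.1 p.2)).trans ?_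
    norm_num

end VL

/-! ### Representatives of `L* / L` -/

/-- The set `{0, …, 2N-1} / √(2N)` of representatives of the cosets of `L` in its dual lattice. -/
@[ext] structure Reps (N : ℕ) where
  /-- The underlying real number. -/
  val : ℝ
  mem : ∃ a : ℕ, a < 2 * N ∧ val = a / Real.sqrt (2 * N)

namespace Reps

variable {N : ℕ}

/-- The two-cocycle `k(x, y)`, equal to `√(2N)` if `x + y ≥ √(2N)` and to `0` otherwise. -/
def k (x y : Reps N) : ℝ :=
  if Real.sqrt (2 * N) ≤ x.val + y.val then Real.sqrt (2 * N) else 0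

theorem add_mem (x y : Reps N) :
    ∃ a : ℕ, a < 2 * N ∧ x.val + y.val - k x y = a / Real.sqrt (2 * N) := by
  obtain ⟨a, ha, hx⟩ := x.mem
  obtain ⟨b, hb, hy⟩ := y.mem
  have hN : (0 : ℝ) < 2 * N := by
    have : 0 < 2 * N := by omega
    exact_mod_cast this
  have hs : 0 < Real.sqrt (2 * N) := Real.sqrt_pos.2 hN
  have hxy : x.val + y.val = ((a + b : ℕ) : ℝ) / Real.sqrt (2 * N) := by
    rw [hx, hy]; push_cast; ring
  have key : Real.sqrt (2 * N) ≤ x.val + y.val ↔ 2 * N ≤ a + b := by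
    rw [hxy, le_div_iff₀ hs, Real.mul_self_sqrt hN.le]
    exact_mod_cast Iff.rfl
  by_cases h : Real.sqrt (2 * N) ≤ x.val + y.val
  · have h' := key.1 h
    refine ⟨a + b - 2 * N, by omega, ?_⟩
    rw [k, if_pos h, hxy, Nat.cast_sub h', sub_div]
    congr 1
    rw [eq_div_iff hs.ne', Real.mul_self_sqrt hN.le]
    push_cast
    rfl
  · have h' := mt key.2 h
    refine ⟨a + b, by omega, ?_⟩
    rw [k, if_neg h, hxy, sub_zero]

/-- The representative `x + y - k(x, y)` of the coset of `x + y`. -/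
def add (x y : Reps N) : Reps N := ⟨x.val + y.val - k x y, add_mem x y⟩

@[simp] theorem add_val (x y : Reps N) : (x.add y).val = x.val + y.val - k x y := rfl

end Reps

/-- The induced module `𝓕(F_x) = V_L ⊗ F_x`. -/
def inducedFock {N : ℕ} (x : Reps N) : Mod (SumCompletion FockCat) (VL N) :=
  (induction (VL N)).obj ((SumCompletion.inclusion FockCat).obj ⟨x.val⟩)

/-- The category `Rep⁰ V_L` of local `V_L`-modules in the direct sum completion. -/
abbrev RepVL (N : ℕ) : Type _ := Rep0 (VL N)

end HeisenbergLattice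

end

open HeisenbergLattice

noncomputable section

namespace HeisenbergLattice

/-! ### Matrices of scalars -/

/-! Module maps between Fock modules are scalars, and they vanish between distinct weights. An
object of the direct sum completion is therefore a real-graded vector space with a homogeneous
basis, and a morphism is a weight-preserving linear map; `lin` is this faithful passage to linear
algebra, and it turns every identity of structure maps into a computation on basis vectors. In this
picture $V_L$ has basis $e_l$, $l\in L$, with $e_l e_m=e_{l+m}$, and the braiding multiplies vectors
of weights $x,y$ by $e^{\pi i xy}$.

On a $V_L$-module $e_{-l}$ inverts $e_l$, so locality on a vector of weight $w$ forces $e^{2\pi i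
lw}=1$ for $l=\sqrt{2N}$, that is $w\sqrt{2N}\in\mathbb Z$ (`exists_mul_period_of_isLocal`). Such a
$w$ is uniquely $l+x$ with $l\in L$, $x\in R$, and $e_l$ carries weight $x$ isomorphically to weight
$w$. Thus a local module is induced from its summands with weight in $R$ (`coreIso`), a module map
is determined by its restriction to them, and `ind` is an equivalence from the direct sums of
objects of the pointed category `Pt N`. The classification of the simple modules is then that of the
simple objects `Pt.single x`.

For the tensor product, send $(e_l\otimes s)\otimes(e_m\otimes t)$, with $s,t$ of weights $x,y\in
R$, to $e^{\pi i xm}\,e_{l+m+k(x,y)}\otimes(s\otimes t)$. The phase is the cost of moving $e_m$ past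
$s$, and the shift by $k$ restores the weight. This map `pj` is a split coequalizer of the two
actions (`pj_condition`, `sec_pj`, `pj_sec_comp`), so it exhibits the relative tensor product.
Comparing the two bracketings of a triple product, $e_{k(y,z)}$ has to pass $s$ on one side only;
this yields the associator $e^{\pi i x k(y,z)}=(-1)^{x k(y,z)}$ (`pj_associator`). The pentagon and
the hexagons in `Pt N` follow from the cocycle identity of $k$, the evenness of $L$ and $e^{2\pi i
xl}=1$ for $x\in R$, $l\in L$.

The structure of `SumCompletion (Pt N)` is transported along the equivalence, and `relTensor`
identifies the result with the relative tensor product. On the skeleton, the comparison maps for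
$\mathscr F(\mathcal F_x)\otimes\mathscr F(\mathcal F_y)$ are chosen to match fixed generators
(`exists_tensor`), so the constraints there are exactly the scalars of `Pt N`. Rigidity comes from
explicit dual bases of finite direct sums (`Pt.exactPairing`). -/

/-- A preadditive category with a faithful additive functor to the one-object category `ℂ`. -/
class ScalarCat (C : Type*) [Category C] [Preadditive C] where
  /-- The scalar of a morphism. -/
  coef {X Y : C} : (X ⟶ Y) →+ ℂ
  coef_id (X : C) : coef (𝟙 X) = 1
  coef_comp {X Y Z : C} (f : X ⟶ Y) (g : Y ⟶ Z) : coef (f ≫ g) = coef f * coef g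
  coef_injective {X Y : C} : Function.Injective (coef : (X ⟶ Y) →+ ℂ)

/-- A monoidal category of scalars, in which the tensor product of morphisms is the product. -/
class MonoidalScalarCat (C : Type*) [Category C] [Preadditive C] [MonoidalCategory C] extends
    ScalarCat C where
  coef_tensorHom {X Y X' Y' : C} (f : X ⟶ Y) (g : X' ⟶ Y') :
    coef (f ⊗ₘ g) = coef f * coef g

namespace ScalarCat

attribute [simp] coef_id coef_comp

variable {C : Type*} [Category C] [Preadditive C] [ScalarCat C]

theorem coef_ne_zero_iff {X Y : C} (f : X ⟶ Y) : coef f ≠ 0 ↔ f ≠ 0 :=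
  not_congr (map_eq_zero_iff _ coef_injective)

end ScalarCat

namespace FockCat

instance : MonoidalScalarCat FockCat where
  coef := { toFun := FockCat.coef, map_zero' := FockCat.coef_zero _ _, map_add' := coef_add }
  coef_id := FockCat.coef_id
  coef_comp := FockCat.coef_comp
  coef_injective {_ _} _ _ h := FockCat.hom_ext h
  coef_tensorHom := coef_tensorHom

theorem scalarCat_coef {X Y : FockCat} (f : X ⟶ Y) : ScalarCat.coef f = FockCat.coef f := rfl

end FockCat

namespace SumCompletion

section Vec

variable {C : Type*}

/-- The vector space with basis the summands of an object. -/
abbrev Vec (A : SumCompletion C) : Type := A.ι →₀ ℂ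

/-- The basis vector of a summand. -/
abbrev bs (A : SumCompletion C) (s : A.ι) : Vec A := Finsupp.single s 1

@[elab_as_elim] theorem bs_induction {A : SumCompletion C} {p : Vec A → Prop} (u : Vec A)
    (zero : p 0) (add : ∀ u v, p u → p v → p (u + v)) (smul : ∀ (c : ℂ) u, p u → p (c • u))
    (basis : ∀ s, p (bs A s)) : p u := by
  induction u using Finsupp.induction_linear with
  | zero => exact zero
  | add u v hu hv => exact add u v hu hv
  | single s c =>
    have h := smul c _ (basis s)
    rwa [Finsupp.smul_single, smul_eq_mul, mul_one] at h

end Vec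

section Lin

variable {C : Type*} [Category C] [Preadditive C] [ScalarCat C]

/-- The image of a basis vector. -/
def col {A B : SumCompletion C} (f : A ⟶ B) (s : A.ι) : Vec B :=
  Finsupp.ofSupportFinite (fun t => ScalarCat.coef (entry f s t))
    ((entry_finite f s).subset fun _ ht => (ScalarCat.coef_ne_zero_iff _).1 ht)

theorem col_apply {A B : SumCompletion C} (f : A ⟶ B) (s : A.ι) (t : B.ι) :
    col f s t = ScalarCat.coef (entry f s t) := rfl

/-- The linear map given by the matrix of scalars of a morphism. -/
def lin {A B : SumCompletion C} (f : A ⟶ B) : Vec A →ₗ[ℂ] Vec B :=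
  Finsupp.linearCombination ℂ (col f)

theorem lin_bs {A B : SumCompletion C} (f : A ⟶ B) (s : A.ι) : lin f (bs A s) = col f s := by
  simp [lin]

theorem lin_bs_apply {A B : SumCompletion C} (f : A ⟶ B) (s : A.ι) (t : B.ι) :
    lin f (bs A s) t = ScalarCat.coef (entry f s t) := by
  rw [lin_bs, col_apply]

/-- A matrix is determined by its columns and `coef` is injective on each entry. This is the tool by
which categorical identities become calculations with vectors. -/
theorem hom_ext_bs {A B : SumCompletion C} {f g : A ⟶ B}
    (h : ∀ s, lin f (bs A s) = lin g (bs A s)) : f = g :=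
  hom_ext fun s t => ScalarCat.coef_injective (by rw [← lin_bs_apply, h, lin_bs_apply])

theorem lin_injective {A B : SumCompletion C} {f g : A ⟶ B} (h : lin f = lin g) : f = g :=
  hom_ext_bs fun s => by rw [h]

@[simp] theorem lin_id (A : SumCompletion C) : lin (𝟙 A) = LinearMap.id := by
  refine Finsupp.lhom_ext' fun s => LinearMap.ext_ring (Finsupp.ext fun t => ?_)
  refine (lin_bs_apply _ s t).trans ?_
  rw [id_eq_graph]
  by_cases h : s = t
  · subst h
    refine (congrArg _ (entry_graph_self (A := A) (B := A) id (fun s => 𝟙 (A.X s)) s)).trans ?_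
    simp
  · rw [entry_graph_of_ne (A := A) (B := A) id _ h]
    simp [h]

@[simp] theorem lin_comp {A B D : SumCompletion C} (f : A ⟶ B) (g : B ⟶ D) :
    lin (f ≫ g) = lin g ∘ₗ lin f := by
  refine Finsupp.lhom_ext' fun s => LinearMap.ext_ring (Finsupp.ext fun r => ?_)
  refine (lin_bs_apply _ s r).trans ?_
  rw [entry_comp f g s r (entry_finite f s).toFinset
    fun t ht => (entry_finite f s).mem_toFinset.2 ht, map_sum]
  show _ = lin g (lin f (bs A s)) r
  rw [lin_bs]
  -- Column finiteness lets the linear combination be summed over the same finite set that computes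
  -- the entry of the composite.
  have h : lin g (col f s) = ∑ t ∈ (entry_finite f s).toFinset, col f s t • col g t := by
    refine Finsupp.linearCombination_apply_of_mem_supported ℂ (s := (entry_finite f s).toFinset) ?_
    intro t ht
    rw [Set.Finite.coe_toFinset]
    exact (ScalarCat.coef_ne_zero_iff _).1 (Finsupp.mem_support_iff.1 ht)
  rw [h, Finsupp.finsetSum_apply]
  exact Finset.sum_congr rfl fun t _ => ScalarCat.coef_comp _ _

theorem lin_comp_apply {A B D : SumCompletion C} (f : A ⟶ B) (g : B ⟶ D) (v : Vec A) :
    lin (f ≫ g) v = lin g (lin f v) := by rw [lin_comp, LinearMap.comp_apply]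

theorem lin_id_apply (A : SumCompletion C) (v : Vec A) : lin (𝟙 A) v = v := by simp

theorem lin_graph {A B : SumCompletion C} (e : A.ι → B.ι) (φ : ∀ s, A.X s ⟶ B.X (e s))
    (s : A.ι) : lin (graph e φ) (bs A s) = ScalarCat.coef (φ s) • bs B (e s) := by
  ext t
  rw [lin_bs_apply]
  by_cases h : e s = t
  · subst h
    simp [entry_graph_self]
  · rw [entry_graph_of_ne _ _ h]
    simp [h]

@[simp] theorem lin_zero {A B : SumCompletion C} : lin (0 : A ⟶ B) = 0 := by
  refine Finsupp.lhom_ext' fun s => LinearMap.ext_ring (Finsupp.ext fun r => ?_)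
  refine (lin_bs_apply _ s r).trans ?_
  simp

@[simp] theorem lin_add {A B : SumCompletion C} (f g : A ⟶ B) : lin (f + g) = lin f + lin g := by
  refine Finsupp.lhom_ext' fun s => LinearMap.ext_ring (Finsupp.ext fun r => ?_)
  refine (lin_bs_apply _ s r).trans ?_
  show _ = (lin f (bs A s) + lin g (bs A s)) r
  rw [Finsupp.add_apply, lin_bs_apply, lin_bs_apply, entry_add, map_add]

theorem lin_comp_inv {A B : SumCompletion C} (e : A ≅ B) (v : Vec A) :
    lin e.inv (lin e.hom v) = v := by
  rw [← lin_comp_apply, e.hom_inv_id, lin_id_apply]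

/-- Two-sided linear inverse to the action of an isomorphism on basis vectors. -/
theorem lin_inv_eq {A B : SumCompletion C} (e : A ≅ B) {v : Vec A} {w : Vec B}
    (h : lin e.hom v = w) : lin e.inv w = v := by rw [← h, lin_comp_inv]

end Lin

section Tensor

variable {C : Type*} [Category C] [Preadditive C] [MonoidalCategory C] [MonoidalPreadditive C]

/-- The tensor product of vectors. -/
def tens {A B : SumCompletion C} : Vec A →ₗ[ℂ] Vec B →ₗ[ℂ] Vec (A ⊗ B) :=
  Finsupp.lsum ℂ fun s => LinearMap.toSpanSingleton ℂ _
    (Finsupp.lsum ℂ fun t => LinearMap.toSpanSingleton ℂ _ (bs (A ⊗ B) (s, t)))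

/-- The tensor product of two vectors. -/
notation:70 u:71 " ⊠ " v:70 => tens u v

/-- The index of a summand of a tensor product. -/
def pr {A B : SumCompletion C} (s : A.ι) (t : B.ι) : (A ⊗ B).ι := (s, t)

theorem bs_tens_bs {A B : SumCompletion C} (s : A.ι) (t : B.ι) :
    tens (bs A s) (bs B t) = bs (A ⊗ B) (s, t) := by
  simp [tens]

theorem tens_apply {A B : SumCompletion C} (u : Vec A) (v : Vec B) (s : A.ι) (t : B.ι) :
    tens u v (pr s t) = u s * v t := by
  induction u using Finsupp.induction_linear with
  | zero => simp
  | add u u' h h' => simp [h, h', add_mul]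
  | single s' a =>
    induction v using Finsupp.induction_linear with
    | zero => simp
    | add v v' h h' => simp only [map_add, Finsupp.add_apply, h, h', mul_add]
    | single t' b =>
      have h : tens (Finsupp.single s' a) (Finsupp.single t' b) =
          (Finsupp.single (pr s' t') (a * b) : Vec (A ⊗ B)) := by
        simp only [tens, Finsupp.lsum_single, LinearMap.toSpanSingleton_apply,
          LinearMap.smul_apply, Finsupp.smul_single, smul_eq_mul, mul_one]
        rfl
      rw [h]
      have h' : (pr s' t' : (A ⊗ B).ι) = pr s t ↔ s' = s ∧ t' = t := Prod.mk_inj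
      classical
      simp only [Finsupp.single_apply, h']
      split_ifs <;> simp_all

variable [MonoidalScalarCat C]

theorem hom_ext_tens_bs {A B D : SumCompletion C} {f g : A ⊗ B ⟶ D}
    (h : ∀ s t, lin f (bs A s ⊠ bs B t) = lin g (bs A s ⊠ bs B t)) : f = g :=
  hom_ext_bs fun p => by
    have := h p.1 p.2
    rwa [bs_tens_bs] at this

theorem lin_tensorHom {A B A' B' : SumCompletion C} (f : A ⟶ A') (g : B ⟶ B') (u : Vec A)
    (v : Vec B) : lin (f ⊗ₘ g) (u ⊠ v) = lin f u ⊠ lin g v := by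
  induction u using bs_induction with
  | zero => simp
  | add u u' h h' => simp only [map_add, LinearMap.add_apply, h, h']
  | smul c u h => simp only [map_smul, LinearMap.smul_apply, h]
  | basis s =>
    induction v using bs_induction with
    | zero => simp
    | add u u' h h' => simp only [map_add, h, h']
    | smul c u h => simp only [map_smul, h]
    | basis t =>
      rw [bs_tens_bs]
      ext ⟨s', t'⟩
      refine (lin_bs_apply _ _ _).trans (Eq.trans ?_ (tens_apply _ _ s' t').symm)
      rw [lin_bs_apply, lin_bs_apply, ← MonoidalScalarCat.coef_tensorHom, ← entry_tensorHom]

@[simp] theorem lin_whiskerLeft {A B B' : SumCompletion C} (g : B ⟶ B') (u : Vec A)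
    (v : Vec B) : lin (A ◁ g) (u ⊠ v) = u ⊠ lin g v := by
  rw [← id_tensorHom, lin_tensorHom, lin_id_apply]

@[simp] theorem lin_whiskerRight {A A' B : SumCompletion C} (f : A ⟶ A') (u : Vec A)
    (v : Vec B) : lin (f ▷ B) (u ⊠ v) = lin f u ⊠ v := by
  rw [← tensorHom_id, lin_tensorHom, lin_id_apply]

/-- The basis vector of the unit object. -/
def vone : Vec (𝟙_ (SumCompletion C)) := bs (𝟙_ (SumCompletion C)) ()

end Tensor

/-! ### Constraints and weight spaces in direct sums of Fock modules. -/

section Fock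

@[simp] theorem lin_associator_hom {A B D : SumCompletion FockCat} (u : Vec A) (v : Vec B)
    (w : Vec D) : lin (α_ A B D).hom ((u ⊠ v) ⊠ w) = u ⊠ (v ⊠ w) := by
  induction u using bs_induction with
  | zero => simp
  | add u u' h h' => simp only [map_add, LinearMap.add_apply, h, h']
  | smul c u h => simp only [map_smul, LinearMap.smul_apply, h]
  | basis s =>
    induction v using bs_induction with
    | zero => simp
    | add u u' h h' => simp only [map_add, LinearMap.add_apply, h, h']
    | smul c u h => simp only [map_smul, LinearMap.smul_apply, h]
    | basis t =>
      induction w using bs_induction with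
      | zero => simp
      | add u u' h h' => simp only [map_add, h, h']
      | smul c u h => simp only [map_smul, h]
      | basis r =>
        simp only [bs_tens_bs]
        rw [associator_hom_eq, lin_graph, FockCat.scalarCat_coef, FockCat.coef_associator_hom,
          one_smul]

@[simp] theorem lin_associator_inv {A B D : SumCompletion FockCat} (u : Vec A) (v : Vec B)
    (w : Vec D) : lin (α_ A B D).inv (u ⊠ (v ⊠ w)) = (u ⊠ v) ⊠ w :=
  lin_inv_eq _ (lin_associator_hom u v w)

@[simp] theorem lin_leftUnitor_hom {A : SumCompletion FockCat} (u : Vec A) :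
    lin (λ_ A).hom (vone ⊠ u) = u := by
  induction u using bs_induction with
  | zero => simp
  | add u u' h h' => simp only [map_add, h, h']
  | smul c u h => simp only [map_smul, h]
  | basis s =>
    rw [vone, bs_tens_bs, leftUnitor_hom_eq, lin_graph, FockCat.scalarCat_coef,
      FockCat.coef_leftUnitor_hom, one_smul]

@[simp] theorem lin_rightUnitor_hom {A : SumCompletion FockCat} (u : Vec A) :
    lin (ρ_ A).hom (u ⊠ vone) = u := by
  induction u using bs_induction with
  | zero => simp
  | add u u' h h' => simp only [map_add, LinearMap.add_apply, h, h']
  | smul c u h => simp only [map_smul, LinearMap.smul_apply, h]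
  | basis s =>
    rw [vone, bs_tens_bs, rightUnitor_hom_eq, lin_graph, FockCat.scalarCat_coef,
      FockCat.coef_rightUnitor_hom, one_smul]

@[simp] theorem lin_rightUnitor_inv {A : SumCompletion FockCat} (u : Vec A) :
    lin (ρ_ A).inv u = u ⊠ vone :=
  lin_inv_eq _ (lin_rightUnitor_hom u)

/-- The vectors of weight `w`. -/
def weightSpace (A : SumCompletion FockCat) (w : ℝ) : Submodule ℂ (Vec A) :=
  Finsupp.supported ℂ ℂ {s | (A.X s).wt = w}

theorem bs_mem_weightSpace (A : SumCompletion FockCat) (s : A.ι) :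
    bs A s ∈ weightSpace A (A.X s).wt :=
  Finsupp.single_mem_supported ℂ _ rfl

/-- A matrix entry between summands of distinct weights has scalar zero, because $b_0$ acts on them
by different scalars. -/
theorem lin_mem_weightSpace {A B : SumCompletion FockCat} (f : A ⟶ B) {w : ℝ} {u : Vec A}
    (hu : u ∈ weightSpace A w) : lin f u ∈ weightSpace B w := by
  rw [weightSpace, Finsupp.supported_eq_span_single] at hu
  induction hu using Submodule.span_induction with
  | mem u hu =>
    obtain ⟨s, hs, rfl⟩ := hu
    refine (Finsupp.mem_supported _ _).2 fun t ht => ?_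
    have h := Finsupp.mem_support_iff.1 ht
    rw [lin_bs_apply] at h
    by_contra hne
    refine h (FockCat.coef_eq_zero _ fun e => hne ?_)
    exact e.symm.trans hs
  | zero => simp
  | add u v _ _ hu hv => rw [map_add]; exact add_mem hu hv
  | smul c u _ hu => rw [map_smul]; exact Submodule.smul_mem _ c hu

@[elab_as_elim] theorem weightSpace_induction {A : SumCompletion FockCat} {w : ℝ}
    {p : (u : Vec A) → u ∈ weightSpace A w → Prop} (zero : p 0 (zero_mem _))
    (add : ∀ u v hu hv, p u hu → p v hv → p (u + v) (add_mem hu hv))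
    (smul : ∀ (c : ℂ) u hu, p u hu → p (c • u) (Submodule.smul_mem _ c hu))
    (basis : ∀ s, ∀ hs : (A.X s).wt = w, p (bs A s) (hs ▸ bs_mem_weightSpace A s))
    {u : Vec A} (hu : u ∈ weightSpace A w) : p u hu := by
  have key : ∀ v ∈ Submodule.span ℂ ((fun s => bs A s) '' {s | (A.X s).wt = w}),
      ∃ h, p v h := by
    intro v hv
    induction hv using Submodule.span_induction with
    | mem v hv => obtain ⟨s, hs, rfl⟩ := hv; exact ⟨_, basis s hs⟩
    | zero => exact ⟨_, zero⟩
    | add v v' _ _ h h' => exact ⟨_, add v v' _ _ h.2 h'.2⟩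
    | smul c v _ h => exact ⟨_, smul c v _ h.2⟩
  exact (key u (by rwa [← Finsupp.supported_eq_span_single])).2

theorem tens_mem_weightSpace {A B : SumCompletion FockCat} {x y : ℝ} {u : Vec A} {v : Vec B}
    (hu : u ∈ weightSpace A x) (hv : v ∈ weightSpace B y) :
    u ⊠ v ∈ weightSpace (A ⊗ B) (x + y) := by
  refine (Finsupp.mem_supported _ _).2 fun p hp => ?_
  obtain ⟨s, t⟩ := p
  have h := Finsupp.mem_support_iff.1 hp
  have h' := (tens_apply u v s t).symm.trans_ne h
  have hs := (Finsupp.mem_supported _ _).1 hu (Finsupp.mem_support_iff.2 (left_ne_zero_of_mul h'))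
  have ht := (Finsupp.mem_supported _ _).1 hv (Finsupp.mem_support_iff.2 (right_ne_zero_of_mul h'))
  exact congrArg₂ (· + ·) hs ht

/-- The braiding scalar depends on the weights alone, so it is constant on a product of two weight
spaces; homogeneity of both vectors is what allows a single scalar. -/
theorem lin_braiding_hom {A B : SumCompletion FockCat} {x y : ℝ} {u : Vec A} {v : Vec B}
    (hu : u ∈ weightSpace A x) (hv : v ∈ weightSpace B y) :
    lin (β_ A B).hom (u ⊠ v) = FockCat.braidScalar x y • (v ⊠ u) := by
  induction hu using weightSpace_induction with
  | zero => simp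
  | add u u' _ _ h h' => simp only [map_add, LinearMap.add_apply, h, h', smul_add]
  | smul c u _ h => simp only [map_smul, LinearMap.smul_apply, h, smul_comm c]
  | basis s hs =>
    induction hv using weightSpace_induction with
    | zero => simp
    | add u u' _ _ h h' => simp only [map_add, LinearMap.add_apply, h, h', smul_add]
    | smul c u _ h => simp only [map_smul, LinearMap.smul_apply, h, smul_comm c]
    | basis t ht =>
      rw [bs_tens_bs, bs_tens_bs, braiding_hom_eq, lin_graph, FockCat.scalarCat_coef,
        FockCat.coef_braiding_hom, hs, ht]

/-- The morphism with prescribed images of the basis vectors. -/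
def ofCol {A B : SumCompletion FockCat} (f : A.ι → Vec B) : A ⟶ B :=
  (⟨fun s t => FockCat.scalar (A.X s) (B.X t) (f s t), fun s =>
    ((f s).hasFiniteSupport).subset fun t ht h0 => ht (by rw [h0]; simp [FockCat.scalar])⟩ : Hom A B)

/-- The weight hypothesis is essential: `scalar` is zero between distinct Fock modules, so
coordinates of the wrong weight would be lost. -/
theorem lin_ofCol {A B : SumCompletion FockCat} {f : A.ι → Vec B}
    (hf : ∀ s, f s ∈ weightSpace B (A.X s).wt) (s : A.ι) : lin (ofCol f) (bs A s) = f s := by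
  ext t
  rw [lin_bs_apply]
  have : entry (ofCol f) s t = FockCat.scalar (A.X s) (B.X t) (f s t) := by
    unfold entry
    rfl
  rw [this]
  refine FockCat.coef_scalar_of _ _ _ fun h => ?_
  by_contra h'
  exact h ((Finsupp.mem_supported _ _).1 (hf s) (Finsupp.mem_support_iff.2 h')).symm

end Fock

end SumCompletion

end HeisenbergLattice

end

noncomputable section

namespace HeisenbergLattice

/-! ### The bicharacter $e^{\pi i xy}$ and its values on the lattice. -/

namespace FockCat

theorem braidScalar_add_left (x y z : ℝ) :
    braidScalar (x + y) z = braidScalar x z * braidScalar y z := by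
  rw [braidScalar, braidScalar, braidScalar, ← Complex.exp_add]
  congr 1; push_cast; ring

theorem braidScalar_add_right (x y z : ℝ) :
    braidScalar x (y + z) = braidScalar x y * braidScalar x z := by
  rw [braidScalar, braidScalar, braidScalar, ← Complex.exp_add]
  congr 1; push_cast; ring

theorem braidScalar_comm (x y : ℝ) : braidScalar x y = braidScalar y x := by
  rw [braidScalar, braidScalar]
  congr 1; ring

theorem braidScalar_neg_left (x y : ℝ) : braidScalar (-x) y = (braidScalar x y)⁻¹ := by
  rw [braidScalar, braidScalar, ← Complex.exp_neg]
  congr 1; push_cast; ring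

theorem braidScalar_neg_right (x y : ℝ) : braidScalar x (-y) = (braidScalar x y)⁻¹ := by
  rw [braidScalar_comm, braidScalar_neg_left, braidScalar_comm]

@[simp] theorem braidScalar_zero_left (y : ℝ) : braidScalar 0 y = 1 := by simp [braidScalar]

@[simp] theorem braidScalar_zero_right (x : ℝ) : braidScalar x 0 = 1 := by simp [braidScalar]

/-- The square is the double braiding $e^{2\pi i xy}$. Through this equivalence locality becomes an
integrality condition on weights. -/
theorem braidScalar_sq_eq_one_iff {x y : ℝ} :
    braidScalar x y * braidScalar x y = 1 ↔ ∃ n : ℤ, x * y = n := by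
  rw [braidScalar, ← Complex.exp_add, Complex.exp_eq_one_iff]
  refine exists_congr fun n => ⟨fun h => ?_, fun h => ?_⟩
  · have h2 : (x : ℂ) * y = n := by
      refine mul_left_cancel₀ (a := 2 * Real.pi * Complex.I) Complex.two_pi_I_ne_zero ?_
      linear_combination h
    exact_mod_cast h2
  · have h' : (x : ℂ) * y = n := by exact_mod_cast h
    linear_combination (2 * Real.pi * Complex.I : ℂ) * h'

end FockCat

open FockCat

/-- The generator of the lattice. -/
def period (N : ℕ) : ℝ := Real.sqrt (2 * N)

theorem period_mul_self (N : ℕ) : period N * period N = 2 * N :=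
  Real.mul_self_sqrt (by positivity)

theorem period_pos (N : ℕ) [NeZero N] : 0 < period N :=
  Real.sqrt_pos.2 (by have := NeZero.pos N; positivity)

theorem mem_lattice_iff {N : ℕ} {x : ℝ} : x ∈ lattice N ↔ ∃ n : ℤ, x = n * period N := by
  simp only [lattice, AddSubgroup.mem_zmultiples_iff, zsmul_eq_mul, period, eq_comm]

theorem braidScalar_mem_lattice {N : ℕ} {x y : ℝ} (hx : x ∈ lattice N) (hy : y ∈ lattice N) :
    braidScalar x y = 1 :=
  VL.braidScalar_lattice N ⟨x, hx⟩ ⟨y, hy⟩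

/-! ### Arithmetic of the coset representatives and the associativity scalar. -/

namespace Reps

variable {N : ℕ}

theorem period_pos (x : Reps N) : 0 < period N := by
  obtain ⟨a, ha, -⟩ := x.mem
  have : 0 < N := by omega
  exact Real.sqrt_pos.2 (by positivity)

theorem exists_mul_period (x : Reps N) : ∃ a : ℤ, x.val * period N = a := by
  obtain ⟨a, ha, h⟩ := x.mem
  refine ⟨a, ?_⟩
  rw [h]
  exact div_mul_cancel₀ _ x.period_pos.ne'

theorem val_nonneg (x : Reps N) : 0 ≤ x.val := by
  obtain ⟨a, ha, h⟩ := x.mem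
  rw [h]
  positivity

theorem val_lt (x : Reps N) : x.val < period N := by
  obtain ⟨a, ha, h⟩ := x.mem
  rw [h]
  refine (div_lt_iff₀ x.period_pos).2 ?_
  rw [period_mul_self]
  exact_mod_cast ha

theorem k_mem (x y : Reps N) : k x y ∈ lattice N := by
  rw [k]
  split_ifs
  · exact AddSubgroup.mem_zmultiples _
  · exact zero_mem _

/-- Both values lie in $[0,\sqrt{2N})$, so a difference $n\sqrt{2N}$ has $|n|<1$. Equalities in $R$
can therefore be checked modulo $L$. -/
theorem eq_of_sub_mem {x y : Reps N} (h : x.val - y.val ∈ lattice N) : x = y := by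
  obtain ⟨n, hn⟩ := mem_lattice_iff.1 h
  have hp := x.period_pos
  have h1 : (n : ℝ) < 1 := by
    have := x.val_lt; have := y.val_nonneg
    refine lt_of_mul_lt_mul_right ?_ hp.le
    linarith
  have h2 : (-1 : ℝ) < n := by
    have := x.val_nonneg; have := y.val_lt
    refine lt_of_mul_lt_mul_right ?_ hp.le
    linarith
  have h3 : n = 0 := by
    have h1' : n < 1 := by exact_mod_cast h1
    have h2' : -1 < n := by exact_mod_cast h2
    omega
  refine Reps.ext ?_
  rw [h3, Int.cast_zero, zero_mul] at hn
  linarith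

theorem eq_of_lattice_add {l m : ℝ} (hl : l ∈ lattice N) (hm : m ∈ lattice N) {x y : Reps N}
    (h : l + x.val = m + y.val) : x = y :=
  eq_of_sub_mem (by
    have : x.val - y.val = m - l := by linarith
    rw [this]
    exact sub_mem hm hl)

/-- Division with remainder of $n=x\sqrt{2N}$ by $2N$: the remainder gives the representative, and
the quotient counts the periods removed since $(\sqrt{2N})^2=2N$. -/
theorem exists_sub_mem [NeZero N] {x : ℝ} (h : ∃ n : ℤ, x * period N = n) :
    ∃ y : Reps N, x - y.val ∈ lattice N := by
  obtain ⟨n, hn⟩ := h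
  have hp := HeisenbergLattice.period_pos N
  have hN : (0 : ℤ) < 2 * N := by have := NeZero.pos N; omega
  refine ⟨⟨(n % (2 * N)).toNat / Real.sqrt (2 * N), (n % (2 * N)).toNat, ?_, rfl⟩, ?_⟩
  · have := Int.emod_lt_of_pos n hN
    omega
  · refine mem_lattice_iff.2 ⟨n / (2 * N), ?_⟩
    have h1 : (((n % (2 * N)).toNat : ℕ) : ℝ) = n - 2 * N * (n / (2 * N) : ℤ) := by
      have : (((n % (2 * N)).toNat : ℕ) : ℤ) = n - 2 * N * (n / (2 * N)) := by
        rw [Int.toNat_of_nonneg (Int.emod_nonneg _ hN.ne'), Int.emod_def]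
      exact_mod_cast this
    show x - _ / period N = _
    rw [h1, sub_eq_iff_eq_add, ← sub_eq_iff_eq_add', eq_div_iff hp.ne', sub_mul, hn, mul_assoc,
      period_mul_self]
    ring

theorem add_comm (x y : Reps N) : x.add y = y.add x := by
  refine Reps.ext ?_
  simp only [add_val, k, _root_.add_comm]

theorem add_assoc (x y z : Reps N) : (x.add y).add z = x.add (y.add z) := by
  refine eq_of_sub_mem ?_
  have : ((x.add y).add z).val - (x.add (y.add z)).val =
      k y z + k x (y.add z) - k x y - k (x.add y) z := by
    simp only [add_val]; ring
  rw [this]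
  exact sub_mem (sub_mem (AddMemClass.add_mem (k_mem _ _) (k_mem _ _)) (k_mem _ _)) (k_mem _ _)

instance [NeZero N] : Zero (Reps N) := ⟨⟨0, 0, by have := NeZero.pos N; omega, by simp⟩⟩

@[simp] theorem zero_val [NeZero N] : (0 : Reps N).val = 0 := rfl

theorem k_zero_left [NeZero N] (x : Reps N) : k 0 x = 0 := by
  have h := x.val_lt
  rw [period] at h
  rw [k, if_neg]
  rw [zero_val]
  linarith

theorem k_zero_right [NeZero N] (x : Reps N) : k x 0 = 0 := by
  have h := x.val_lt
  rw [period] at h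
  rw [k, if_neg]
  rw [zero_val]
  linarith

theorem zero_add [NeZero N] (x : Reps N) : Reps.add 0 x = x := by
  refine Reps.ext ?_
  simp [k_zero_left]

theorem add_zero [NeZero N] (x : Reps N) : x.add 0 = x := by
  refine Reps.ext ?_
  simp [k_zero_right]

/-- The scalar by which a representative pairs with the lattice is a sign. -/
theorem braidScalar_sq (x : Reps N) {l : ℝ} (hl : l ∈ lattice N) :
    braidScalar x.val l * braidScalar x.val l = 1 := by
  obtain ⟨n, rfl⟩ := mem_lattice_iff.1 hl
  obtain ⟨a, ha⟩ := x.exists_mul_period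
  refine braidScalar_sq_eq_one_iff.2 ⟨n * a, ?_⟩
  push_cast
  rw [← ha]; ring

theorem braidScalar_inv (x : Reps N) {l : ℝ} (hl : l ∈ lattice N) :
    (braidScalar x.val l)⁻¹ = braidScalar x.val l :=
  inv_eq_of_mul_eq_one_left (x.braidScalar_sq hl)

/-- The correction $k(x,y)$ pairs trivially with $L$ because the lattice is even, so $x\mapsto
e^{\pi i xl}$ is multiplicative for the addition of $R$. -/
theorem braidScalar_add_val (x y : Reps N) {l : ℝ} (hl : l ∈ lattice N) :
    braidScalar (x.add y).val l = braidScalar x.val l * braidScalar y.val l := by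
  rw [add_val, sub_eq_add_neg, braidScalar_add_left, braidScalar_add_left,
    braidScalar_mem_lattice (neg_mem (k_mem x y)) hl, mul_one]

/-- The associativity scalar `(-1)^{x k(y, z)}`. -/
def assocScalar (x y z : Reps N) : ℂ := braidScalar x.val (k y z)

theorem assocScalar_ne_zero (x y z : Reps N) : assocScalar x y z ≠ 0 := braidScalar_ne_zero _ _

/-- The principal logarithm of $-1$ is $\pi i$, so the complex power agrees with the exponential. -/
theorem assocScalar_eq (x y z : Reps N) :
    assocScalar x y z = (-1 : ℂ) ^ ((x.val * k y z : ℝ) : ℂ) := by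
  rw [assocScalar, braidScalar, Complex.cpow_def_of_ne_zero (by norm_num), Complex.log_neg_one]
  congr 1
  push_cast
  ring

/-- Each side is the total amount subtracted from $x+y+z$ when it is reduced into $R$ with one of
the two bracketings. -/
theorem k_cocycle (x y z : Reps N) : k y z + k x (y.add z) = k x y + k (x.add y) z := by
  have h := congrArg Reps.val (add_assoc x y z)
  simp only [add_val] at h
  linarith

/-- The scalar is multiplicative in its first argument by evenness of $L$; what remains is $e^{\pi i
w\,\cdot}$ applied to the cocycle identity for $x,y,z$. -/
theorem assocScalar_pentagon (w x y z : Reps N) :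
    assocScalar w x y * (assocScalar w (x.add y) z * assocScalar x y z) =
      assocScalar (w.add x) y z * assocScalar w x (y.add z) := by
  simp only [assocScalar]
  rw [braidScalar_add_val _ _ (k_mem y z), ← mul_assoc, ← braidScalar_add_right,
    ← k_cocycle, braidScalar_add_right]
  ring

/-- Replacing $y+z$ by its representative costs $e^{-\pi i xk(y,z)}$, which the first associator
cancels; the other two associators agree by symmetry of $k$. -/
theorem assocScalar_hexagon (x y z : Reps N) :
    assocScalar x y z * (braidScalar x.val (y.add z).val * assocScalar y z x) =
      braidScalar x.val y.val * (assocScalar y x z * braidScalar x.val z.val) := by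
  have h : assocScalar y z x = assocScalar y x z := by
    simp only [assocScalar, k, _root_.add_comm]
  rw [h, assocScalar, add_val, sub_eq_add_neg, braidScalar_add_right,
    braidScalar_add_right, braidScalar_neg_right]
  field_simp [braidScalar_ne_zero]

/-- Here the reduction of $x+y$ and the inverse associator contribute the same factor $e^{-\pi i
zk(x,y)}$. It does not cancel but is squared, and its square is 1 because $z\,k(x,y)$ is an integer.
-/
theorem assocScalar_hexagon_inv (x y z : Reps N) :
    (assocScalar x y z)⁻¹ * (braidScalar (x.add y).val z.val * (assocScalar z x y)⁻¹) =
      braidScalar y.val z.val * ((assocScalar x z y)⁻¹ * braidScalar x.val z.val) := by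
  have h : assocScalar x z y = assocScalar x y z := by
    simp only [assocScalar, k, _root_.add_comm]
  have h2 := z.braidScalar_sq (k_mem x y)
  rw [h, assocScalar, assocScalar, add_val, sub_eq_add_neg, braidScalar_add_left,
    braidScalar_add_left, braidScalar_neg_left, braidScalar_comm (k x y), braidScalar_inv z (k_mem x y)]
  linear_combination (braidScalar x.val (k y z))⁻¹ * braidScalar x.val z.val *
    braidScalar y.val z.val * h2

end Reps

/-- The pointed category of the representatives of `L* / L`: the full subcategory of the Fock
modules with these weights. -/
abbrev Pt (N : ℕ) : Type := InducedCategory FockCat fun x : Reps N => (⟨x.val⟩ : FockCat)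

/-! ### The pointed braided category on the representatives. -/

namespace Pt

variable {N : ℕ}

instance : ScalarCat (Pt N) where
  coef := { toFun := fun f => FockCat.coef f.hom
            map_zero' := FockCat.coef_zero _ _
            map_add' := fun _ _ => FockCat.coef_add _ _ }
  coef_id _ := FockCat.coef_id _
  coef_comp _ _ := FockCat.coef_comp _ _
  coef_injective {_ _} _ _ h := InducedCategory.hom_ext (FockCat.hom_ext h)

open ScalarCat

@[ext] theorem hom_ext {x y : Pt N} {f g : x ⟶ y} (h : coef f = coef g) : f = g :=
  coef_injective h

theorem coef_eq_zero {x y : Pt N} (f : x ⟶ y) (h : x ≠ y) : coef f = 0 :=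
  FockCat.coef_eq_zero _ fun e => h (Reps.ext e)

/-- The morphism with a given scalar between equal objects, and `0` between distinct ones. -/
def scalar (x y : Pt N) (c : ℂ) : x ⟶ y := InducedCategory.homMk (FockCat.scalar _ _ c)

theorem coef_scalar_of (x y : Pt N) (c : ℂ) (h : x ≠ y → c = 0) : coef (scalar x y c) = c :=
  FockCat.coef_scalar_of _ _ _ fun e => h fun e' => e (by rw [e'])

theorem coef_scalar {x y : Pt N} (h : x = y) (c : ℂ) : coef (scalar x y c) = c :=
  coef_scalar_of x y c fun h' => absurd h h'

/-- A nonzero scalar as an isomorphism of equal objects. -/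
@[simps] def scalarIso (x y : Pt N) (h : x = y) (c : ℂ) (hc : c ≠ 0) : x ≅ y where
  hom := scalar x y c
  inv := scalar y x c⁻¹
  hom_inv_id := hom_ext (by simp [coef_scalar h, coef_scalar h.symm, hc])
  inv_hom_id := hom_ext (by simp [coef_scalar h, coef_scalar h.symm, hc])

variable [NeZero N]

instance : MonoidalCategoryStruct (Pt N) where
  tensorObj x y := Reps.add x y
  tensorHom {x₁ y₁ x₂ y₂} f g := scalar (Reps.add x₁ x₂) (Reps.add y₁ y₂) (coef f * coef g)
  whiskerLeft x {y₁ y₂} f := scalar (Reps.add x y₁) (Reps.add x y₂) (coef f)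
  whiskerRight {x₁ x₂} f y := scalar (Reps.add x₁ y) (Reps.add x₂ y) (coef f)
  tensorUnit := (0 : Reps N)
  associator x y z := scalarIso _ _ (Reps.add_assoc x y z) (Reps.assocScalar x y z)
    (Reps.assocScalar_ne_zero x y z)
  leftUnitor x := scalarIso _ _ (Reps.zero_add x) 1 one_ne_zero
  rightUnitor x := scalarIso _ _ (Reps.add_zero x) 1 one_ne_zero

@[simp] theorem coef_tensorHom {x₁ y₁ x₂ y₂ : Pt N} (f : x₁ ⟶ y₁) (g : x₂ ⟶ y₂) :
    coef (f ⊗ₘ g) = coef f * coef g := by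
  refine coef_scalar_of _ _ _ fun h => ?_
  by_cases h₁ : x₁ = y₁
  · by_cases h₂ : x₂ = y₂
    · exact absurd (congrArg₂ Reps.add h₁ h₂) h
    · rw [coef_eq_zero g h₂, mul_zero]
  · rw [coef_eq_zero f h₁, zero_mul]

@[simp] theorem coef_whiskerLeft (x : Pt N) {y₁ y₂ : Pt N} (f : y₁ ⟶ y₂) :
    coef (x ◁ f) = coef f :=
  coef_scalar_of _ _ _ fun h => coef_eq_zero f fun e => h (congrArg (Reps.add x) e)

@[simp] theorem coef_whiskerRight {x₁ x₂ : Pt N} (f : x₁ ⟶ x₂) (y : Pt N) :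
    coef (f ▷ y) = coef f :=
  coef_scalar_of _ _ _ fun h => coef_eq_zero f fun e => h (congrArg (Reps.add · y) e)

@[simp] theorem coef_associator_hom (x y z : Pt N) :
    coef (α_ x y z).hom = Reps.assocScalar x y z :=
  coef_scalar (Reps.add_assoc x y z) _
@[simp] theorem coef_associator_inv (x y z : Pt N) :
    coef (α_ x y z).inv = (Reps.assocScalar x y z)⁻¹ :=
  coef_scalar (Reps.add_assoc x y z).symm _
@[simp] theorem coef_leftUnitor_hom (x : Pt N) : coef (λ_ x).hom = 1 :=
  coef_scalar (Reps.zero_add x) 1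
@[simp] theorem coef_rightUnitor_hom (x : Pt N) : coef (ρ_ x).hom = 1 :=
  coef_scalar (Reps.add_zero x) 1
instance : MonoidalCategory (Pt N) where
  tensorHom_def _ _ := hom_ext (by simp)
  id_tensorHom_id _ _ := hom_ext (by simp)
  tensorHom_comp_tensorHom _ _ _ _ := hom_ext (by simp; ring)
  whiskerLeft_id _ _ := hom_ext (by simp)
  id_whiskerRight _ _ := hom_ext (by simp)
  -- The associator scalar varies with the objects, so naturality rests on the vanishing of
  -- morphisms between distinct objects.
  associator_naturality {x₁ x₂ x₃ y₁ y₂ y₃} f g h := hom_ext (by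
    by_cases h₁ : x₁ = y₁
    · by_cases h₂ : x₂ = y₂
      · by_cases h₃ : x₃ = y₃
        · subst h₁ h₂ h₃; simp; ring
        · simp [coef_eq_zero h h₃]
      · simp [coef_eq_zero g h₂]
    · simp [coef_eq_zero f h₁])
  leftUnitor_naturality _ := hom_ext (by simp)
  rightUnitor_naturality _ := hom_ext (by simp)
  pentagon w x y z := hom_ext (by
    simp only [ScalarCat.coef_comp, coef_associator_hom, coef_whiskerLeft, coef_whiskerRight]
    exact Reps.assocScalar_pentagon w x y z)
  -- Identity unitors are compatible with the associator because $k(0,y)=0$.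
  triangle x y := hom_ext (by
    simp only [ScalarCat.coef_comp, coef_associator_hom, coef_whiskerLeft, coef_leftUnitor_hom,
      coef_whiskerRight, coef_rightUnitor_hom, mul_one]
    exact (congrArg _ (Reps.k_zero_left y)).trans (braidScalar_zero_right _))

instance : MonoidalScalarCat (Pt N) where
  coef_tensorHom := coef_tensorHom

instance : MonoidalPreadditive (Pt N) where
  whiskerLeft_zero := hom_ext (by simp)
  zero_whiskerRight := hom_ext (by simp)
  whiskerLeft_add _ _ := hom_ext (by simp)
  add_whiskerRight _ _ := hom_ext (by simp)

/-- The braiding `e^{π i x y}`. -/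
def braid (x y : Pt N) : x ⊗ y ≅ y ⊗ x :=
  scalarIso _ _ (Reps.add_comm x y) (braidScalar (Reps.val x) (Reps.val y))
    (braidScalar_ne_zero _ _)

@[simp] theorem coef_braid_hom (x y : Pt N) :
    coef (braid x y).hom = braidScalar (Reps.val x) (Reps.val y) :=
  coef_scalar (Reps.add_comm x y) _

instance : BraidedCategory (Pt N) where
  braiding := braid
  braiding_naturality_right x y z f := hom_ext (by
    by_cases h : y = z
    · subst h; simp [mul_comm]
    · simp [coef_eq_zero f h])
  braiding_naturality_left {x y} f z := hom_ext (by
    by_cases h : x = y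
    · subst h; simp [mul_comm]
    · simp [coef_eq_zero f h])
  hexagon_forward x y z := hom_ext (by
    simp only [ScalarCat.coef_comp, coef_associator_hom, coef_braid_hom, coef_whiskerLeft, coef_whiskerRight]
    exact Reps.assocScalar_hexagon x y z)
  hexagon_reverse x y z := hom_ext (by
    simp only [ScalarCat.coef_comp, coef_associator_inv, coef_braid_hom, coef_whiskerLeft, coef_whiskerRight]
    exact Reps.assocScalar_hexagon_inv x y z)

@[simp] theorem coef_braiding_hom (x y : Pt N) :
    coef (β_ x y).hom = braidScalar (Reps.val x) (Reps.val y) := coef_braid_hom x y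

end Pt

end HeisenbergLattice

end

noncomputable section

namespace HeisenbergLattice

open SumCompletion FockCat
open scoped MonObj

/-! ### Vectors in modules over the lattice algebra -/

namespace VL

variable {N : ℕ}

/-- A lattice vector as an index of a summand of `V_L`. -/
def ix (l : lattice N) : (VL N).ι := l

/-- The basis vector of `V_L` of weight `l`. -/
def e (l : lattice N) : Vec (VL N) := bs (VL N) (ix l)

theorem e_mem (l : lattice N) : e l ∈ weightSpace (VL N) l := bs_mem_weightSpace (VL N) (ix l)

@[simp] theorem lin_mul (l m : lattice N) :
    lin (μ : VL N ⊗ VL N ⟶ VL N) (e l ⊠ e m) = e (l + m) := by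
  rw [e, e, bs_tens_bs]
  refine (lin_graph (add N) (mulComp N) _).trans ?_
  rw [scalarCat_coef, coef_mulComp, one_smul]
  rfl

@[simp] theorem lin_one : lin (η : 𝟙_ _ ⟶ VL N) vone = e 0 := by
  refine (lin_graph (zero N) (oneComp N) _).trans ?_
  rw [scalarCat_coef, coef_oneComp, one_smul]
  rfl

theorem hom_ext_e {B D : SumCompletion FockCat} {f g : VL N ⊗ B ⟶ D}
    (h : ∀ (l : lattice N) (s : B.ι), lin f (e l ⊠ bs B s) = lin g (e l ⊠ bs B s)) : f = g :=
  hom_ext_tens_bs h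

end VL

open VL

variable {N : ℕ}

@[simp] theorem lin_act_induction (V : SumCompletion FockCat) (l m : lattice N) (v : Vec V) :
    lin (act ((induction (VL N)).obj V)) (e l ⊠ (e m ⊠ v)) = e (l + m) ⊠ v := by
  show lin ((α_ (VL N) (VL N) V).inv ≫ μ ▷ V) (e l ⊠ (e m ⊠ v)) = _
  rw [lin_comp_apply, lin_associator_inv, lin_whiskerRight, lin_mul]

section Action

variable (M : Mod (SumCompletion FockCat) (VL N))

@[simp] theorem lin_act_zero (u : Vec M.X) : lin (act M) (e 0 ⊠ u) = u := by
  have h : η ▷ M.X ≫ act M = (λ_ M.X).hom := ModObj.one_smul (M := VL N) M.X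
  have h' := congrArg (fun f => lin f (vone ⊠ u)) h
  simpa only [lin_comp_apply, lin_whiskerRight, VL.lin_one, lin_leftUnitor_hom] using h'

/-- Associativity of the action on vectors. With `lin_act_zero` it makes $e_{-l}$ a two-sided
inverse of $e_l$ on every module. -/
theorem lin_act_act (l m : lattice N) (u : Vec M.X) :
    lin (act M) (e l ⊠ lin (act M) (e m ⊠ u)) = lin (act M) (e (l + m) ⊠ u) := by
  have h : μ ▷ M.X ≫ act M = (α_ (VL N) (VL N) M.X).hom ≫ VL N ◁ act M ≫ act M :=
    ModObj.mul_smul (M := VL N) M.X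
  have h' := congrArg (fun f => lin f ((e l ⊠ e m) ⊠ u)) h
  simp only [lin_comp_apply, lin_whiskerRight, lin_mul, lin_associator_hom,
    lin_whiskerLeft] at h'
  exact h'.symm

theorem lin_act_mem {l : lattice N} {w : ℝ} {u : Vec M.X} (hu : u ∈ weightSpace M.X w) :
    lin (act M) (e l ⊠ u) ∈ weightSpace M.X (l + w) :=
  lin_mem_weightSpace _ (tens_mem_weightSpace (e_mem l) hu)

end Action

theorem lin_hom_act {M M' : Mod (SumCompletion FockCat) (VL N)} (f : M ⟶ M') (l : lattice N)
    (u : Vec M.X) : lin f.hom (lin (act M) (e l ⊠ u)) = lin (act M') (e l ⊠ lin f.hom u) := by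
  have h := congrArg (fun f => lin f (e l ⊠ u)) (act_comp f)
  simpa only [lin_comp_apply, lin_whiskerLeft] using h

/-! ### The induction functor from the pointed category -/

/-- The direct sum of Fock modules with weights in `R`, as a direct sum of Fock modules. -/
abbrev fockObj (X : SumCompletion (Pt N)) : SumCompletion FockCat :=
  ⟨X.ι, fun s => ⟨Reps.val (X.X s)⟩⟩

/-- A morphism between direct sums of Fock modules with weights in `R`. -/
def fockMap {X Y : SumCompletion (Pt N)} (f : X ⟶ Y) : fockObj X ⟶ fockObj Y :=
  (⟨fun s t => (entry f s t).hom, fun s => (entry_finite f s).subset fun t ht h0 =>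
    ht (by
      show (entry f s t).hom = 0
      rw [h0]; rfl)⟩ : Hom (fockObj X) (fockObj Y))

theorem lin_fockMap {X Y : SumCompletion (Pt N)} (f : X ⟶ Y) : lin (fockMap f) = lin f := by
  refine Finsupp.lhom_ext' fun s => LinearMap.ext_ring (Finsupp.ext fun t => ?_)
  refine (lin_bs_apply (fockMap f) s t).trans (Eq.trans ?_ (lin_bs_apply f s t).symm)
  have : entry (fockMap f) s t = (entry f s t).hom := by
    conv_lhs => unfold entry
    rfl
  rw [this]
  rfl

/-- The inclusion of the direct sums of the Fock modules with weights in `R`. -/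
def fockOf : SumCompletion (Pt N) ⥤ SumCompletion FockCat where
  obj X := fockObj X
  map f := fockMap f
  map_id X := lin_injective (by rw [lin_fockMap, lin_id, lin_id])
  map_comp f g := lin_injective (by
    rw [lin_fockMap, lin_comp, lin_comp, lin_fockMap, lin_fockMap])

/-- Every morphism between direct sums of Fock modules with weights in `R` comes from `Pt N`. -/
theorem exists_fockMap {X Y : SumCompletion (Pt N)} (g : fockObj X ⟶ fockObj Y) :
    ∃ f : X ⟶ Y, fockMap f = g := by
  let F (s : X.ι) (t : Y.ι) : X.X s ⟶ Y.X t :=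
    InducedCategory.homMk (F := fun x : Reps N => (⟨x.val⟩ : FockCat)) (entry g s t)
  let f : X ⟶ Y := (⟨F, fun s => (entry_finite g s).subset fun t ht h0 => ht (by
    show InducedCategory.homMk (F := fun x : Reps N => (⟨x.val⟩ : FockCat)) (entry g s t) = 0
    rw [h0]; rfl)⟩ : Hom X Y)
  refine ⟨f, lin_injective ?_⟩
  rw [lin_fockMap]
  refine Finsupp.lhom_ext' fun s => LinearMap.ext_ring (Finsupp.ext fun t => ?_)
  refine (lin_bs_apply f s t).trans (Eq.trans ?_ (lin_bs_apply g s t).symm)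
  have : entry f s t = F s t := by
    conv_lhs => unfold entry
  rw [this]
  rfl

/-- The object underlying the module induced from a direct sum of Fock modules. -/
abbrev indObj (X : SumCompletion (Pt N)) : SumCompletion FockCat := VL N ⊗ fockObj X

/-- The action of `V_L` on an induced module. -/
def indAct (X : SumCompletion (Pt N)) : VL N ⊗ indObj X ⟶ indObj X :=
  act ((induction (VL N)).obj (fockObj X))

@[simp] theorem lin_indAct (X : SumCompletion (Pt N)) (l m : lattice N) (v : Vec (fockObj X)) :
    lin (indAct X) (e l ⊠ (e m ⊠ v)) = e (l + m) ⊠ v :=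
  lin_act_induction (fockObj X) l m v

theorem fockObj_bs_mem (X : SumCompletion (Pt N)) (s : X.ι) :
    bs (fockObj X) s ∈ weightSpace (fockObj X) (Reps.val (X.X s)) :=
  bs_mem_weightSpace (fockObj X) s

theorem indObj_hom_ext {X : SumCompletion (Pt N)} {D : SumCompletion FockCat}
    {f g : indObj X ⟶ D}
    (h : ∀ (l : lattice N) (s : X.ι),
      lin f (e l ⊠ bs (fockObj X) s) = lin g (e l ⊠ bs (fockObj X) s)) : f = g :=
  VL.hom_ext_e h

theorem act_indObj_hom_ext {X : SumCompletion (Pt N)} {D : SumCompletion FockCat}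
    {f g : VL N ⊗ indObj X ⟶ D}
    (h : ∀ (l m : lattice N) (s : X.ι), lin f (e l ⊠ (e m ⊠ bs (fockObj X) s)) =
      lin g (e l ⊠ (e m ⊠ bs (fockObj X) s))) : f = g :=
  VL.hom_ext_e (B := indObj X) fun l p => by
    have hp : e p.1 ⊠ bs (fockObj X) p.2 = bs (indObj X) p := bs_tens_bs _ _
    rw [← hp]
    exact h l p.1 p.2

/-- The monodromy of $e_l$ with weight $m+x$ is $e^{2\pi i l(m+x)}$. The $m$-part is trivial since
$L$ is even, and the $x$-part since $lx$ is an integer for $x\in R$. -/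
theorem isLocal_induction_fockObj (X : SumCompletion (Pt N)) :
    IsLocal (VL N) ((induction (VL N)).obj (fockObj X)) := by
  show (β_ (VL N) (indObj X)).hom ≫ (β_ (indObj X) (VL N)).hom ≫ indAct X = indAct X
  refine act_indObj_hom_ext fun l m s => ?_
  have hb : braidScalar l (m + Reps.val (X.X s)) * braidScalar (m + Reps.val (X.X s)) l = 1 := by
    rw [braidScalar_comm l, braidScalar_add_left, braidScalar_mem_lattice m.2 l.2, one_mul,
      Reps.braidScalar_sq _ l.2]
  have hp := tens_mem_weightSpace (e_mem m) (fockObj_bs_mem X s)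
  rw [lin_comp_apply, lin_braiding_hom (e_mem l) hp, map_smul, lin_comp_apply,
    lin_braiding_hom hp (e_mem l), map_smul, smul_smul, hb, one_smul]

/-- Induction from the pointed category to local modules. -/
def ind : SumCompletion (Pt N) ⥤ RepVL N :=
  ObjectProperty.lift _ (fockOf ⋙ induction (VL N)) isLocal_induction_fockObj

theorem rep0_hom_ext {M M' : RepVL N} {f g : M ⟶ M'} (h : Rep0.toHom f = Rep0.toHom g) : f = g :=
  ObjectProperty.hom_ext _ (Mod.hom_ext _ _ h)

/-- A morphism can be read off from its induced map on the vectors $e_0\otimes u$. -/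
instance : (ind (N := N)).Faithful where
  map_injective {X Y} f g h := by
    have h' : VL N ◁ fockMap f = VL N ◁ fockMap g := congrArg Rep0.toHom h
    refine lin_injective (LinearMap.ext fun u => ?_)
    have h2 := congrArg (fun k => lin k (e 0 ⊠ (show Vec (fockObj X) from u))) h'
    simp only [lin_whiskerLeft, lin_fockMap] at h2
    refine Finsupp.ext fun t => ?_
    have h3 := DFunLike.congr_fun h2 (pr (ix 0) t)
    have h0 : e (0 : lattice N) (ix 0) = 1 := Finsupp.single_eq_same
    rw [tens_apply, tens_apply, h0, one_mul, one_mul] at h3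
    exact h3

/-- Decompositions in $L+R$ are unique, so weight $l+x$ occurs in an induced module only inside
$e_l\otimes Y$. -/
theorem mem_weightSpace_induction {Y : SumCompletion (Pt N)} {l : lattice N} {x : Reps N}
    {u : Vec (VL N ⊗ fockObj Y)} (hu : u ∈ weightSpace (VL N ⊗ fockObj Y) (l + x.val)) :
    ∃ v ∈ weightSpace (fockObj Y) x.val, u = e l ⊠ v := by
  induction hu using weightSpace_induction with
  | zero => exact ⟨0, zero_mem _, by simp⟩
  | add u u' _ _ h h' =>
    obtain ⟨v, hv, rfl⟩ := h
    obtain ⟨v', hv', rfl⟩ := h'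
    exact ⟨v + v', add_mem hv hv', by simp⟩
  | smul c u _ h =>
    obtain ⟨v, hv, rfl⟩ := h
    exact ⟨c • v, Submodule.smul_mem _ c hv, by simp⟩
  | basis p hp =>
    obtain ⟨m, t⟩ := p
    change lattice N at m
    have hp' : (m : ℝ) + Reps.val (Y.X t) = l + x.val := hp
    have ht := Reps.eq_of_lattice_add m.2 l.2 hp'
    have hm : m = l := Subtype.ext (by rw [ht] at hp'; linarith)
    refine ⟨bs (fockObj Y) t, ht ▸ bs_mem_weightSpace (fockObj Y) t, ?_⟩
    rw [← hm]
    exact (bs_tens_bs _ _).symm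

/-- A module map preserves weights, so it sends $e_0\otimes s$ to some $e_0\otimes v$; these $v$ are
the columns of the preimage. Since $e_l$ acting on $e_0\otimes s$ gives $e_l\otimes s$, linearity
over $V_L$ determines all other values. -/
instance : (ind (N := N)).Full where
  map_surjective {X Y} f := by
    let f' : indObj X ⟶ indObj Y := Rep0.toHom f
    have hf' (l : lattice N) (u : Vec (indObj X)) :
        lin f' (lin (indAct X) (e l ⊠ u)) = lin (indAct Y) (e l ⊠ lin f' u) :=
      lin_hom_act f.hom l u
    have key : ∀ s : X.ι, ∃ v ∈ weightSpace (fockObj Y) (Reps.val (X.X s)),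
        lin f' (e 0 ⊠ bs (fockObj X) s) = e 0 ⊠ v := fun s =>
      mem_weightSpace_induction (lin_mem_weightSpace _
        (tens_mem_weightSpace (e_mem 0) (fockObj_bs_mem X s)))
    choose v hv hfv using key
    obtain ⟨g, hg⟩ := exists_fockMap (X := X) (Y := Y) (ofCol (A := fockObj X) v)
    refine ⟨g, rep0_hom_ext (show VL N ◁ fockMap g = f' from indObj_hom_ext fun l s => ?_)⟩
    have h := hf' l (e 0 ⊠ bs (fockObj X) s)
    rw [hfv, lin_indAct, lin_indAct, add_zero] at h
    rw [hg, lin_whiskerLeft, lin_ofCol (A := fockObj X) hv, h]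

end HeisenbergLattice

end

noncomputable section

namespace HeisenbergLattice

open SumCompletion FockCat
open scoped MonObj
open VL

variable {N : ℕ}

/-! ### Local modules are induced -/

/-- An isomorphism of local modules from an isomorphism of the underlying objects. -/
def rep0Iso {M M' : RepVL N} (i : Rep0.carrier M ≅ Rep0.carrier M')
    (h : act M.obj ≫ i.hom = VL N ◁ i.hom ≫ act M'.obj) : M ≅ M' where
  hom := ObjectProperty.homMk (Mod.Hom.mk' i.hom h)
  inv := ObjectProperty.homMk (Mod.Hom.mk' i.inv (by
    show act M'.obj ≫ i.inv = VL N ◁ i.inv ≫ act M.obj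
    rw [Iso.comp_inv_eq, Category.assoc, h, ← MonoidalCategory.whiskerLeft_comp_assoc,
      i.inv_hom_id, MonoidalCategory.whiskerLeft_id, Category.id_comp]))
  hom_inv_id := rep0_hom_ext i.hom_inv_id
  inv_hom_id := rep0_hom_ext i.inv_hom_id

section Local

variable (M : RepVL N)

/-- Testing locality with the generator $l=\sqrt{2N}$ of the lattice suffices to place every weight
in the dual lattice. -/
theorem exists_mul_period_of_isLocal (s : (Rep0.carrier M).ι) :
    ∃ n : ℤ, ((Rep0.carrier M).X s).wt * period N = n := by
  let l : lattice N := ⟨period N, AddSubgroup.mem_zmultiples _⟩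
  set w := ((Rep0.carrier M).X s).wt with hw
  have hs : bs (Rep0.carrier M) s ∈ weightSpace (Rep0.carrier M) w := bs_mem_weightSpace _ s
  have h := congrArg (fun f => lin f (e l ⊠ bs (Rep0.carrier M) s)) M.property
  simp only [lin_comp_apply] at h
  rw [lin_braiding_hom (e_mem l) hs, map_smul, lin_braiding_hom hs (e_mem l), smul_smul,
    map_smul] at h
  -- Acting with $e_{-l}$ removes the action of $e_l$ from both sides and leaves the scalar $e^{2\pi
  -- i lw}$ on the basis vector.
  have h2 := congrArg (fun u => lin (act M.obj) (e (-l) ⊠ u)) h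
  simp only [map_smul, lin_act_act, neg_add_cancel, lin_act_zero] at h2
  have h3 := DFunLike.congr_fun h2 s
  simp only [Finsupp.smul_apply, Finsupp.single_eq_same, smul_eq_mul, mul_one] at h3
  rw [braidScalar_comm (l : ℝ)] at h3
  exact braidScalar_sq_eq_one_iff.1 h3

/-- The summands of a local module whose weight lies in `R`. -/
def core : SumCompletion (Pt N) :=
  ⟨{ p : (Rep0.carrier M).ι × Reps N // ((Rep0.carrier M).X p.1).wt = p.2.val }, fun p => p.1.2⟩

/-- The inclusion of the summands with weight in `R`. -/
def coreIncl : fockObj (core M) ⟶ Rep0.carrier M :=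
  ofCol fun p => bs (Rep0.carrier M) p.1.1

theorem lin_coreIncl (p : (core M).ι) :
    lin (coreIncl M) (bs (fockObj (core M)) p) = bs (Rep0.carrier M) p.1.1 :=
  lin_ofCol (A := fockObj (core M)) (fun p => by
    show _ ∈ weightSpace _ (p.1.2).val
    rw [← p.2]
    exact bs_mem_weightSpace _ _) p

open Classical in
/-- The linear projection onto the summands with weight in `R`. -/
def coreProj : Vec (Rep0.carrier M) →ₗ[ℂ] Vec (fockObj (core M)) :=
  Finsupp.linearCombination ℂ fun s =>
    if h : ∃ x : Reps N, ((Rep0.carrier M).X s).wt = x.val then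
      bs (fockObj (core M)) ⟨(s, h.choose), h.choose_spec⟩ else 0

theorem coreProj_bs (p : (core M).ι) :
    coreProj M (bs (Rep0.carrier M) p.1.1) = bs (fockObj (core M)) p := by
  obtain ⟨⟨s, x⟩, h⟩ := p
  have h' : ∃ x : Reps N, ((Rep0.carrier M).X s).wt = x.val := ⟨x, h⟩
  have hx : h'.choose = x := Reps.ext (h'.choose_spec.symm.trans h)
  simp only [coreProj, Finsupp.linearCombination_single, one_smul, dif_pos h']
  congr

/-- On a weight in $R$ the projection loses nothing, so there it is a right inverse of the
inclusion. -/
theorem coreProj_spec {x : Reps N} {v : Vec (Rep0.carrier M)}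
    (hv : v ∈ weightSpace (Rep0.carrier M) x.val) :
    coreProj M v ∈ weightSpace (fockObj (core M)) x.val ∧ lin (coreIncl M) (coreProj M v) = v := by
  induction hv using weightSpace_induction with
  | zero => simp
  | add u u' _ _ h h' =>
    exact ⟨by rw [map_add]; exact add_mem h.1 h'.1, by rw [map_add, map_add, h.2, h'.2]⟩
  | smul c u _ h =>
    exact ⟨by rw [map_smul]; exact Submodule.smul_mem _ c h.1, by rw [map_smul, map_smul, h.2]⟩
  | basis s hs =>
    have h := coreProj_bs M ⟨(s, x), hs⟩
    rw [h]
    exact ⟨fockObj_bs_mem (core M) ⟨(s, x), hs⟩, lin_coreIncl M ⟨(s, x), hs⟩⟩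

/-- The map from the module induced from the summands with weight in `R`. -/
def coreHom : indObj (core M) ⟶ Rep0.carrier M := VL N ◁ coreIncl M ≫ act M.obj

theorem lin_coreHom (l : lattice N) (v : Vec (fockObj (core M))) :
    lin (coreHom M) (e l ⊠ v) = lin (act M.obj) (e l ⊠ lin (coreIncl M) v) := by
  rw [coreHom, lin_comp_apply, lin_whiskerLeft]

theorem coreHom_act : indAct (core M) ≫ coreHom M = VL N ◁ coreHom M ≫ act M.obj :=
  act_indObj_hom_ext fun l m p => by
    rw [lin_comp_apply, lin_comp_apply, lin_indAct, lin_coreHom, lin_whiskerLeft, lin_coreHom,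
      lin_act_act]

theorem act_neg_mem {l : lattice N} {x : Reps N} {v : Vec (Rep0.carrier M)}
    (hv : v ∈ weightSpace (Rep0.carrier M) (l + x.val)) :
    lin (act M.obj) (e (-l) ⊠ v) ∈ weightSpace (Rep0.carrier M) x.val := by
  have h := lin_act_mem M.obj (l := -l) hv
  rwa [AddSubgroup.coe_neg, neg_add_cancel_left] at h

variable [NeZero N]

theorem exists_rep_of_isLocal (s : (Rep0.carrier M).ι) :
    ∃ (l : lattice N) (x : Reps N), ((Rep0.carrier M).X s).wt = l + x.val := by
  obtain ⟨x, hx⟩ := Reps.exists_sub_mem (exists_mul_period_of_isLocal M s)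
  exact ⟨⟨_, hx⟩, x, by simp⟩

/-- The inverse of `coreHom`. -/
def coreInv : Rep0.carrier M ⟶ indObj (core M) :=
  -- A basis vector of weight $l+x$ is translated by $e_{-l}$ into the core, and the translation is
  -- recorded in the factor $e_l$.
  ofCol fun s => e (exists_rep_of_isLocal M s).choose ⊠ coreProj M
    (lin (act M.obj) (e (-(exists_rep_of_isLocal M s).choose) ⊠ bs (Rep0.carrier M) s))

/-- Uniqueness of $l+x$ shows that the chosen lattice vector is the given $l$, which makes the
formula valid on the whole weight space. -/
theorem lin_coreInv {l : lattice N} {x : Reps N} {v : Vec (Rep0.carrier M)}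
    (hv : v ∈ weightSpace (Rep0.carrier M) (l + x.val)) :
    lin (coreInv M) v = e l ⊠ coreProj M (lin (act M.obj) (e (-l) ⊠ v)) := by
  induction hv using weightSpace_induction with
  | zero => simp
  | add u u' _ _ h h' => simp only [map_add, h, h']
  | smul c u _ h => simp only [map_smul, h]
  | basis s hs =>
    have hl : (exists_rep_of_isLocal M s).choose = l := by
      have h := (exists_rep_of_isLocal M s).choose_spec.choose_spec.symm.trans hs
      have hx := Reps.eq_of_lattice_add (exists_rep_of_isLocal M s).choose.2 l.2 h
      rw [hx] at h
      exact Subtype.ext (add_right_cancel h)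
    refine (lin_ofCol (fun s => ?_) s).trans (by rw [hl])
    have hw := (exists_rep_of_isLocal M s).choose_spec.choose_spec
    have h := tens_mem_weightSpace (e_mem (exists_rep_of_isLocal M s).choose)
      (coreProj_spec M (act_neg_mem M (hw ▸ bs_mem_weightSpace (Rep0.carrier M) s))).1
    rwa [← hw] at h

/-- A local module is induced from its summands with weight in `R`. -/
def coreIso : indObj (core M) ≅ Rep0.carrier M where
  hom := coreHom M
  inv := coreInv M
  hom_inv_id := indObj_hom_ext fun l p => by
    have h : bs (Rep0.carrier M) p.1.1 ∈ weightSpace (Rep0.carrier M) p.1.2.val := by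
      rw [← p.2]; exact bs_mem_weightSpace _ _
    rw [lin_comp_apply, lin_coreHom, lin_coreIncl, lin_coreInv M (lin_act_mem M.obj h),
      lin_act_act, neg_add_cancel, lin_act_zero, coreProj_bs, lin_id_apply]
  inv_hom_id := hom_ext_bs fun s => by
    obtain ⟨l, x, h⟩ := exists_rep_of_isLocal M s
    have hs : bs (Rep0.carrier M) s ∈ weightSpace (Rep0.carrier M) (l + x.val) := by
      rw [← h]; exact bs_mem_weightSpace _ s
    rw [lin_comp_apply, lin_coreInv M hs, lin_coreHom, (coreProj_spec M (act_neg_mem M hs)).2,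
      lin_act_act, add_neg_cancel, lin_act_zero, lin_id_apply]

/-- `coreIso` commutes with the actions by `coreHom_act`, so it is an isomorphism of local modules.
-/
instance : (ind (N := N)).EssSurj where
  mem_essImage M := ⟨core M, ⟨rep0Iso (coreIso M) (coreHom_act M)⟩⟩

instance : (ind (N := N)).IsEquivalence where

end Local

end HeisenbergLattice

end

noncomputable section

namespace HeisenbergLattice

open SumCompletion FockCat
open scoped MonObj
open VL

variable {N : ℕ}

/-! ### The relative tensor product of induced modules -/

theorem bs_eq_tens {A B : SumCompletion FockCat} (p : (A ⊗ B).ι) :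
    bs (A ⊗ B) p = bs A p.1 ⊠ bs B p.2 := (bs_tens_bs _ _).symm

theorem bs_indObj {X : SumCompletion (Pt N)} (p : (indObj X).ι) :
    bs (indObj X) p = e p.1 ⊠ bs (fockObj X) p.2 := bs_eq_tens p

section Ext

variable {X Y Z : SumCompletion (Pt N)} {D : SumCompletion FockCat}

theorem hom_ext_ind_ind {f g : indObj X ⊗ indObj Y ⟶ D}
    (h : ∀ (l : lattice N) (s : X.ι) (m : lattice N) (t : Y.ι),
      lin f ((e l ⊠ bs (fockObj X) s) ⊠ (e m ⊠ bs (fockObj Y) t)) =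
      lin g ((e l ⊠ bs (fockObj X) s) ⊠ (e m ⊠ bs (fockObj Y) t))) : f = g :=
  hom_ext_tens_bs fun p q => by
    rw [bs_indObj, bs_indObj]
    exact h _ _ _ _

theorem hom_ext_ind_ind_ind {f g : (indObj X ⊗ indObj Y) ⊗ indObj Z ⟶ D}
    (h : ∀ (l : lattice N) (s : X.ι) (m : lattice N) (t : Y.ι) (n : lattice N) (r : Z.ι),
      lin f (((e l ⊠ bs (fockObj X) s) ⊠ (e m ⊠ bs (fockObj Y) t)) ⊠ (e n ⊠ bs (fockObj Z) r)) =
      lin g (((e l ⊠ bs (fockObj X) s) ⊠ (e m ⊠ bs (fockObj Y) t)) ⊠ (e n ⊠ bs (fockObj Z) r))) :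
    f = g :=
  hom_ext_tens_bs fun p q => by
    rw [bs_indObj, bs_eq_tens, bs_indObj, bs_indObj]
    exact h _ _ _ _ _ _

theorem hom_ext_ind_act {f g : indObj X ⊗ (VL N ⊗ indObj Y) ⟶ D}
    (h : ∀ (l : lattice N) (s : X.ι) (a m : lattice N) (t : Y.ι),
      lin f ((e l ⊠ bs (fockObj X) s) ⊠ (e a ⊠ (e m ⊠ bs (fockObj Y) t))) =
      lin g ((e l ⊠ bs (fockObj X) s) ⊠ (e a ⊠ (e m ⊠ bs (fockObj Y) t)))) : f = g :=
  hom_ext_tens_bs fun p q => by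
    rw [bs_indObj, bs_eq_tens, bs_indObj]
    exact h _ _ _ _ _

theorem hom_ext_act_ind {f g : VL N ⊗ (indObj X ⊗ indObj Y) ⟶ D}
    (h : ∀ (a l : lattice N) (s : X.ι) (m : lattice N) (t : Y.ι),
      lin f (e a ⊠ ((e l ⊠ bs (fockObj X) s) ⊠ (e m ⊠ bs (fockObj Y) t))) =
      lin g (e a ⊠ ((e l ⊠ bs (fockObj X) s) ⊠ (e m ⊠ bs (fockObj Y) t)))) : f = g :=
  VL.hom_ext_e fun a q => by
    rw [bs_eq_tens, bs_indObj, bs_indObj]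
    exact h _ _ _ _ _

end Ext

/-- The weight of a summand of `V_L`. -/
def VL.lat (i : (VL N).ι) : lattice N := i

/-- The two-cocycle with values in the lattice. -/
def kl (x y : Reps N) : lattice N := ⟨Reps.k x y, Reps.k_mem x y⟩

@[simp] theorem coe_kl (x y : Reps N) : (kl x y : ℝ) = Reps.k x y := rfl

/-- The representative of the weight of a summand. -/
abbrev rp (X : SumCompletion (Pt N)) (s : X.ι) : Reps N := X.X s

theorem braidScalar_lattice_add (l : lattice N) (x : ℝ) (m : lattice N) :
    braidScalar (l + x) m = braidScalar x m := by
  rw [braidScalar_add_left, braidScalar_mem_lattice l.2 m.2, one_mul]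

variable (X Y Z : SumCompletion (Pt N))

theorem ind_bs_mem (l : lattice N) (s : X.ι) :
    e l ⊠ bs (fockObj X) s ∈ weightSpace (indObj X) (l + (rp X s).val) :=
  tens_mem_weightSpace (e_mem l) (fockObj_bs_mem X s)

/-- The action on the left factor, moved past the right factor. -/
def indLeft : indObj X ⊗ (VL N ⊗ indObj Y) ⟶ indObj X ⊗ indObj Y :=
  (α_ (indObj X) (VL N) (indObj Y)).inv ≫ (β_ (indObj X) (VL N)).hom ▷ indObj Y ≫
    indAct X ▷ indObj Y

/-- The left factor has weight $l+x$, but $e^{\pi i la}=1$, so only the weight of $s$ contributes to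
the phase. -/
theorem lin_indLeft_bs (l : lattice N) (s : X.ι) (a : lattice N) (v : Vec (indObj Y)) :
    lin (indLeft X Y) ((e l ⊠ bs (fockObj X) s) ⊠ (e a ⊠ v)) =
      braidScalar (rp X s).val a • ((e (a + l) ⊠ bs (fockObj X) s) ⊠ v) := by
  rw [indLeft, lin_comp_apply, lin_associator_inv, lin_comp_apply, lin_whiskerRight,
    lin_braiding_hom (ind_bs_mem X l s) (e_mem a), map_smul, LinearMap.smul_apply, map_smul,
    lin_whiskerRight, lin_indAct, braidScalar_lattice_add]

variable [NeZero N]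

/-- The tensor product of vectors in the direct sums of Fock modules with weights in `R`. -/
def ptens : Vec (fockObj X) →ₗ[ℂ] Vec (fockObj Y) →ₗ[ℂ] Vec (fockObj (X ⊗ Y)) :=
  tens (A := X) (B := Y)

variable {X Y} in
theorem ptens_bs (s : X.ι) (t : Y.ι) :
    ptens X Y (bs (fockObj X) s) (bs (fockObj Y) t) = bs (fockObj (X ⊗ Y)) (s, t) :=
  bs_tens_bs (A := X) (B := Y) s t

theorem ptens_bs_mem (s : X.ι) (t : Y.ι) :
    ptens X Y (bs (fockObj X) s) (bs (fockObj Y) t) ∈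
      weightSpace (fockObj (X ⊗ Y)) ((rp X s).add (rp Y t)).val := by
  rw [ptens_bs]
  exact fockObj_bs_mem (X ⊗ Y) (s, t)

variable {X Y} in
theorem lin_fockMap_tensorHom {X' Y' : SumCompletion (Pt N)} (f : X ⟶ X') (g : Y ⟶ Y')
    (u : Vec (fockObj X)) (v : Vec (fockObj Y)) :
    lin (fockMap (f ⊗ₘ g)) (ptens X Y u v) =
      ptens X' Y' (lin (fockMap f) u) (lin (fockMap g) v) := by
  rw [lin_fockMap, lin_fockMap, lin_fockMap]
  exact lin_tensorHom f g u v

/-- The quotient map from the tensor product of two induced modules to their relative tensor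
product. -/
def pj : indObj X ⊗ indObj Y ⟶ indObj (X ⊗ Y) :=
  -- The phase comes from moving $e_m$ past the generator of weight $x$. The shift by $k(x,y)$
  -- compensates the reduction of $x+y$, so that the map preserves weight.
  ofCol fun p => braidScalar (rp X p.1.2).val (lat p.2.1) •
    (e (lat p.1.1 + lat p.2.1 + kl (rp X p.1.2) (rp Y p.2.2)) ⊠
      ptens X Y (bs (fockObj X) p.1.2) (bs (fockObj Y) p.2.2))

theorem lin_pj_bs (l : lattice N) (s : X.ι) (m : lattice N) (t : Y.ι) :
    lin (pj X Y) ((e l ⊠ bs (fockObj X) s) ⊠ (e m ⊠ bs (fockObj Y) t)) =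
      braidScalar (rp X s).val m • (e (l + m + kl (rp X s) (rp Y t)) ⊠
        ptens X Y (bs (fockObj X) s) (bs (fockObj Y) t)) := by
  have h : (e l ⊠ bs (fockObj X) s) ⊠ (e m ⊠ bs (fockObj Y) t) =
      bs (indObj X ⊗ indObj Y) ((l, s), (m, t)) := by
    rw [bs_eq_tens, bs_eq_tens, bs_eq_tens]
    rfl
  rw [h]
  refine lin_ofCol (A := indObj X ⊗ indObj Y) (fun p => Submodule.smul_mem _ _ ?_) ((l, s), (m, t))
  have h2 := tens_mem_weightSpace (e_mem (lat p.1.1 + lat p.2.1 +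
    kl (rp X p.1.2) (rp Y p.2.2))) (ptens_bs_mem X Y p.1.2 p.2.2)
  have hw : ((indObj X ⊗ indObj Y).X p).wt =
      ((lat p.1.1 + lat p.2.1 +
        kl (rp X p.1.2) (rp Y p.2.2) : lattice N) : ℝ) + ((rp X p.1.2).add (rp Y p.2.2)).val := by
    show ((lat p.1.1) + (rp X p.1.2).val : ℝ) +
      ((lat p.2.1) + (rp Y p.2.2).val) = _
    simp only [AddSubgroup.coe_add, coe_kl, Reps.add_val]
    ring
  rw [hw]
  exact h2

variable {X Y} in
theorem lin_pj {x y : Reps N} {u : Vec (fockObj X)} {v : Vec (fockObj Y)}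
    (hu : u ∈ weightSpace (fockObj X) x.val) (hv : v ∈ weightSpace (fockObj Y) y.val)
    (l m : lattice N) : lin (pj X Y) ((e l ⊠ u) ⊠ (e m ⊠ v)) =
      braidScalar x.val m • (e (l + m + kl x y) ⊠ ptens X Y u v) := by
  induction hu using weightSpace_induction with
  | zero => simp
  | add u u' _ _ h h' => simp only [map_add, LinearMap.add_apply, h, h', smul_add]
  | smul c u _ h => simp only [map_smul, LinearMap.smul_apply, h, smul_comm c]
  | basis s hs =>
    induction hv using weightSpace_induction with
    | zero => simp
    | add u u' _ _ h h' => simp only [map_add, h, h', smul_add]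
    | smul c u _ h => simp only [map_smul, h, smul_comm c]
    | basis t ht =>
      obtain rfl : rp X s = x := Reps.ext hs
      obtain rfl : rp Y t = y := Reps.ext ht
      exact lin_pj_bs X Y l s m t

variable {X Y} in
theorem pj_natural {X' Y' : SumCompletion (Pt N)} (f : X ⟶ X') (g : Y ⟶ Y') :
    pj X Y ≫ VL N ◁ fockMap (f ⊗ₘ g) =
      (VL N ◁ fockMap f ⊗ₘ VL N ◁ fockMap g) ≫ pj X' Y' :=
  hom_ext_ind_ind fun l s m t => by
    rw [lin_comp_apply, lin_pj_bs, map_smul, lin_whiskerLeft, lin_fockMap_tensorHom,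
      lin_comp_apply, lin_tensorHom, lin_whiskerLeft, lin_whiskerLeft,
      lin_pj (lin_mem_weightSpace _ (fockObj_bs_mem X s)) (lin_mem_weightSpace _ (fockObj_bs_mem Y t))]

/-- Moving $e_a$ and then $e_m$ past weight $x$ costs the same as moving $e_{a+m}$, by
multiplicativity of the phase. -/
theorem pj_condition : indLeft X Y ≫ pj X Y = indObj X ◁ indAct Y ≫ pj X Y :=
  hom_ext_ind_act fun l s a m t => by
    rw [lin_comp_apply, lin_indLeft_bs, map_smul, lin_pj_bs, lin_comp_apply, lin_whiskerLeft,
      lin_indAct, lin_pj_bs, smul_smul, AddSubgroup.coe_add, braidScalar_add_right,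
      add_comm a l, add_assoc l a m]

theorem pj_act : VL N ◁ pj X Y ≫ indAct (X ⊗ Y) =
    (α_ (VL N) (indObj X) (indObj Y)).inv ≫ indAct X ▷ indObj Y ≫ pj X Y :=
  hom_ext_act_ind fun a l s m t => by
    rw [lin_comp_apply, lin_whiskerLeft, lin_pj_bs, map_smul, map_smul, lin_indAct,
      lin_comp_apply, lin_associator_inv, lin_comp_apply, lin_whiskerRight, lin_indAct, lin_pj_bs,
      add_assoc a l m, add_assoc a (l + m)]

/-- The section of `pj`. -/
def sec : indObj (X ⊗ Y) ⟶ indObj X ⊗ indObj Y :=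
  -- All of the lattice part goes into the left factor: with $e_0$ on the right no phase appears,
  -- and subtracting $k$ cancels the shift in `pj`.
  ofCol fun p => (e (lat p.1 - kl (rp X p.2.1) (rp Y p.2.2)) ⊠
    bs (fockObj X) p.2.1) ⊠ (e 0 ⊠ bs (fockObj Y) p.2.2)

theorem lin_sec_bs (l : lattice N) (s : X.ι) (t : Y.ι) :
    lin (sec X Y) (e l ⊠ ptens X Y (bs (fockObj X) s) (bs (fockObj Y) t)) =
      (e (l - kl (rp X s) (rp Y t)) ⊠ bs (fockObj X) s) ⊠ (e 0 ⊠ bs (fockObj Y) t) := by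
  have h : e l ⊠ ptens X Y (bs (fockObj X) s) (bs (fockObj Y) t) =
      bs (indObj (X ⊗ Y)) (l, (s, t)) := by
    rw [bs_eq_tens, ptens_bs]
    rfl
  rw [h]
  refine lin_ofCol (A := indObj (X ⊗ Y)) (fun p => ?_) (l, (s, t))
  have h2 := tens_mem_weightSpace (ind_bs_mem X (lat p.1 -
    kl (rp X p.2.1) (rp Y p.2.2)) p.2.1) (ind_bs_mem Y 0 p.2.2)
  have hw : ((indObj (X ⊗ Y)).X p).wt =
      ((lat p.1 - kl (rp X p.2.1) (rp Y p.2.2) : lattice N) + (rp X p.2.1).val)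
        + ((0 : lattice N) + (rp Y p.2.2).val) := by
    show ((lat p.1) : ℝ) + ((rp X p.2.1).add (rp Y p.2.2)).val = _
    simp only [AddSubgroup.coe_sub, coe_kl, Reps.add_val, AddSubgroup.coe_zero]
    ring
  rw [hw]
  exact h2

theorem indObj_tensor_hom_ext {X Y : SumCompletion (Pt N)} {D : SumCompletion FockCat}
    {f g : indObj (X ⊗ Y) ⟶ D}
    (h : ∀ (l : lattice N) (s : X.ι) (t : Y.ι),
      lin f (e l ⊠ ptens X Y (bs (fockObj X) s) (bs (fockObj Y) t)) =
        lin g (e l ⊠ ptens X Y (bs (fockObj X) s) (bs (fockObj Y) t))) : f = g :=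
  indObj_hom_ext fun l p => by
    have h2 := h l p.1 p.2
    rw [ptens_bs] at h2
    exact h2

theorem sec_pj : sec X Y ≫ pj X Y = 𝟙 _ :=
  indObj_tensor_hom_ext fun l s t => by
    rw [lin_comp_apply, lin_sec_bs, lin_pj_bs, lin_id_apply, AddSubgroup.coe_zero,
      braidScalar_zero_right, one_smul, add_zero, sub_add_cancel]

/-- A map that equalizes the two actions can have $e_m$ moved from the right factor to the left,
with the phase of `pj`. It is therefore determined by the image of `sec`; together with `sec_pj`
this gives the universal property of the quotient. -/
theorem pj_sec_comp {D : SumCompletion FockCat} (f : indObj X ⊗ indObj Y ⟶ D)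
    (hf : indLeft X Y ≫ f = indObj X ◁ indAct Y ≫ f) : pj X Y ≫ sec X Y ≫ f = f :=
  hom_ext_ind_ind fun l s m t => by
    have h := congrArg
      (fun k => lin k ((e l ⊠ bs (fockObj X) s) ⊠ (e m ⊠ (e 0 ⊠ bs (fockObj Y) t)))) hf
    simp only [lin_comp_apply] at h
    rw [lin_indLeft_bs, lin_whiskerLeft, lin_indAct, add_zero, map_smul] at h
    rw [lin_comp_apply, lin_pj_bs, map_smul, lin_comp_apply, lin_sec_bs, add_sub_cancel_right,
      ← h, add_comm m l]

/-- The ambient braiding contributes $e^{\pi i(xm+xy+ly)}$, since $lm$ is even, and the quotient map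
in the other order contributes a second $e^{\pi i ly}$. Its square is 1, which leaves the braiding
$e^{\pi i xy}$ of `Pt N`. -/
theorem pj_braiding : pj X Y ≫ VL N ◁ fockMap (β_ X Y).hom =
    (β_ (indObj X) (indObj Y)).hom ≫ pj Y X :=
  hom_ext_ind_ind fun l s m t => by
    have h : lin (fockMap (β_ X Y).hom) (ptens X Y (bs (fockObj X) s) (bs (fockObj Y) t)) =
        braidScalar (rp X s).val (rp Y t).val •
          ptens Y X (bs (fockObj Y) t) (bs (fockObj X) s) := by
      rw [ptens_bs, ptens_bs, lin_fockMap, braiding_hom_eq]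
      refine (lin_graph _ _ _).trans ?_
      rw [Pt.coef_braiding_hom]
    rw [lin_comp_apply, lin_pj_bs, map_smul, lin_whiskerLeft, h, map_smul, lin_comp_apply,
      lin_braiding_hom (ind_bs_mem X l s) (ind_bs_mem Y m t), map_smul, lin_pj_bs,
      smul_smul, smul_smul]
    have hk : kl (rp X s) (rp Y t) = kl (rp Y t) (rp X s) :=
      Subtype.ext (by simp only [coe_kl, Reps.k, add_comm])
    rw [hk, add_comm m l, braidScalar_add_right, braidScalar_lattice_add,
      braidScalar_add_left (l : ℝ), braidScalar_comm (l : ℝ)]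
    congr 1
    linear_combination (-braidScalar (rp X s).val m * braidScalar (rp X s).val (rp Y t).val) *
      (rp Y t).braidScalar_sq l.2

/-- Both bracketings reach the same lattice vector by `k_cocycle` and share the phases from $m$ and
$n$. In the right-hand bracketing the shift $e_{k(y,z)}$ must in addition cross weight $x$, which is
the source of $e^{\pi i xk(y,z)}$. -/
theorem pj_associator : pj X Y ▷ indObj Z ≫ pj (X ⊗ Y) Z ≫ VL N ◁ fockMap (α_ X Y Z).hom =
    (α_ (indObj X) (indObj Y) (indObj Z)).hom ≫ indObj X ◁ pj Y Z ≫ pj X (Y ⊗ Z) :=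
  hom_ext_ind_ind_ind fun l s m t n r => by
    have h : lin (fockMap (α_ X Y Z).hom) (ptens (X ⊗ Y) Z
        (ptens X Y (bs (fockObj X) s) (bs (fockObj Y) t)) (bs (fockObj Z) r)) =
        Reps.assocScalar (rp X s) (rp Y t) (rp Z r) • ptens X (Y ⊗ Z) (bs (fockObj X) s)
          (ptens Y Z (bs (fockObj Y) t) (bs (fockObj Z) r)) := by
      rw [ptens_bs, ptens_bs, ptens_bs, ptens_bs, lin_fockMap, associator_hom_eq]
      refine (lin_graph _ _ _).trans ?_
      rw [Pt.coef_associator_hom]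
    rw [lin_comp_apply, lin_whiskerRight, lin_pj_bs, map_smul, LinearMap.smul_apply, map_smul,
      lin_comp_apply, lin_pj (ptens_bs_mem X Y s t) (fockObj_bs_mem Z r), map_smul,
      lin_whiskerLeft, h, map_smul, lin_comp_apply, lin_associator_hom, lin_comp_apply,
      lin_whiskerLeft, lin_pj_bs, map_smul, map_smul,
      lin_pj (fockObj_bs_mem X s) (ptens_bs_mem Y Z t r), smul_smul, smul_smul, smul_smul]
    have hk : l + m + kl (rp X s) (rp Y t) + n + kl ((rp X s).add (rp Y t)) (rp Z r) =
        l + (m + n + kl (rp Y t) (rp Z r)) + kl (rp X s) ((rp Y t).add (rp Z r)) :=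
      Subtype.ext (by
        have := Reps.k_cocycle (rp X s) (rp Y t) (rp Z r)
        simp only [AddSubgroup.coe_add, coe_kl]
        linarith)
    rw [hk]
    congr 1
    rw [Reps.braidScalar_add_val _ _ n.2, AddSubgroup.coe_add, AddSubgroup.coe_add,
      braidScalar_add_right, braidScalar_add_right, Reps.assocScalar, coe_kl]
    ring

/-- The generator of the unit has weight 0, so both the phase and the shift disappear and
multiplication in $V_L$ remains. -/
theorem pj_leftUnitor : (ρ_ (VL N)).inv ▷ indObj X ≫ pj (𝟙_ _) X ≫ VL N ◁ fockMap (λ_ X).hom =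
    indAct X :=
  act_indObj_hom_ext fun l m s => by
    have h : lin (fockMap (λ_ X).hom) (ptens (𝟙_ _) X (bs (fockObj (𝟙_ _)) ()) (bs (fockObj X) s)) =
        bs (fockObj X) s := by
      rw [ptens_bs, lin_fockMap, leftUnitor_hom_eq]
      refine (lin_graph _ _ _).trans ?_
      rw [Pt.coef_leftUnitor_hom, one_smul]
    rw [lin_comp_apply, lin_whiskerRight, lin_rightUnitor_inv, lin_comp_apply]
    have h2 := lin_pj_bs (𝟙_ (SumCompletion (Pt N))) X l () m s
    refine (congrArg _ h2).trans ?_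
    rw [map_smul, lin_whiskerLeft, h, lin_indAct]
    have hk : kl (rp (𝟙_ (SumCompletion (Pt N))) ()) (rp X s) = 0 :=
      Subtype.ext (Reps.k_zero_left _)
    rw [hk, add_zero]
    refine (congrArg (· • _) (braidScalar_zero_left _)).trans (one_smul _ _)

theorem pj_rightUnitor : indObj X ◁ (ρ_ (VL N)).inv ≫ pj X (𝟙_ _) ≫ VL N ◁ fockMap (ρ_ X).hom =
    (β_ (indObj X) (VL N)).hom ≫ indAct X :=
  hom_ext_tens_bs fun p m => by
    obtain ⟨l, s⟩ := p
    change lattice N at l m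
    have hb : bs (indObj X) (l, s) = e l ⊠ bs (fockObj X) s := bs_indObj _
    have h : lin (fockMap (ρ_ X).hom) (ptens X (𝟙_ _) (bs (fockObj X) s) (bs (fockObj (𝟙_ _)) ())) =
        bs (fockObj X) s := by
      rw [ptens_bs, lin_fockMap, rightUnitor_hom_eq]
      refine (lin_graph _ _ _).trans ?_
      rw [Pt.coef_rightUnitor_hom, one_smul]
    show lin _ (bs (indObj X) (l, s) ⊠ e m) = lin _ (bs (indObj X) (l, s) ⊠ e m)
    rw [hb, lin_comp_apply, lin_whiskerLeft, lin_rightUnitor_inv, lin_comp_apply]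
    have h2 := lin_pj_bs X (𝟙_ (SumCompletion (Pt N))) l s m ()
    refine (congrArg _ h2).trans ?_
    have hk : kl (rp X s) (rp (𝟙_ (SumCompletion (Pt N))) ()) = 0 :=
      Subtype.ext (Reps.k_zero_right _)
    rw [hk, map_smul, lin_whiskerLeft, h, add_zero, lin_comp_apply,
      lin_braiding_hom (ind_bs_mem X l s) (e_mem m), map_smul, lin_indAct,
      braidScalar_lattice_add, add_comm m l]

end HeisenbergLattice

end

noncomputable section

namespace HeisenbergLattice

open SumCompletion FockCat
open scoped MonObj
open VL

variable {N : ℕ}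

/-! ### Naturality used to pass from induced modules to all local modules. -/

theorem whiskerLeft_fockMap_comp {X Y Z : SumCompletion (Pt N)} (f : X ⟶ Y) (g : Y ⟶ Z) :
    VL N ◁ fockMap (f ≫ g) = VL N ◁ fockMap f ≫ VL N ◁ fockMap g := by
  rw [← MonoidalCategory.whiskerLeft_comp]
  exact congrArg _ (fockOf.map_comp f g)

theorem fockMap_id (X : SumCompletion (Pt N)) : fockMap (𝟙 X) = 𝟙 _ := fockOf.map_id X

theorem rightAction_natural {D : Type*} [Category D] [MonoidalCategory D] [BraidedCategory D]
    (A : D) {M M' P P' : D} {a : A ⊗ M ⟶ M} {a' : A ⊗ M' ⟶ M'} (f : M ⟶ M') (g : P ⟶ P')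
    (hf : a ≫ f = A ◁ f ≫ a') :
    ((α_ M A P).inv ≫ (β_ M A).hom ▷ P ≫ a ▷ P) ≫ (f ⊗ₘ g) =
      (f ⊗ₘ A ◁ g) ≫ (α_ M' A P').inv ≫ (β_ M' A).hom ▷ P' ≫ a' ▷ P' := by
  have h : (β_ M A).hom ≫ a ≫ f = f ▷ A ≫ (β_ M' A).hom ≫ a' := by
    rw [hf, BraidedCategory.braiding_naturality_left_assoc]
  have h2 : ((β_ M A).hom ▷ P ≫ a ▷ P) ≫ (f ⊗ₘ g) =
      ((f ▷ A) ⊗ₘ g) ≫ (β_ M' A).hom ▷ P' ≫ a' ▷ P' := by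
    rw [MonoidalCategory.tensorHom_def f g, MonoidalCategory.tensorHom_def (f ▷ A) g,
      Category.assoc, Category.assoc, whisker_exchange_assoc, whisker_exchange,
      ← comp_whiskerRight_assoc, ← comp_whiskerRight_assoc, ← comp_whiskerRight_assoc,
      ← comp_whiskerRight_assoc, Category.assoc, Category.assoc, h]
  rw [Category.assoc, h2, ← id_tensorHom A g, associator_inv_naturality_assoc, tensorHom_id]

variable [NeZero N]

/-! ### The braided monoidal category of local modules -/

/-- Local modules are direct sums of Fock modules with weights in `R`. -/
def indEquiv (N : ℕ) [NeZero N] : SumCompletion (Pt N) ≌ RepVL N := ind.asEquivalence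

/-- Transport makes the object underlying $M\otimes P$ equal by definition to `indObj (red M ⊗ red
P)`, so `pj` can serve directly as the quotient map. -/
instance repMonoidal : MonoidalCategory (RepVL N) := Monoidal.transport (indEquiv N)

instance repBraided : BraidedCategory (RepVL N) :=
  Monoidal.Transported.instBraidedCategory (indEquiv N)

/-- The direct sum of Fock modules with weights in `R` that corresponds to a local module. -/
abbrev red (M : RepVL N) : SumCompletion (Pt N) := (indEquiv N).inverse.obj M

/-- The morphism of `SumCompletion (Pt N)` that corresponds to a morphism of local modules. -/
abbrev redMap {M M' : RepVL N} (f : M ⟶ M') : red M ⟶ red M' := (indEquiv N).inverse.map f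

/-- A local module as an induced module. -/
def toInd (M : RepVL N) : Rep0.carrier M ⟶ indObj (red M) :=
  Rep0.toHom ((indEquiv N).counitIso.inv.app M)

/-- A local module as an induced module. -/
def fromInd (M : RepVL N) : indObj (red M) ⟶ Rep0.carrier M :=
  Rep0.toHom ((indEquiv N).counitIso.hom.app M)

theorem toInd_fromInd (M : RepVL N) : toInd M ≫ fromInd M = 𝟙 _ :=
  congrArg Rep0.toHom ((indEquiv N).counitIso.inv_hom_id_app M)

theorem fromInd_toInd (M : RepVL N) : fromInd M ≫ toInd M = 𝟙 _ :=
  congrArg Rep0.toHom ((indEquiv N).counitIso.hom_inv_id_app M)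

theorem toInd_natural {M M' : RepVL N} (f : M ⟶ M') :
    Rep0.toHom f ≫ toInd M' = toInd M ≫ VL N ◁ fockMap (redMap f) :=
  congrArg Rep0.toHom ((indEquiv N).counitIso.inv.naturality f)

theorem act_toInd (M : RepVL N) : act M.obj ≫ toInd M = VL N ◁ toInd M ≫ indAct (red M) :=
  act_comp ((indEquiv N).counitIso.inv.app M).hom

theorem act_fromInd (M : RepVL N) : indAct (red M) ≫ fromInd M = VL N ◁ fromInd M ≫ act M.obj :=
  act_comp ((indEquiv N).counitIso.hom.app M).hom

/-- The unit of the equivalence. -/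
abbrev unitTo (X : SumCompletion (Pt N)) : X ≅ red (ind.obj X) := (indEquiv N).unitIso.app X

/-- A triangle identity of the equivalence: on induced modules the counit is expressed by the unit.
-/
theorem toInd_ind (X : SumCompletion (Pt N)) :
    toInd (ind.obj X) = VL N ◁ fockMap (unitTo X).hom :=
  congrArg Rep0.toHom ((indEquiv N).counitInv_app_functor X)

/-- The quotient map to the relative tensor product. -/
def proj (M M' : RepVL N) : Rep0.carrier M ⊗ Rep0.carrier M' ⟶ indObj (red M ⊗ red M') :=
  (toInd M ⊗ₘ toInd M') ≫ pj (red M) (red M')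

/-- Definitional unfolding of the transported associator. The unit isomorphisms occur because an
inner tensor product is induced and then reduced again. -/
theorem toHom_associator (M P Q : RepVL N) :
    Rep0.toHom (α_ M P Q).hom = VL N ◁ fockMap ((unitTo (red M ⊗ red P)).inv ▷ red Q ≫
      (α_ (red M) (red P) (red Q)).hom ≫ red M ◁ (unitTo (red P ⊗ red Q)).hom) := rfl

theorem toHom_leftUnitor (M : RepVL N) :
    Rep0.toHom (λ_ M).hom = VL N ◁ fockMap ((unitTo (𝟙_ (SumCompletion (Pt N)))).inv ▷ red M ≫
      (λ_ (red M)).hom) ≫ fromInd M := rfl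

theorem toHom_rightUnitor (M : RepVL N) :
    Rep0.toHom (ρ_ M).hom = VL N ◁ fockMap (red M ◁ (unitTo (𝟙_ (SumCompletion (Pt N)))).inv ≫
      (ρ_ (red M)).hom) ≫ fromInd M := rfl

theorem pj_whiskerRight {X X' : SumCompletion (Pt N)} (f : X ⟶ X') (Y : SumCompletion (Pt N)) :
    (VL N ◁ fockMap f) ▷ indObj Y ≫ pj X' Y = pj X Y ≫ VL N ◁ fockMap (f ▷ Y) := by
  rw [← tensorHom_id f, pj_natural, fockMap_id, MonoidalCategory.whiskerLeft_id, tensorHom_id]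

theorem pj_whiskerLeft (X : SumCompletion (Pt N)) {Y Y' : SumCompletion (Pt N)} (f : Y ⟶ Y') :
    indObj X ◁ (VL N ◁ fockMap f) ≫ pj X Y' = pj X Y ≫ VL N ◁ fockMap (X ◁ f) := by
  rw [← id_tensorHom X f, pj_natural, fockMap_id, MonoidalCategory.whiskerLeft_id, id_tensorHom]

theorem tensorHom_pj_left {X X' Y : SumCompletion (Pt N)} {Q : SumCompletion FockCat}
    (f : X ⟶ X') (q : Q ⟶ indObj Y) : (VL N ◁ fockMap f ⊗ₘ q) ≫ pj X' Y =
      indObj X ◁ q ≫ pj X Y ≫ VL N ◁ fockMap (f ▷ Y) := by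
  rw [← pj_whiskerRight, MonoidalCategory.tensorHom_def', Category.assoc]

theorem tensorHom_pj_right {X Y Y' : SumCompletion (Pt N)} {Q : SumCompletion FockCat}
    (q : Q ⟶ indObj X) (f : Y ⟶ Y') : (q ⊗ₘ VL N ◁ fockMap f) ≫ pj X Y' =
      q ▷ indObj Y ≫ pj X Y ≫ VL N ◁ fockMap (X ◁ f) := by
  rw [← pj_whiskerLeft, MonoidalCategory.tensorHom_def, Category.assoc]

/-- Meant for iterated products, whose inner factor is literally induced: the outer projection
becomes `pj` up to a unit isomorphism. -/
theorem proj_ind_left (X : SumCompletion (Pt N)) (Q : RepVL N) :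
    (proj (ind.obj X) Q : indObj X ⊗ _ ⟶ _) = indObj X ◁ toInd Q ≫ pj X (red Q) ≫
      VL N ◁ fockMap ((unitTo X).hom ▷ red Q) :=
  (congrArg (fun k : indObj X ⟶ indObj (red (ind.obj X)) => (k ⊗ₘ toInd Q) ≫ pj _ _)
    (toInd_ind X)).trans (tensorHom_pj_left _ _)

theorem proj_ind_right (M : RepVL N) (X : SumCompletion (Pt N)) :
    (proj M (ind.obj X) : _ ⊗ indObj X ⟶ _) = toInd M ▷ indObj X ≫ pj (red M) X ≫
      VL N ◁ fockMap (red M ◁ (unitTo X).hom) :=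
  (congrArg (fun k : indObj X ⟶ indObj (red (ind.obj X)) => (toInd M ⊗ₘ k) ≫ pj _ _)
    (toInd_ind X)).trans (tensorHom_pj_right _ _)

theorem mLeft_proj (M P : RepVL N) :
    Rep0.mLeft M P ≫ (toInd M ⊗ₘ toInd P) =
      (toInd M ⊗ₘ VL N ◁ toInd P) ≫ indLeft (red M) (red P) :=
  rightAction_natural (VL N) (toInd M) (toInd P) (act_toInd M)

theorem mRight_proj (M P : RepVL N) :
    Rep0.mRight M P ≫ (toInd M ⊗ₘ toInd P) =
      (toInd M ⊗ₘ VL N ◁ toInd P) ≫ indObj (red M) ◁ indAct (red P) := by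
  rw [Rep0.mRight, MonoidalCategory.tensorHom_def', ← MonoidalCategory.whiskerLeft_comp_assoc, act_toInd,
    whisker_exchange, MonoidalCategory.tensorHom_def, Category.assoc, ← MonoidalCategory.whiskerLeft_comp]

theorem proj_condition (M P : RepVL N) :
    Rep0.mLeft M P ≫ proj M P = Rep0.mRight M P ≫ proj M P := by
  rw [proj, reassoc_of% (mLeft_proj M P), reassoc_of% (mRight_proj M P), pj_condition]

/-- The section of the quotient map. -/
def projSec (M P : RepVL N) : indObj (red M ⊗ red P) ⟶ Rep0.carrier M ⊗ Rep0.carrier P :=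
  sec (red M) (red P) ≫ (fromInd M ⊗ₘ fromInd P)

theorem projSec_proj (M P : RepVL N) : projSec M P ≫ proj M P = 𝟙 _ := by
  rw [projSec, proj, Category.assoc, tensorHom_comp_tensorHom_assoc, fromInd_toInd, fromInd_toInd,
    id_tensorHom_id, Category.id_comp, sec_pj]

theorem eq_projSec_comp (M P : RepVL N) {D : SumCompletion FockCat}
    (m : indObj (red M ⊗ red P) ⟶ D) (f : Rep0.carrier M ⊗ Rep0.carrier P ⟶ D)
    (h : proj M P ≫ m = f) : m = projSec M P ≫ f := by
  rw [← h, ← Category.assoc, projSec_proj, Category.id_comp]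

/-- The existence half of the coequalizer property, conjugated from `pj_sec_comp` by `toInd` and
`fromInd`; uniqueness follows from the splitting `projSec_proj`. -/
theorem proj_projSec_comp (M P : RepVL N) {D : SumCompletion FockCat}
    (f : Rep0.carrier M ⊗ Rep0.carrier P ⟶ D) (hf : Rep0.mLeft M P ≫ f = Rep0.mRight M P ≫ f) :
    proj M P ≫ projSec M P ≫ f = f := by
  have hinv : (fromInd M ⊗ₘ VL N ◁ fromInd P) ≫ (toInd M ⊗ₘ VL N ◁ toInd P) = 𝟙 _ := by
    rw [tensorHom_comp_tensorHom, ← MonoidalCategory.whiskerLeft_comp, fromInd_toInd,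
      fromInd_toInd, MonoidalCategory.whiskerLeft_id, id_tensorHom_id]
  have hinv' : (toInd M ⊗ₘ toInd P) ≫ (fromInd M ⊗ₘ fromInd P) = 𝟙 _ := by
    rw [tensorHom_comp_tensorHom, toInd_fromInd, toInd_fromInd, id_tensorHom_id]
  have hL : indLeft (red M) (red P) ≫ (fromInd M ⊗ₘ fromInd P) =
      (fromInd M ⊗ₘ VL N ◁ fromInd P) ≫ Rep0.mLeft M P := by
    rw [← Category.comp_id (Rep0.mLeft M P), ← hinv', reassoc_of% (mLeft_proj M P),
      reassoc_of% hinv]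
  have hR : indObj (red M) ◁ indAct (red P) ≫ (fromInd M ⊗ₘ fromInd P) =
      (fromInd M ⊗ₘ VL N ◁ fromInd P) ≫ Rep0.mRight M P := by
    rw [← Category.comp_id (Rep0.mRight M P), ← hinv', reassoc_of% (mRight_proj M P),
      reassoc_of% hinv]
  rw [proj, projSec, Category.assoc, Category.assoc, pj_sec_comp, reassoc_of% hinv']
  rw [reassoc_of% hL, reassoc_of% hR, hf]

theorem proj_act (M P : RepVL N) : VL N ◁ proj M P ≫ indAct (red M ⊗ red P) =
    (α_ (VL N) (Rep0.carrier M) (Rep0.carrier P)).inv ≫ act M.obj ▷ Rep0.carrier P ≫ proj M P := by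
  have h : act M.obj ▷ Rep0.carrier P ≫ (toInd M ⊗ₘ toInd P) =
      ((VL N ◁ toInd M) ⊗ₘ toInd P) ≫ indAct (red M) ▷ indObj (red P) := by
    rw [MonoidalCategory.tensorHom_def, ← comp_whiskerRight_assoc, act_toInd, comp_whiskerRight, Category.assoc,
      ← whisker_exchange, MonoidalCategory.tensorHom_def, Category.assoc]
  rw [proj, MonoidalCategory.whiskerLeft_comp, Category.assoc, pj_act, reassoc_of% h,
    ← id_tensorHom (VL N) (toInd M ⊗ₘ toInd P), associator_inv_naturality_assoc, id_tensorHom]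

theorem proj_tensorHom {M M' P P' : RepVL N} (f : M ⟶ M') (g : P ⟶ P') :
    proj M P ≫ VL N ◁ fockMap (redMap f ⊗ₘ redMap g) =
      (Rep0.toHom f ⊗ₘ Rep0.toHom g) ≫ proj M' P' := by
  rw [proj, proj, Category.assoc, pj_natural, tensorHom_comp_tensorHom_assoc,
    tensorHom_comp_tensorHom_assoc, toInd_natural, toInd_natural]

theorem proj_braiding (M P : RepVL N) :
    proj M P ≫ VL N ◁ fockMap (β_ (red M) (red P)).hom =
      (β_ (Rep0.carrier M) (Rep0.carrier P)).hom ≫ proj P M := by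
  rw [proj, proj, Category.assoc, pj_braiding, BraidedCategory.braiding_naturality_assoc]

/-- The unit isomorphisms from the projections cancel or match those in the transported associator.
What is left is `pj_associator` and naturality. -/
theorem proj_associator (M P Q : RepVL N) :
    proj M P ▷ Rep0.carrier Q ≫ proj (M ⊗ P) Q ≫ Rep0.toHom (α_ M P Q).hom =
      (α_ (Rep0.carrier M) (Rep0.carrier P) (Rep0.carrier Q)).hom ≫
        Rep0.carrier M ◁ proj P Q ≫ proj M (P ⊗ Q) := by
  have h1 := proj_ind_left (red M ⊗ red P) Q
  have h2 := proj_ind_right M (red P ⊗ red Q)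
  have h3 := toHom_associator M P Q
  have key : proj M P ▷ Rep0.carrier Q ≫ (indObj (red M ⊗ red P) ◁ toInd Q ≫
      pj (red M ⊗ red P) (red Q) ≫ VL N ◁ fockMap ((unitTo (red M ⊗ red P)).hom ▷ red Q)) ≫
      VL N ◁ fockMap ((unitTo (red M ⊗ red P)).inv ▷ red Q ≫
      (α_ (red M) (red P) (red Q)).hom ≫ red M ◁ (unitTo (red P ⊗ red Q)).hom) =
      (α_ (Rep0.carrier M) (Rep0.carrier P) (Rep0.carrier Q)).hom ≫
        Rep0.carrier M ◁ proj P Q ≫ toInd M ▷ indObj (red P ⊗ red Q) ≫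
        pj (red M) (red P ⊗ red Q) ≫ VL N ◁ fockMap (red M ◁ (unitTo (red P ⊗ red Q)).hom) := by
    have e1 : VL N ◁ fockMap ((unitTo (red M ⊗ red P)).hom ▷ red Q) ≫
        VL N ◁ fockMap ((unitTo (red M ⊗ red P)).inv ▷ red Q ≫
        (α_ (red M) (red P) (red Q)).hom ≫ red M ◁ (unitTo (red P ⊗ red Q)).hom) =
        VL N ◁ fockMap (α_ (red M) (red P) (red Q)).hom ≫
          VL N ◁ fockMap (red M ◁ (unitTo (red P ⊗ red Q)).hom) := by
      rw [← whiskerLeft_fockMap_comp, ← whiskerLeft_fockMap_comp, hom_inv_whiskerRight_assoc]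
    have e2 : proj M P ▷ Rep0.carrier Q ≫ indObj (red M ⊗ red P) ◁ toInd Q =
        ((toInd M ⊗ₘ toInd P) ⊗ₘ toInd Q) ≫ pj (red M) (red P) ▷ indObj (red Q) := by
      rw [proj, comp_whiskerRight, Category.assoc, ← whisker_exchange, MonoidalCategory.tensorHom_def _ (toInd Q),
        Category.assoc]
    have e3 : Rep0.carrier M ◁ proj P Q ≫ toInd M ▷ indObj (red P ⊗ red Q) =
        (toInd M ⊗ₘ (toInd P ⊗ₘ toInd Q)) ≫ indObj (red M) ◁ pj (red P) (red Q) := by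
      rw [proj, MonoidalCategory.whiskerLeft_comp, Category.assoc, whisker_exchange,
        MonoidalCategory.tensorHom_def' (toInd M), Category.assoc]
    rw [Category.assoc, Category.assoc, e1, reassoc_of% e2, reassoc_of% e3,
      reassoc_of% (pj_associator (red M) (red P) (red Q)), associator_naturality_assoc]
  exact (congrArg (proj M P ▷ Rep0.carrier Q ≫ ·) (congrArg₂ (· ≫ ·) h1 h3)).trans
    (key.trans (congrArg (fun k => (α_ (Rep0.carrier M) (Rep0.carrier P) (Rep0.carrier Q)).hom ≫
        Rep0.carrier M ◁ proj P Q ≫ k) h2).symm)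

theorem proj_leftUnitor (M : RepVL N) :
    (ρ_ (VL N)).inv ▷ Rep0.carrier M ≫ proj (𝟙_ (RepVL N)) M ≫ Rep0.toHom (λ_ M).hom =
      act M.obj := by
  have h1 := proj_ind_left (𝟙_ (SumCompletion (Pt N))) M
  have e1 : VL N ◁ fockMap ((unitTo (𝟙_ (SumCompletion (Pt N)))).hom ▷ red M) ≫
      VL N ◁ fockMap ((unitTo (𝟙_ (SumCompletion (Pt N)))).inv ▷ red M ≫ (λ_ (red M)).hom) =
      VL N ◁ fockMap (λ_ (red M)).hom := by
    rw [← whiskerLeft_fockMap_comp, hom_inv_whiskerRight_assoc]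
  have key : (ρ_ (VL N)).inv ▷ Rep0.carrier M ≫ (indObj (𝟙_ (SumCompletion (Pt N))) ◁ toInd M ≫
      pj (𝟙_ (SumCompletion (Pt N))) (red M) ≫
      VL N ◁ fockMap ((unitTo (𝟙_ (SumCompletion (Pt N)))).hom ▷ red M)) ≫
      VL N ◁ fockMap ((unitTo (𝟙_ (SumCompletion (Pt N)))).inv ▷ red M ≫ (λ_ (red M)).hom) ≫
        fromInd M = act M.obj := by
    have e2 : (ρ_ (VL N)).inv ▷ Rep0.carrier M ≫
        indObj (𝟙_ (SumCompletion (Pt N))) ◁ toInd M =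
        VL N ◁ toInd M ≫ (ρ_ (VL N)).inv ▷ indObj (red M) := (whisker_exchange _ _).symm
    rw [Category.assoc, Category.assoc, reassoc_of% e1, reassoc_of% e2]
    have e3 := pj_leftUnitor (red M)
    have e4 : VL N ◁ toInd M ≫ indAct (red M) ≫ fromInd M = act M.obj := by
      rw [act_fromInd, ← MonoidalCategory.whiskerLeft_comp_assoc, toInd_fromInd,
        MonoidalCategory.whiskerLeft_id, Category.id_comp]
    rw [← e4, ← e3, Category.assoc, Category.assoc]
  exact (congrArg ((ρ_ (VL N)).inv ▷ Rep0.carrier M ≫ ·)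
    (congrArg₂ (· ≫ ·) h1 (toHom_leftUnitor M))).trans key

theorem proj_rightUnitor (M : RepVL N) :
    Rep0.carrier M ◁ (ρ_ (VL N)).inv ≫ proj M (𝟙_ (RepVL N)) ≫ Rep0.toHom (ρ_ M).hom =
      (β_ (Rep0.carrier M) (VL N)).hom ≫ act M.obj := by
  have h1 := proj_ind_right M (𝟙_ (SumCompletion (Pt N)))
  have e1 : VL N ◁ fockMap (red M ◁ (unitTo (𝟙_ (SumCompletion (Pt N)))).hom) ≫
      VL N ◁ fockMap (red M ◁ (unitTo (𝟙_ (SumCompletion (Pt N)))).inv ≫ (ρ_ (red M)).hom) =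
      VL N ◁ fockMap (ρ_ (red M)).hom := by
    rw [← whiskerLeft_fockMap_comp, whiskerLeft_hom_inv_assoc]
  have key : Rep0.carrier M ◁ (ρ_ (VL N)).inv ≫ (toInd M ▷ indObj (𝟙_ (SumCompletion (Pt N))) ≫
      pj (red M) (𝟙_ (SumCompletion (Pt N))) ≫
      VL N ◁ fockMap (red M ◁ (unitTo (𝟙_ (SumCompletion (Pt N)))).hom)) ≫
      VL N ◁ fockMap (red M ◁ (unitTo (𝟙_ (SumCompletion (Pt N)))).inv ≫ (ρ_ (red M)).hom) ≫
        fromInd M = (β_ (Rep0.carrier M) (VL N)).hom ≫ act M.obj := by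
    have e2 : Rep0.carrier M ◁ (ρ_ (VL N)).inv ≫
        toInd M ▷ indObj (𝟙_ (SumCompletion (Pt N))) =
        toInd M ▷ VL N ≫ indObj (red M) ◁ (ρ_ (VL N)).inv := whisker_exchange _ _
    rw [Category.assoc, Category.assoc, reassoc_of% e1, reassoc_of% e2]
    have e3 := pj_rightUnitor (red M)
    have e4 : VL N ◁ toInd M ≫ indAct (red M) ≫ fromInd M = act M.obj := by
      rw [act_fromInd, ← MonoidalCategory.whiskerLeft_comp_assoc, toInd_fromInd,
        MonoidalCategory.whiskerLeft_id, Category.id_comp]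
    rw [← e4, ← BraidedCategory.braiding_naturality_left_assoc, ← reassoc_of% e3]
  exact (congrArg (Rep0.carrier M ◁ (ρ_ (VL N)).inv ≫ ·)
    (congrArg₂ (· ≫ ·) h1 (toHom_rightUnitor M))).trans key

/-- The transported structure is that of the relative tensor product. -/
def relTensor (N : ℕ) [NeZero N] : Rep0.RelTensor (VL N) where
  proj M P := proj M P
  condition M P := proj_condition M P
  isCoequalizer M P := ⟨Limits.Cofork.IsColimit.mk _ (fun s => projSec M P ≫ s.π)
    (fun s => proj_projSec_comp M P s.π s.condition) fun s m hm => eq_projSec_comp M P m s.π hm⟩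
  act_tensor M P := proj_act M P
  tensorHom f g := proj_tensorHom f g
  associator M P Q := proj_associator M P Q
  unitIso := (ρ_ (VL N)).symm
  act_unit := by
    -- The monoidal unit is induced from the weight 0 object, so its carrier is by definition
    -- $V_L\otimes\mathbf 1$ with the induced action.
    show μ ≫ (ρ_ (VL N)).inv =
      VL N ◁ (ρ_ (VL N)).inv ≫ (α_ (VL N) (VL N) (𝟙_ (SumCompletion FockCat))).inv ≫ μ ▷ _
    rw [rightUnitor_inv_naturality, rightUnitor_tensor_inv]
    simp
  leftUnitor M := proj_leftUnitor M
  rightUnitor M := proj_rightUnitor M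
  braiding M P := proj_braiding M P

end HeisenbergLattice

end

noncomputable section

namespace HeisenbergLattice

open SumCompletion FockCat
open scoped MonObj
open VL

variable {N : ℕ}

/-! ### The twist of local modules -/

/-- The twist of the ambient category. -/
abbrev ambientTwist (A : SumCompletion FockCat) : A ≅ A := (SumCompletion.twist fockTwist).app A

theorem lin_twist {A : SumCompletion FockCat} {w : ℝ} {u : Vec A} (hu : u ∈ weightSpace A w) :
    lin (ambientTwist A).hom u = braidScalar w w • u := by
  induction hu using weightSpace_induction with
  | zero => simp
  | add u u' _ _ h h' => rw [map_add, h, h', smul_add]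
  | smul c u _ h => rw [map_smul, h, smul_comm]
  | basis s hs =>
    refine (lin_graph (A := A) (B := A) id (fun s => (fockTwist.app (A.X s)).hom) s).trans ?_
    rw [scalarCat_coef]
    have h : FockCat.coef (fockTwist.app (A.X s)).hom = braidScalar w w := by
      rw [← hs]; exact FockCat.coef_scalar rfl _
    rw [h]
    rfl

variable [NeZero N]

/-- The twist scalar $e^{\pi i w^2}$ is unchanged when $l\in L$ is added to a local weight $w$:
$l^2$ is even and $lw$ is an integer. Hence the ambient twist is a module map. -/
theorem act_twist (M : RepVL N) : act M.obj ≫ (ambientTwist (Rep0.carrier M)).hom =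
    VL N ◁ (ambientTwist (Rep0.carrier M)).hom ≫ act M.obj := by
  refine hom_ext_e fun l s => ?_
  obtain ⟨l', x, h⟩ := exists_rep_of_isLocal M s
  have hs : bs (Rep0.carrier M) s ∈ weightSpace (Rep0.carrier M) (l' + x.val) := by
    rw [← h]; exact bs_mem_weightSpace _ s
  have hb : braidScalar (l + (l' + x.val)) (l + (l' + x.val)) =
      braidScalar (l' + x.val) (l' + x.val) := by
    rw [braidScalar_add_left, braidScalar_add_right (l : ℝ) l, braidScalar_mem_lattice l.2 l.2,
      one_mul, braidScalar_add_right _ (l : ℝ), braidScalar_comm _ (l : ℝ), ← mul_assoc,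
      braidScalar_add_right (l : ℝ) l', braidScalar_mem_lattice l.2 l'.2, one_mul,
      braidScalar_comm, Reps.braidScalar_sq _ l.2, one_mul]
  rw [lin_comp_apply, lin_twist (lin_act_mem M.obj hs), lin_comp_apply, lin_whiskerLeft,
    lin_twist hs, map_smul, map_smul, hb]

/-- The twist of a local module. -/
def repTwistApp (M : RepVL N) : M ≅ M := rep0Iso (ambientTwist (Rep0.carrier M)) (act_twist M)

theorem proj_cancel {M P : RepVL N} {D : SumCompletion FockCat}
    {f g : indObj (red M ⊗ red P) ⟶ D} (h : proj M P ≫ f = proj M P ≫ g) : f = g := by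
  rw [eq_projSec_comp M P f _ rfl, eq_projSec_comp M P g _ rfl, h]

/-- The twist of the category of local modules, which is the ambient twist. -/
def repTwist (N : ℕ) [NeZero N] : Twist (RepVL N) where
  app := repTwistApp
  naturality f := rep0_hom_ext ((SumCompletion.twist fockTwist).naturality (Rep0.toHom f))
  balancing M P := rep0_hom_ext <| by
    refine proj_cancel (M := M) (P := P) ?_
    have h1 : proj M P ≫ (ambientTwist (indObj (red M ⊗ red P))).hom =
        (ambientTwist (Rep0.carrier M ⊗ Rep0.carrier P)).hom ≫ proj M P :=
      (SumCompletion.twist fockTwist).naturality (proj M P)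
    have h2 : (ambientTwist (Rep0.carrier M ⊗ Rep0.carrier P)).hom =
        ((ambientTwist (Rep0.carrier M)).hom ⊗ₘ (ambientTwist (Rep0.carrier P)).hom) ≫
          (β_ (Rep0.carrier M) (Rep0.carrier P)).hom ≫
            (β_ (Rep0.carrier P) (Rep0.carrier M)).hom :=
      (SumCompletion.twist fockTwist).balancing _ _
    have h3 := proj_tensorHom (repTwistApp M).hom (repTwistApp P).hom
    refine h1.trans ?_
    -- After precomposition with the split epimorphism `proj`, the balancing axiom is the ambient
    -- one with both braidings carried across the quotient.
    rw [h2, Category.assoc, Category.assoc, ← proj_braiding, ← reassoc_of% (proj_braiding M P)]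
    exact (reassoc_of% h3) _ |>.symm

end HeisenbergLattice

end

noncomputable section

namespace HeisenbergLattice

open SumCompletion FockCat

variable {N : ℕ}

/-! ### Simple objects and finite direct sums -/

namespace Pt

/-- The direct sum with a single summand. -/
abbrev single (x : Pt N) : SumCompletion (Pt N) := ⟨Unit, fun _ => x⟩

/-- The morphism with prescribed images of the basis vectors. -/
def ofCols {A B : SumCompletion (Pt N)} (f : A.ι → Vec B) : A ⟶ B :=
  (⟨fun s t => Pt.scalar (A.X s) (B.X t) (f s t), fun s =>
    ((f s).hasFiniteSupport).subset fun t ht h0 => ht (by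
      rw [h0]
      exact ScalarCat.coef_injective
        ((coef_scalar_of _ _ _ fun _ => rfl).trans (map_zero ScalarCat.coef).symm))⟩ : Hom A B)

theorem lin_ofCols {A B : SumCompletion (Pt N)} {f : A.ι → Vec B}
    (hf : ∀ s t, f s t ≠ 0 → A.X s = B.X t) (s : A.ι) : lin (ofCols f) (bs A s) = f s := by
  ext t
  rw [lin_bs_apply]
  have : entry (ofCols f) s t = Pt.scalar (A.X s) (B.X t) (f s t) := by
    unfold entry
    rfl
  rw [this]
  refine coef_scalar_of _ _ _ fun h => ?_
  by_contra h'
  exact h (hf s t h')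

theorem eq_of_lin_bs_apply_ne_zero {A B : SumCompletion (Pt N)} (f : A ⟶ B) {s : A.ι} {t : B.ι}
    (h : lin f (bs A s) t ≠ 0) : A.X s = B.X t := by
  by_contra h'
  exact h ((lin_bs_apply f s t).trans (coef_eq_zero _ h'))

theorem exists_ne_zero {A B : SumCompletion (Pt N)} {f : A ⟶ B} (h : f ≠ 0) :
    ∃ s t, lin f (bs A s) t ≠ 0 := by
  by_contra! h'
  exact h (hom_ext_bs fun s => Finsupp.ext fun t => by rw [h' s t, lin_zero]; rfl)

/-- The inclusion of a summand. -/
def incl (A : SumCompletion (Pt N)) (s : A.ι) : single (A.X s) ⟶ A :=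
  graph (A := single (A.X s)) (fun _ => s) fun _ => 𝟙 (A.X s)

theorem lin_incl (A : SumCompletion (Pt N)) (s : A.ι) (u : Unit) :
    lin (incl A s) (bs (single (A.X s)) u) = bs A s := by
  refine (lin_graph (A := single (A.X s)) _ _ u).trans ?_
  rw [ScalarCat.coef_id, one_smul]

theorem vec_single {x : Pt N} (v : Vec (single x)) : v = v () • bs (single x) () := by
  ext
  simp

theorem lin_incl_apply (A : SumCompletion (Pt N)) (s : A.ι) (v : Vec (single (A.X s))) :
    lin (incl A s) v = v () • bs A s := by
  refine (congrArg (lin (incl A s)) (vec_single v)).trans ?_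
  rw [map_smul, lin_incl]

instance (A : SumCompletion (Pt N)) (s : A.ι) : Mono (incl A s) := ⟨fun {B} f g h =>
  hom_ext_bs fun t => by
    have h' := congrArg (fun k => lin k (bs B t) s) h
    simp only [lin_comp_apply, lin_incl_apply] at h'
    rw [vec_single (lin f (bs B t)), vec_single (lin g (bs B t))]
    simpa using h'⟩

/-- A nonzero map into a single summand has a nonzero entry from a summand of the same type.
Inverting that scalar gives a section, and a split epimorphism that is mono is invertible. -/
instance simple_single (x : Pt N) : Simple (single x) where
  mono_isIso_iff_nonzero {B} f _ := by
    refine ⟨fun hf h0 => ?_, fun h => ?_⟩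
    · have h1 : 𝟙 (single x) = 0 :=
        (IsIso.inv_hom_id f).symm.trans ((congrArg (inv f ≫ ·) h0).trans Limits.comp_zero)
      have h2 := congrArg (fun k => lin k (bs (single x) ()) ()) h1
      simp at h2
    · obtain ⟨s, ⟨⟩, hs⟩ := exists_ne_zero h
      have hx : B.X s = x := eq_of_lin_bs_apply_ne_zero f hs
      let g : single x ⟶ B := ofCols fun _ => (lin f (bs B s) ())⁻¹ • bs B s
      have hg : g ≫ f = 𝟙 _ := hom_ext_bs fun u => by
        have h1 : lin g (bs (single x) u) = (lin f (bs B s) ())⁻¹ • bs B s :=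
          lin_ofCols (fun _ t ht => by
            by_cases hst : s = t
            · rw [← hst]; exact hx.symm
            · exact absurd (by simp [hst]) ht) u
        rw [lin_comp_apply, h1, map_smul, lin_id_apply]
        nth_rewrite 2 [vec_single (lin f (bs B s))]
        rw [smul_smul, inv_mul_cancel₀ hs, one_smul]
      have : IsSplitEpi f := ⟨⟨g, hg⟩⟩
      exact isIso_of_mono_of_isSplitEpi f

/-- A nonzero object has a summand, whose inclusion is a nonzero monomorphism and hence an
isomorphism onto a simple object. -/
theorem exists_iso_single (A : SumCompletion (Pt N)) [Simple A] :
    ∃ x : Pt N, Nonempty (A ≅ single x) := by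
  obtain ⟨s, -, -⟩ := exists_ne_zero (id_nonzero A)
  have h : incl A s ≠ 0 := fun h => by
    have h2 := congrArg (fun k => lin k (bs (single (A.X s)) ()) s) h
    simp only [lin_incl] at h2
    simp at h2
  have := isIso_of_mono_of_nonzero h
  exact ⟨A.X s, ⟨(asIso (incl A s)).symm⟩⟩

theorem eq_of_single_iso {x y : Pt N} (i : single x ≅ single y) : x = y := by
  have h : i.hom ≠ 0 := fun h => by
    have h2 := congrArg (fun k => lin k (bs (single x) ()) ()) i.hom_inv_id
    simp [h] at h2
  obtain ⟨⟨⟩, ⟨⟩, h⟩ := exists_ne_zero h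
  exact eq_of_lin_bs_apply_ne_zero i.hom h

/-- The spaces spanned by the summands are linearly isomorphic, and a basis of a finite-dimensional
space is finite. -/
theorem finite_of_iso {A B : SumCompletion (Pt N)} (i : A ≅ B) [Finite A.ι] : Finite B.ι := by
  let L : Vec A ≃ₗ[ℂ] Vec B := LinearEquiv.ofLinearMap (lin i.hom) (lin i.inv)
    (by rw [← lin_comp, i.inv_hom_id, lin_id]) (by rw [← lin_comp, i.hom_inv_id, lin_id])
  have : Module.Finite ℂ (Vec B) := Module.Finite.equiv L
  exact Module.Finite.finite_basis (Finsupp.basisSingleOne (R := ℂ) (ι := B.ι))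

open Classical in
/-- The projection to a summand. -/
def prj (A : SumCompletion (Pt N)) (s : A.ι) : A ⟶ single (A.X s) :=
  ofCols fun t => if t = s then bs (single (A.X s)) () else 0

open Classical in
theorem lin_prj (A : SumCompletion (Pt N)) (s t : A.ι) :
    lin (prj A s) (bs A t) = if t = s then bs (single (A.X s)) () else 0 := by
  refine lin_ofCols (fun t u h => ?_) t
  by_cases hst : t = s
  · rw [hst]
  · simp [hst] at h

theorem incl_prj_self (A : SumCompletion (Pt N)) (s : A.ι) : incl A s ≫ prj A s = 𝟙 _ :=
  hom_ext_bs fun u => by rw [lin_comp_apply, lin_incl, lin_prj, if_pos rfl, lin_id_apply]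

theorem incl_prj_of_ne (A : SumCompletion (Pt N)) {s t : A.ι} (h : s ≠ t) :
    incl A s ≫ prj A t = 0 :=
  hom_ext_bs fun u => by rw [lin_comp_apply, lin_incl, lin_prj, if_neg h, lin_zero]; rfl

/-- A direct sum with its inclusions and projections. -/
def bicone (A : SumCompletion (Pt N)) : Limits.Bicone fun s => single (A.X s) where
  pt := A
  π := prj A
  ι := incl A
  ι_π s t := by
    split_ifs with h
    · subst h; simpa using incl_prj_self A s
    · exact incl_prj_of_ne A h

theorem lin_sum {A B : SumCompletion (Pt N)} {J : Type*} (S : Finset J) (f : J → (A ⟶ B))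
    (u : Vec A) : lin (∑ j ∈ S, f j) u = ∑ j ∈ S, lin (f j) u := by
  classical
  induction S using Finset.induction_on with
  | empty => simp
  | insert j S h ih => rw [Finset.sum_insert h, Finset.sum_insert h, lin_add, LinearMap.add_apply, ih]

theorem sum_prj_incl (A : SumCompletion (Pt N)) [Fintype A.ι] :
    ∑ s : A.ι, prj A s ≫ incl A s = 𝟙 A := hom_ext_bs fun t => by
  rw [lin_sum, Finset.sum_eq_single t]
  · rw [lin_comp_apply, lin_prj, if_pos rfl, lin_incl, lin_id_apply]
  · intro s _ h
    rw [lin_comp_apply, lin_prj, if_neg h.symm, map_zero]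
  · exact fun h => absurd (Finset.mem_univ _) h

/-- A finite direct sum is a biproduct. -/
def biconeIsBilimit (A : SumCompletion (Pt N)) [Fintype A.ι] : (bicone A).IsBilimit :=
  Limits.isBilimitOfTotal _ (sum_prj_incl A)

section Equivalence

variable {K : Type*} [Category K]

section Zero

variable [Limits.HasZeroMorphisms K] (F : SumCompletion (Pt N) ⥤ K) [F.IsEquivalence]

theorem exists_iso_obj_single (M : K) [Simple M] :
    ∃ x : Pt N, Nonempty (M ≅ F.obj (single x)) := by
  have := simple_obj F.inv M
  obtain ⟨x, ⟨i⟩⟩ := exists_iso_single (F.inv.obj M)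
  exact ⟨x, ⟨(F.asEquivalence.counitIso.app M).symm ≪≫ F.mapIso i⟩⟩

end Zero

theorem isFiniteSumOfSimples_iff [Preadditive K] (F : SumCompletion (Pt N) ⥤ K)
    [F.IsEquivalence] [F.Additive] (Z : K) : isFiniteSumOfSimples K Z ↔
      ∃ A : SumCompletion (Pt N), Finite A.ι ∧ Nonempty (F.obj A ≅ Z) := by
  constructor
  · rintro ⟨n, f, b, hf, ⟨hb⟩, ⟨i⟩⟩
    have h (j : Fin n) : ∃ x : Pt N, Nonempty (f j ≅ F.obj (single x)) :=
      haveI := hf j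
      exists_iso_obj_single F (f j)
    choose x e using h
    let A : SumCompletion (Pt N) := ⟨Fin n, x⟩
    let _ : Fintype A.ι := inferInstanceAs (Fintype (Fin n))
    have hA : (F.mapBicone (bicone A)).IsBilimit :=
      Limits.isBilimitOfPreserves F (biconeIsBilimit A)
    have : Limits.HasBiproduct f := Limits.HasBiproduct.mk ⟨b, hb⟩
    have : Limits.HasBiproduct (F.obj ∘ fun s : A.ι => single (A.X s)) :=
      Limits.HasBiproduct.mk ⟨_, hA⟩
    let j : Limits.biproduct f ≅ Limits.biproduct (F.obj ∘ fun s : A.ι => single (A.X s)) :=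
      Limits.biproduct.mapIso fun s => (e s).some
    exact ⟨A, inferInstance, ⟨Limits.biproduct.uniqueUpToIso _ hA ≪≫ j.symm ≪≫
      (Limits.biproduct.uniqueUpToIso _ hb).symm ≪≫ i⟩⟩
  · rintro ⟨A, hA, ⟨i⟩⟩
    obtain ⟨n, ⟨e⟩⟩ := Finite.exists_equiv_fin A.ι
    let B : SumCompletion (Pt N) := ⟨Fin n, fun j => A.X (e.symm j)⟩
    let _ : Fintype B.ι := inferInstanceAs (Fintype (Fin n))
    have j : B ≅ A := graphIso (A := B) (B := A) e.symm fun _ => Iso.refl _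
    exact ⟨n, fun s => F.obj (single (B.X s)), F.mapBicone (bicone B),
      fun s => simple_obj F _, ⟨Limits.isBilimitOfPreserves F (biconeIsBilimit B)⟩,
      ⟨F.mapIso j ≪≫ i⟩⟩

/-- Finiteness of the index set replaces the existential condition and is evidently stable under
tensor products and duals. -/
theorem isFiniteSumOfSimples_iff_finite [Preadditive K] (J : K ⥤ SumCompletion (Pt N))
    [J.IsEquivalence] [J.Additive] (Z : K) : isFiniteSumOfSimples K Z ↔ Finite (J.obj Z).ι := by
  have : J.asEquivalence.functor.Additive := inferInstanceAs J.Additive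
  have : J.inv.Additive := Equivalence.inverse_additive J.asEquivalence
  rw [isFiniteSumOfSimples_iff J.inv]
  constructor
  · rintro ⟨A, hA, ⟨i⟩⟩
    have : Finite ((𝟭 (SumCompletion (Pt N))).obj A).ι := hA
    exact finite_of_iso ((J.asEquivalence.counitIso.app A).symm ≪≫ J.mapIso i)
  · exact fun h => ⟨_, h, ⟨(J.asEquivalence.unitIso.app Z).symm⟩⟩

end Equivalence

end Pt

end HeisenbergLattice

end

noncomputable section

namespace HeisenbergLattice

open SumCompletion FockCat

variable {N : ℕ} [NeZero N]

/-! ### Duals of finite direct sums -/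

namespace Reps

theorem exists_neg (x : Reps N) : ∃ y : Reps N, x.add y = 0 := by
  obtain ⟨n, hn⟩ := x.exists_mul_period
  obtain ⟨y, hy⟩ := exists_sub_mem (N := N) (x := -x.val) ⟨-n, by push_cast; linarith⟩
  refine ⟨y, eq_of_sub_mem ?_⟩
  have h := neg_mem (AddSubgroup.add_mem _ hy (k_mem x y))
  have : (x.add y).val - (0 : Reps N).val = -(-x.val - y.val + k x y) := by
    rw [add_val, zero_val]; ring
  rwa [this]

/-- The representative of the negative coset. -/
def neg (x : Reps N) : Reps N := x.exists_neg.choose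

theorem add_neg (x : Reps N) : x.add x.neg = 0 := x.exists_neg.choose_spec

theorem neg_add (x : Reps N) : x.neg.add x = 0 := (add_comm _ _).trans x.add_neg

/-- With $k=k(x,-x)$ the representatives satisfy $x+(-x)=k$, so the product is $e^{\pi i k^2}$,
which is 1 as $L$ is even. This is the compatibility of the two zigzag identities. -/
theorem assocScalar_neg (x : Reps N) : assocScalar x x.neg x * assocScalar x.neg x x.neg = 1 := by
  have h1 := congrArg val x.add_neg
  have h2 := congrArg val x.neg_add
  rw [add_val, zero_val] at h1 h2
  have hk : k x x.neg = k x.neg x := by linarith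
  rw [assocScalar, assocScalar, hk, ← braidScalar_add_left]
  have h3 : x.val + x.neg.val = k x.neg x := by linarith
  rw [h3]
  exact braidScalar_mem_lattice (k_mem _ _) (k_mem _ _)

end Reps

namespace Pt

theorem lin_associator_hom_bs {A B D : SumCompletion (Pt N)} (s : A.ι) (t : B.ι) (r : D.ι) :
    lin (α_ A B D).hom ((bs A s ⊠ bs B t) ⊠ bs D r) =
      Reps.assocScalar (A.X s) (B.X t) (D.X r) • (bs A s ⊠ (bs B t ⊠ bs D r)) := by
  simp only [bs_tens_bs]
  rw [associator_hom_eq, lin_graph, coef_associator_hom]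

theorem lin_associator_inv_bs {A B D : SumCompletion (Pt N)} (s : A.ι) (t : B.ι) (r : D.ι) :
    lin (α_ A B D).inv (bs A s ⊠ (bs B t ⊠ bs D r)) =
      (Reps.assocScalar (A.X s) (B.X t) (D.X r))⁻¹ • ((bs A s ⊠ bs B t) ⊠ bs D r) :=
  lin_inv_eq _ (by
    rw [map_smul, lin_associator_hom_bs, smul_smul,
      inv_mul_cancel₀ (Reps.assocScalar_ne_zero _ _ _), one_smul])

theorem lin_leftUnitor_hom_bs {A : SumCompletion (Pt N)} (s : A.ι) :
    lin (λ_ A).hom (vone ⊠ bs A s) = bs A s := by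
  rw [vone, bs_tens_bs, leftUnitor_hom_eq, lin_graph, coef_leftUnitor_hom, one_smul]

theorem lin_rightUnitor_hom_bs {A : SumCompletion (Pt N)} (s : A.ι) :
    lin (ρ_ A).hom (bs A s ⊠ vone) = bs A s := by
  rw [vone, bs_tens_bs, rightUnitor_hom_eq, lin_graph, coef_rightUnitor_hom, one_smul]

theorem lin_braiding_hom_bs {A B : SumCompletion (Pt N)} (s : A.ι) (t : B.ι) :
    lin (β_ A B).hom (bs A s ⊠ bs B t) =
      braidScalar (Reps.val (A.X s)) (Reps.val (B.X t)) • (bs B t ⊠ bs A s) := by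
  simp only [bs_tens_bs]
  rw [braiding_hom_eq, lin_graph, coef_braiding_hom]

/-- The dual of a direct sum. -/
def dual (A : SumCompletion (Pt N)) : SumCompletion (Pt N) := ⟨A.ι, fun s => Reps.neg (A.X s)⟩

/-- A dual basis vector. -/
def bsd (A : SumCompletion (Pt N)) (s : A.ι) : Vec (dual A) := bs (dual A) s

variable (A : SumCompletion (Pt N))

theorem tensorObj_neg (x : Pt N) : tensorObj (C := Pt N) x (Reps.neg x) = 𝟙_ (Pt N) := Reps.add_neg x

theorem neg_tensorObj (x : Pt N) : tensorObj (C := Pt N) (Reps.neg x) x = 𝟙_ (Pt N) := Reps.neg_add x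

/-- The coevaluation of a finite direct sum. -/
def coev [Fintype A.ι] : 𝟙_ (SumCompletion (Pt N)) ⟶ A ⊗ dual A :=
  ofCols fun _ => ∑ s : A.ι, bs (A ⊗ dual A) (s, s)

theorem lin_coev [Fintype A.ι] : lin (coev A) vone = ∑ s : A.ι, bs A s ⊠ bsd A s := by
  have h (s : A.ι) : bs A s ⊠ bsd A s = bs (A ⊗ dual A) (s, s) := bs_tens_bs _ _
  simp only [h]
  refine lin_ofCols (A := 𝟙_ (SumCompletion (Pt N))) (B := A ⊗ dual A)
    (f := fun _ => ∑ s : A.ι, bs (A ⊗ dual A) (s, s)) (fun _ p hp => ?_) ()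
  rw [Finsupp.finsetSum_apply] at hp
  obtain ⟨s, -, hs⟩ := Finset.exists_ne_zero_of_sum_ne_zero hp
  have h : (s, s) = p := by
    by_contra hne
    exact hs (Finsupp.single_eq_of_ne (Ne.symm hne))
  rw [← h]
  exact (tensorObj_neg (A.X s)).symm

open Classical in
/-- The evaluation of a direct sum. -/
def eval : dual A ⊗ A ⟶ 𝟙_ (SumCompletion (Pt N)) :=
  -- The inverse associator normalizes the pairing so that one zigzag identity holds; with the plain
  -- dual basis pairing it would hold only up to that scalar.
  ofCols fun p => if p.1 = p.2 then
    (Reps.assocScalar (A.X p.2) (Reps.neg (A.X p.2)) (A.X p.2))⁻¹ • vone else 0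

open Classical in
theorem lin_eval (s t : A.ι) : lin (eval A) (bsd A s ⊠ bs A t) = if s = t then
    (Reps.assocScalar (A.X t) (Reps.neg (A.X t)) (A.X t))⁻¹ • vone else 0 := by
  have h : bsd A s ⊠ bs A t = bs (dual A ⊗ A) (s, t) := bs_tens_bs _ _
  rw [h]
  refine lin_ofCols (A := dual A ⊗ A) (B := 𝟙_ (SumCompletion (Pt N))) (f := fun p => if p.1 = p.2
    then (Reps.assocScalar (A.X p.2) (Reps.neg (A.X p.2)) (A.X p.2))⁻¹ • vone else 0)
    (fun p u hp => ?_) (s, t)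
  by_cases hst : p.1 = p.2
  · exact (congrArg (fun s => (dual A).X s ⊗ A.X p.2) hst).trans (neg_tensorObj (A.X p.2))
  · exact absurd (by simp only [hst]; rfl) hp

/-- Only the term $s=t$ survives. Its factor combines the associator of this zigzag with the
normalization of `eval`, and the two cancel by `assocScalar_neg`. -/
theorem coev_eval_left [Fintype A.ι] (t : A.ι) :
    lin (dual A ◁ coev A ≫ (α_ (dual A) A (dual A)).inv ≫ eval A ▷ dual A) (bsd A t ⊠ vone) =
      lin ((ρ_ (dual A)).hom ≫ (λ_ (dual A)).inv) (bsd A t ⊠ vone) := by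
  classical
  have h (s : A.ι) : lin (α_ (dual A) A (dual A)).inv (bsd A t ⊠ (bs A s ⊠ bsd A s)) =
      (Reps.assocScalar (Reps.neg (A.X t)) (A.X s) (Reps.neg (A.X s)))⁻¹ •
        ((bsd A t ⊠ bs A s) ⊠ bsd A s) := lin_associator_inv_bs (A := dual A) (D := dual A) t s s
  have h1 : lin (λ_ (dual A)).inv (bsd A t) = vone ⊠ bsd A t :=
    lin_inv_eq _ (lin_leftUnitor_hom_bs (A := dual A) t)
  have h2 : lin (ρ_ (dual A)).hom (bsd A t ⊠ vone) = bsd A t :=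
    lin_rightUnitor_hom_bs (A := dual A) t
  rw [lin_comp_apply, lin_comp_apply, lin_comp_apply, h2, h1, lin_whiskerLeft, lin_coev, map_sum,
    map_sum, map_sum, Finset.sum_eq_single t]
  · rw [h, map_smul, lin_whiskerRight, lin_eval, if_pos rfl, map_smul, LinearMap.smul_apply,
      smul_smul, ← mul_inv_rev, Reps.assocScalar_neg, inv_one, one_smul]
  · intro s _ hs
    rw [h, map_smul, lin_whiskerRight, lin_eval, if_neg hs.symm, map_zero, LinearMap.zero_apply,
      smul_zero]
  · exact fun h => absurd (Finset.mem_univ _) h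

theorem coev_eval_right [Fintype A.ι] (t : A.ι) :
    lin (coev A ▷ A ≫ (α_ A (dual A) A).hom ≫ A ◁ eval A) (vone ⊠ bs A t) =
      lin ((λ_ A).hom ≫ (ρ_ A).inv) (vone ⊠ bs A t) := by
  classical
  have h (s : A.ι) : lin (α_ A (dual A) A).hom ((bs A s ⊠ bsd A s) ⊠ bs A t) =
      Reps.assocScalar (A.X s) (Reps.neg (A.X s)) (A.X t) •
        (bs A s ⊠ (bsd A s ⊠ bs A t)) := lin_associator_hom_bs (B := dual A) s s t
  have h1 : lin (ρ_ A).inv (bs A t) = bs A t ⊠ vone :=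
    lin_inv_eq _ (lin_rightUnitor_hom_bs t)
  rw [lin_comp_apply, lin_comp_apply, lin_comp_apply, lin_leftUnitor_hom_bs, h1,
    lin_whiskerRight, lin_coev, map_sum, LinearMap.sum_apply, map_sum, map_sum,
    Finset.sum_eq_single t]
  · rw [h, map_smul, lin_whiskerLeft, lin_eval, if_pos rfl, map_smul, smul_smul,
      mul_inv_cancel₀ (Reps.assocScalar_ne_zero _ _ _), one_smul]
  · intro s _ hs
    rw [h, map_smul, lin_whiskerLeft, lin_eval, if_neg hs, map_zero, smul_zero]
  · exact fun h => absurd (Finset.mem_univ _) h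

/-- A finite direct sum has a dual. -/
@[reducible]
def exactPairing [Fintype A.ι] : ExactPairing A (dual A) where
  coevaluation' := coev A
  evaluation' := eval A
  coevaluation_evaluation' := hom_ext_tens_bs fun t _ => coev_eval_left A t
  evaluation_coevaluation' := hom_ext_tens_bs fun _ t => coev_eval_right A t

section Equivalence

variable {K : Type*} [Category K] [Preadditive K] [MonoidalCategory K]

theorem isFiniteSumOfSimples_isMonoidal (J : K ⥤ SumCompletion (Pt N)) [J.IsEquivalence]
    [J.Additive] [J.Monoidal] : (isFiniteSumOfSimples K).IsMonoidal where
  prop_unit := by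
    rw [isFiniteSumOfSimples_iff_finite J]
    have : Finite (𝟙_ (SumCompletion (Pt N))).ι := inferInstanceAs (Finite Unit)
    exact finite_of_iso (Functor.Monoidal.εIso J)
  prop_tensor Z W hZ hW := by
    rw [isFiniteSumOfSimples_iff_finite J] at hZ hW ⊢
    have : Finite (J.obj Z ⊗ J.obj W).ι := inferInstanceAs (Finite ((J.obj Z).ι × (J.obj W).ι))
    exact finite_of_iso (Functor.Monoidal.μIso J Z W)

/-- Right duals are pulled back along the fully faithful monoidal functor to finite direct sums; the
braiding turns them into left duals. -/
theorem nonempty_rigidCategory [BraidedCategory K] (J : K ⥤ SumCompletion (Pt N))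
    [J.IsEquivalence] [J.Additive] [J.Monoidal] [(isFiniteSumOfSimples K).IsMonoidal] :
    Nonempty (RigidCategory (isFiniteSumOfSimples K).FullSubcategory) := by
  have h (Z : (isFiniteSumOfSimples K).FullSubcategory) : Nonempty (HasRightDual Z) := by
    let G : (isFiniteSumOfSimples K).FullSubcategory ⥤ SumCompletion (Pt N) :=
      (isFiniteSumOfSimples K).ι ⋙ J
    have hZ : Finite (G.obj Z).ι := (isFiniteSumOfSimples_iff_finite J Z.obj).1 Z.property
    let _ := Fintype.ofFinite (G.obj Z).ι
    let D := J.inv.obj (dual (G.obj Z))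
    let i : J.obj D ≅ dual (G.obj Z) := J.asEquivalence.counitIso.app _
    have hD : isFiniteSumOfSimples K D := by
      rw [isFiniteSumOfSimples_iff_finite J]
      have : Finite (dual (G.obj Z)).ι := hZ
      exact finite_of_iso i.symm
    let W : (isFiniteSumOfSimples K).FullSubcategory := ⟨D, hD⟩
    let _ : ExactPairing (G.obj Z) (dual (G.obj Z)) := exactPairing _
    let _ : ExactPairing (G.obj Z) (G.obj W) := exactPairingCongrRight i
    exact ⟨{ rightDual := W, exact := ExactPairing.ofFullyFaithful G Z W }⟩
  let _ : RightRigidCategory (isFiniteSumOfSimples K).FullSubcategory :=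
    { rightDual := fun Z => (h Z).some }
  exact ⟨BraidedCategory.rigidCategoryOfRightRigidCategory⟩

end Equivalence

end Pt

end HeisenbergLattice

end

noncomputable section

namespace HeisenbergLattice

/-! ### Skeletons that contain given objects -/

section Skeleton

variable {C : Type*} [Category C] {I : Type*} (F : I → C)

/-- A choice of representatives of the isomorphism classes of objects that contains given
representatives of some of the classes. -/
def skeletonContaining : ObjectProperty C := fun M =>
  (∃ i, M = F i) ∨ ((¬∃ i, Nonempty (M ≅ F i)) ∧
    M = (Quotient.mk (isIsomorphicSetoid C) M).out)

theorem skeletonContaining_apply (i : I) : skeletonContaining F (F i) := Or.inl ⟨i, rfl⟩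

theorem exists_iso_skeletonContaining (M : C) :
    ∃ M' : C, skeletonContaining F M' ∧ Nonempty (M' ≅ M) := by
  by_cases h : ∃ i, Nonempty (M ≅ F i)
  · obtain ⟨i, ⟨e⟩⟩ := h
    exact ⟨F i, skeletonContaining_apply F i, ⟨e.symm⟩⟩
  · let q := Quotient.mk (isIsomorphicSetoid C) M
    have hq : Nonempty (q.out ≅ M) := Quotient.exact (q.out_eq)
    refine ⟨q.out, Or.inr ⟨fun ⟨i, ⟨e⟩⟩ => h ⟨i, ⟨hq.some.symm ≪≫ e⟩⟩, ?_⟩, hq⟩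
    rw [Quotient.out_eq]

theorem eq_of_iso_of_skeletonContaining (hF : ∀ i j, Nonempty (F i ≅ F j) → i = j) {M M' : C}
    (hM : skeletonContaining F M) (hM' : skeletonContaining F M') (e : M ≅ M') : M = M' := by
  rcases hM with ⟨i, rfl⟩ | ⟨h, hM⟩ <;> rcases hM' with ⟨j, rfl⟩ | ⟨h', hM'⟩
  · rw [hF i j ⟨e⟩]
  · exact absurd ⟨i, ⟨e.symm⟩⟩ h'
  · exact absurd ⟨j, ⟨e⟩⟩ h
  · have : Quotient.mk (isIsomorphicSetoid C) M = Quotient.mk (isIsomorphicSetoid C) M' :=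
      Quotient.sound ⟨e⟩
    rw [hM, hM', this]

instance : (skeletonContaining F).ι.IsEquivalence where
  essSurj := ⟨fun M => by
    obtain ⟨M', h, ⟨e⟩⟩ := exists_iso_skeletonContaining F M
    exact ⟨⟨M', h⟩, ⟨e⟩⟩⟩

theorem isSkeletonOf_skeletonContaining (hF : ∀ i j, Nonempty (F i ≅ F j) → i = j) :
    IsSkeletonOf C (skeletonContaining F).FullSubcategory (skeletonContaining F).ι where
  skel X Y := fun ⟨e⟩ => ObjectProperty.FullSubcategory.ext
    (eq_of_iso_of_skeletonContaining F hF X.property Y.property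
      ((skeletonContaining F).ι.mapIso e))

end Skeleton

/-! ### Transport of braided monoidal structures along fully faithful functors -/

section Transport

open Functor.LaxMonoidal Functor.OplaxMonoidal

variable {K E : Type*} [Category K] [Category E] [MonoidalCategory E]

/-- A choice of objects that represent the tensor products and the unit object along a functor. -/
structure TensorData (J : K ⥤ E) where
  /-- The tensor product. -/
  obj (X Y : K) : K
  /-- The comparison of the tensor products. -/
  iso (X Y : K) : J.obj X ⊗ J.obj Y ≅ J.obj (obj X Y)
  /-- The unit object. -/
  unit : K
  /-- The comparison of the unit objects. -/
  unitIso : 𝟙_ E ≅ J.obj unit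

namespace TensorData

variable {J : K ⥤ E} [J.Full] [J.Faithful] (T : TensorData J)

/-- The tensor product of a fully faithful functor to a monoidal category with representable
tensor products. -/
@[reducible]
def struct : MonoidalCategoryStruct K where
  tensorObj := T.obj
  whiskerLeft X _ _ f := J.preimage ((T.iso _ _).inv ≫ J.obj X ◁ J.map f ≫ (T.iso _ _).hom)
  whiskerRight f Y := J.preimage ((T.iso _ _).inv ≫ J.map f ▷ J.obj Y ≫ (T.iso _ _).hom)
  tensorHom f g := J.preimage ((T.iso _ _).inv ≫ (J.map f ⊗ₘ J.map g) ≫ (T.iso _ _).hom)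
  tensorUnit := T.unit
  associator X Y Z := J.preimageIso (((T.iso _ _).symm ≪≫ ((T.iso _ _).symm ⊗ᵢ .refl _)) ≪≫
    α_ (J.obj X) (J.obj Y) (J.obj Z) ≪≫ ((.refl _ ⊗ᵢ T.iso _ _) ≪≫ T.iso _ _))
  leftUnitor X := J.preimageIso (((T.iso _ _).symm ≪≫ (T.unitIso.symm ⊗ᵢ .refl _)) ≪≫
    λ_ (J.obj X))
  rightUnitor X := J.preimageIso (((T.iso _ _).symm ≪≫ (.refl _ ⊗ᵢ T.unitIso.symm)) ≪≫
    ρ_ (J.obj X))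

/-- The functor preserves the tensor product. -/
def inducing : letI := T.struct; Monoidal.InducingFunctorData J :=
  letI := T.struct
  { μIso := T.iso
    εIso := T.unitIso
    whiskerLeft_eq := fun _ _ _ _ => J.map_preimage _
    whiskerRight_eq := fun _ _ => J.map_preimage _
    tensorHom_eq := fun _ _ => J.map_preimage _
    associator_eq := fun _ _ _ => J.map_preimage _
    leftUnitor_eq := fun _ => J.map_preimage _
    rightUnitor_eq := fun _ => J.map_preimage _ }

/-- The monoidal category given by representing objects of tensor products. -/
@[reducible]
def monoidalCategory : MonoidalCategory K :=
  letI := T.struct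
  Monoidal.induced J T.inducing

/-- The functor is monoidal. -/
@[reducible]
def monoidal : letI := T.monoidalCategory; J.Monoidal :=
  letI := T.struct
  Monoidal.fromInducedMonoidal J T.inducing

variable [BraidedCategory E]

/-- The braiding given by representing objects of tensor products. -/
@[reducible]
def braidedCategory : letI := T.monoidalCategory; BraidedCategory K :=
  letI := T.monoidalCategory
  letI := T.monoidal
  BraidedCategory.ofFullyFaithful J

/-- The functor is braided. -/
@[reducible]
def braided : letI := T.monoidalCategory; letI := T.braidedCategory; J.Braided :=
  letI := T.monoidalCategory
  letI := T.braidedCategory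
  letI := T.monoidal
  { braided := fun X Y => by
      have h : J.map (β_ X Y).hom = δ J X Y ≫ (β_ (J.obj X) (J.obj Y)).hom ≫ μ J Y X :=
        J.map_preimage _
      rw [h, Functor.Monoidal.μ_δ_assoc] }

end TensorData

/-- A functor isomorphic to a braided functor is braided. -/
@[reducible]
def braidedOfIso [MonoidalCategory K] [BraidedCategory K] [BraidedCategory E] {F G : K ⥤ E}
    (i : F ≅ G) [F.Braided] : G.Braided :=
  letI : G.Monoidal := Functor.Monoidal.transport i
  haveI := Functor.Monoidal.natTransIsMonoidal_of_transport i
  { braided := (Functor.LaxBraided.ofNatIso i).braided }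

/-- The restriction of a twist along a fully faithful braided functor. -/
def Twist.restrict [MonoidalCategory K] [BraidedCategory K] [BraidedCategory E] (θ : Twist E)
    (G : K ⥤ E) [G.Full] [G.Faithful] [G.Braided] : Twist K where
  app X := G.preimageIso (θ.app (G.obj X))
  naturality f := G.map_injective (by
    rw [G.map_comp, G.map_comp, Functor.preimageIso_hom, Functor.preimageIso_hom, G.map_preimage,
      G.map_preimage]
    exact θ.naturality _)
  balancing X Y := G.map_injective (by
    rw [G.map_comp, G.map_comp, Functor.Monoidal.map_tensor, Functor.preimageIso_hom,
      Functor.preimageIso_hom, Functor.preimageIso_hom, G.map_preimage,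
      G.map_preimage, G.map_preimage, Category.assoc, Category.assoc,
      Functor.LaxBraided.braided_assoc, Functor.LaxBraided.braided, ← cancel_epi (μ G X Y),
      Functor.Monoidal.μ_δ_assoc, θ.naturality, θ.balancing]
    simp only [Category.assoc])

end Transport

end HeisenbergLattice

end

noncomputable section

namespace HeisenbergLattice

open SumCompletion FockCat

/-! ### Tensor products with normalized generators -/

section Smul

variable {C : Type*} [Category C] [Preadditive C] [ScalarCat C] [Linear ℂ C]

theorem lin_smul_of {A B : SumCompletion C} (c : ℂ) (f : A ⟶ B)
    (h : ∀ {X Y : C} (g : X ⟶ Y), ScalarCat.coef (c • g) = c * ScalarCat.coef g) :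
    lin (c • f) = c • lin f := by
  refine Finsupp.lhom_ext' fun s => LinearMap.ext_ring (Finsupp.ext fun r => ?_)
  refine (lin_bs_apply _ s r).trans ?_
  show _ = c * lin f (bs A s) r
  rw [lin_bs_apply, entry_smul, h]

end Smul

@[simp] theorem lin_smul_fock {A B : SumCompletion FockCat} (c : ℂ) (f : A ⟶ B) :
    lin (c • f) = c • lin f := lin_smul_of c f fun g => FockCat.coef_smul c g

variable {N : ℕ}

@[simp] theorem Pt.lin_smul {A B : SumCompletion (Pt N)} (c : ℂ) (f : A ⟶ B) :
    lin (c • f) = c • lin f := lin_smul_of c f fun g => FockCat.coef_smul c g.hom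

open Functor.LaxMonoidal

variable {K : Type*} [Category K] (J : K ⥤ SumCompletion (Pt N)) {F : Reps N → K}

section Generators

variable (φ : ∀ x, J.obj (F x) ≅ Pt.single x)

open Classical in
/-- The generator of an object of the family `F`. -/
def gen (X : K) : Vec (J.obj X) :=
  if h : ∃ x, F x = X then
    lin (J.map (eqToHom h.choose_spec)) (lin (φ h.choose).inv (bs (Pt.single h.choose) ())) else 0

variable {φ}

theorem gen_apply (hF : F.Injective) (x : Reps N) :
    gen J φ (F x) = lin (φ x).inv (bs (Pt.single x) ()) := by
  have h : ∃ y, F y = F x := ⟨x, rfl⟩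
  rw [gen, dif_pos h]
  generalize_proofs p
  revert p
  generalize h.choose = y
  intro p
  obtain rfl := hF p
  rw [eqToHom_refl, J.map_id, lin_id_apply]

theorem lin_map_eqToHom_gen {X Y : K} (h : X = Y) :
    lin (J.map (eqToHom h)) (gen J φ X) = gen J φ Y := by
  subst h
  rw [eqToHom_refl, J.map_id, lin_id_apply]

/-- Such an $X$ is one-dimensional and spanned by its generator. The equality is kept as a
hypothesis because tensor products equal members of the family only propositionally. -/
theorem hom_ext_gen (hF : F.Injective) [J.Faithful] {x : Reps N} {X Y : K} (hX : X = F x)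
    {f g : X ⟶ Y} (h : lin (J.map f) (gen J φ X) = lin (J.map g) (gen J φ X)) : f = g := by
  subst hX
  rw [gen_apply J hF] at h
  refine J.map_injective ((cancel_epi (φ x).inv).1 (hom_ext_bs fun u => ?_))
  rw [lin_comp_apply, lin_comp_apply]
  exact h

theorem eq_smul_eqToHom [Preadditive K] [Linear ℂ K] (hF : F.Injective) [J.Faithful] [J.Additive]
    [J.Linear ℂ] {x : Reps N} {X Y : K} (hX : X = F x) (h : X = Y) {f : X ⟶ Y} {c : ℂ}
    (hf : lin (J.map f) (gen J φ X) = c • gen J φ Y) : f = c • eqToHom h :=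
  hom_ext_gen J hF hX (by
    rw [hf, J.map_smul, Pt.lin_smul, LinearMap.smul_apply, lin_map_eqToHom_gen])

variable [NeZero N]

/-- For two members of the family the product is chosen in the family and its comparison map is
rescaled to respect generators; any representing object does otherwise. Injectivity of `F` makes the
labels unambiguous. -/
theorem exists_tensor [J.EssSurj] (hF : F.Injective) (X Y : K) :
    ∃ (Z : K) (i : J.obj X ⊗ J.obj Y ≅ J.obj Z), ∀ x y, X = F x → Y = F y →
      Z = F (x.add y) ∧ lin i.hom (gen J φ X ⊠ gen J φ Y) = gen J φ Z := by
  by_cases h : ∃ x y, X = F x ∧ Y = F y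
  · obtain ⟨x, y, rfl, rfl⟩ := h
    -- Both sides have one summand, and the summands agree by definition, so the isomorphism has
    -- scalar 1.
    let n : Pt.single x ⊗ Pt.single y ≅ Pt.single (x.add y) :=
      graphIso (A := Pt.single x ⊗ Pt.single y) (B := Pt.single (x.add y))
        (Equiv.punitProd Unit) fun _ => Iso.refl _
    have hn : lin n.hom (bs (Pt.single x) () ⊠ bs (Pt.single y) ()) =
        bs (Pt.single (x.add y)) () := by
      rw [bs_tens_bs]
      refine (lin_graph (A := Pt.single x ⊗ Pt.single y) (B := Pt.single (x.add y)) _ _ _).trans ?_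
      rw [Iso.refl_hom, ScalarCat.coef_id, one_smul]
    refine ⟨F (x.add y), (φ x ⊗ᵢ φ y) ≪≫ n ≪≫ (φ (x.add y)).symm, fun x' y' hx hy => ?_⟩
    obtain rfl := hF hx
    obtain rfl := hF hy
    refine ⟨rfl, ?_⟩
    have h1 : lin (φ x).hom (lin (φ x).inv (bs (Pt.single x) ())) = bs (Pt.single x) () :=
      lin_comp_inv (φ x).symm _
    have h2 : lin (φ y).hom (lin (φ y).inv (bs (Pt.single y) ())) = bs (Pt.single y) () :=
      lin_comp_inv (φ y).symm _
    rw [gen_apply J hF, gen_apply J hF, gen_apply J hF, Iso.trans_hom, Iso.trans_hom,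
      lin_comp_apply, lin_comp_apply, tensorIso_hom, lin_tensorHom, h1, h2, hn, Iso.symm_hom]
  · exact ⟨J.objPreimage (J.obj X ⊗ J.obj Y), (J.objObjPreimageIso _).symm,
      fun x y hx hy => absurd ⟨x, y, hx, hy⟩ h⟩

/-- Tensor products for which the comparison maps preserve the generators. -/
def genTensorData [J.EssSurj] (φ : ∀ x, J.obj (F x) ≅ Pt.single x) (hF : F.Injective) :
    TensorData J where
  obj X Y := (exists_tensor J (φ := φ) hF X Y).choose
  iso X Y := (exists_tensor J (φ := φ) hF X Y).choose_spec.choose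
  unit := J.objPreimage (𝟙_ _)
  unitIso := (J.objObjPreimageIso _).symm

section Constraints

variable [MonoidalCategory K] [J.Monoidal] (φ)

/-- The tensor product preserves the objects of the family `F` and their generators. -/
structure IsGenTensor : Prop where
  injective : F.Injective
  obj (x y : Reps N) : F x ⊗ F y = F (x.add y)
  gen_tens (x y : Reps N) : lin (μ J (F x) (F y)) (gen J φ (F x) ⊠ gen J φ (F y)) =
    gen J φ (F x ⊗ F y)

namespace IsGenTensor

variable {J φ}

theorem lin_μ (T : IsGenTensor J φ) {X Y : K} {x y : Reps N} (hX : X = F x) (hY : Y = F y) :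
    lin (μ J X Y) (gen J φ X ⊠ gen J φ Y) = gen J φ (X ⊗ Y) := by
  subst hX hY
  exact T.gen_tens x y

theorem lin_associator_gen (T : IsGenTensor J φ) (x y z : Reps N) :
    lin (α_ (J.obj (F x)) (J.obj (F y)) (J.obj (F z))).hom
      ((gen J φ (F x) ⊠ gen J φ (F y)) ⊠ gen J φ (F z)) =
    Reps.assocScalar x y z • (gen J φ (F x) ⊠ (gen J φ (F y) ⊠ gen J φ (F z))) := by
  have h := congrArg (fun f => lin f ((bs (Pt.single x) () ⊠ bs (Pt.single y) ()) ⊠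
    bs (Pt.single z) ())) (associator_naturality (φ x).inv (φ y).inv (φ z).inv)
  simp only [lin_comp_apply, lin_tensorHom, ← gen_apply J T.injective, Pt.lin_associator_hom_bs,
    map_smul] at h
  exact h

theorem lin_braiding_gen (T : IsGenTensor J φ) (x y : Reps N) :
    lin (β_ (J.obj (F x)) (J.obj (F y))).hom (gen J φ (F x) ⊠ gen J φ (F y)) =
      braidScalar x.val y.val • (gen J φ (F y) ⊠ gen J φ (F x)) := by
  have h := congrArg (fun f => lin f (bs (Pt.single x) () ⊠ bs (Pt.single y) ()))
    (BraidedCategory.braiding_naturality (φ x).inv (φ y).inv)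
  simp only [lin_comp_apply, lin_tensorHom, ← gen_apply J T.injective, Pt.lin_braiding_hom_bs,
    map_smul] at h
  exact h

theorem assoc_obj (T : IsGenTensor J φ) (x y z : Reps N) : (F x ⊗ F y) ⊗ F z = F x ⊗ (F y ⊗ F z) := by
  rw [T.obj, T.obj, T.obj, T.obj, Reps.add_assoc]

variable [Preadditive K] [Linear ℂ K] [J.Faithful] [J.Additive] [J.Linear ℂ]

/-- Monoidality of `J` compares this associator with the one in the target. The comparison maps
carry generators to generators and introduce no scalar of their own. -/
theorem associator_hom (T : IsGenTensor J φ) (x y z : Reps N) : (α_ (F x) (F y) (F z)).hom =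
    Reps.assocScalar x y z • eqToHom (T.assoc_obj x y z) := by
  have hX : (F x ⊗ F y) ⊗ F z = F ((x.add y).add z) := by rw [T.obj, T.obj]
  refine eq_smul_eqToHom J (φ := φ) T.injective hX _ ?_
  have h := congrArg (fun f => lin f ((gen J φ (F x) ⊠ gen J φ (F y)) ⊠ gen J φ (F z)))
    (associativity J (F x) (F y) (F z))
  simp only [lin_comp_apply, lin_whiskerRight, lin_whiskerLeft, T.lin_associator_gen, map_smul,
    T.gen_tens] at h
  rw [T.lin_μ (T.obj x y) rfl, T.lin_μ rfl (T.obj y z)] at h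
  exact h

theorem braiding_hom (T : IsGenTensor J φ) [BraidedCategory K]
    (hJ : ∀ X Y, μ J X Y ≫ J.map (β_ X Y).hom = (β_ _ _).hom ≫ μ J Y X) (x y : Reps N) :
    (β_ (F x) (F y)).hom = braidScalar x.val y.val •
      eqToHom ((T.obj x y).trans ((congrArg F (Reps.add_comm x y)).trans (T.obj y x).symm)) := by
  refine eq_smul_eqToHom J (φ := φ) T.injective (T.obj x y) _ ?_
  have h := congrArg (fun f => lin f (gen J φ (F x) ⊠ gen J φ (F y))) (hJ (F x) (F y))
  simp only [lin_comp_apply, T.lin_braiding_gen, map_smul, T.gen_tens] at h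
  exact h

end IsGenTensor

end Constraints

theorem isGenTensor_genTensorData [J.Full] [J.Faithful] [J.EssSurj] (hF : F.Injective) :
    letI := (genTensorData J φ hF).monoidalCategory
    letI := (genTensorData J φ hF).monoidal
    IsGenTensor J φ :=
  letI := (genTensorData J φ hF).monoidalCategory
  letI := (genTensorData J φ hF).monoidal
  { injective := hF
    obj := fun x y =>
      ((exists_tensor J (φ := φ) hF (F x) (F y)).choose_spec.choose_spec x y rfl rfl).1
    gen_tens := fun x y =>
      ((exists_tensor J (φ := φ) hF (F x) (F y)).choose_spec.choose_spec x y rfl rfl).2 }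

end Generators

end HeisenbergLattice

end

noncomputable section

namespace HeisenbergLattice

open SumCompletion FockCat
open scoped MonObj
open VL

variable {N : ℕ}

/-! ### The skeleton of the category of local modules -/

theorem fockMap_add {X Y : SumCompletion (Pt N)} (f g : X ⟶ Y) :
    fockMap (f + g) = fockMap f + fockMap g :=
  lin_injective (by rw [lin_fockMap, lin_add, lin_add, lin_fockMap, lin_fockMap])

theorem fockMap_smul {X Y : SumCompletion (Pt N)} (c : ℂ) (f : X ⟶ Y) :
    fockMap (c • f) = c • fockMap f :=
  lin_injective (by rw [lin_fockMap, Pt.lin_smul, lin_smul_fock, lin_fockMap])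

instance : (ind (N := N)).Additive where
  map_add {X Y f g} := rep0_hom_ext <| by
    show VL N ◁ fockMap (f + g) = VL N ◁ fockMap f + VL N ◁ fockMap g
    rw [fockMap_add, MonoidalPreadditive.whiskerLeft_add]

instance : (ind (N := N)).Linear ℂ where
  map_smul {X Y} f c := rep0_hom_ext <| by
    show VL N ◁ fockMap (c • f) = c • (VL N ◁ fockMap f)
    rw [fockMap_smul, MonoidalLinear.whiskerLeft_smul]

/-- The local module induced from the Fock module of weight `x`. -/
abbrev indRep (x : Reps N) : RepVL N :=
  ⟨inducedFock x, isLocal_induction_fockObj (Pt.single x)⟩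

theorem indRep_injective (x y : Reps N) (h : Nonempty (indRep x ≅ indRep y)) : x = y :=
  Pt.eq_of_single_iso ((ind (N := N)).preimageIso h.some)

variable (N) in
/-- The skeleton of the category of local modules. -/
abbrev Skel : ObjectProperty (RepVL N) := skeletonContaining (indRep (N := N))

/-- The simple objects of the skeleton. -/
abbrev skelRep (x : Reps N) : (Skel N).FullSubcategory := ⟨indRep x, skeletonContaining_apply _ x⟩

theorem skelRep_injective : (skelRep (N := N)).Injective := fun x y h =>
  indRep_injective x y ⟨eqToIso (congrArg ObjectProperty.FullSubcategory.obj h)⟩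

variable (N) [NeZero N]

instance : (indEquiv N).functor.Additive := inferInstanceAs (ind (N := N)).Additive
instance : (indEquiv N).functor.Linear ℂ := inferInstanceAs ((ind (N := N)).Linear ℂ)

instance : (indEquiv N).functor.Braided :=
  inferInstanceAs (Monoidal.equivalenceTransported (indEquiv N)).functor.Braided

variable {N}

variable (N) in
/-- The equivalence of the skeleton with the category of direct sums of objects of `Pt N`. -/
abbrev skelRed : (Skel N).FullSubcategory ⥤ SumCompletion (Pt N) :=
  (Skel N).ι ⋙ (indEquiv N).inverse

/-- A simple object of the skeleton as a direct sum with a single summand. -/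
def skelRedIso (x : Reps N) : (skelRed N).obj (skelRep x) ≅ Pt.single x :=
  ((indEquiv N).unitIso.app (Pt.single x)).symm

variable (N) in
/-- The tensor products in the skeleton. -/
def skelTensor : TensorData (skelRed N) := genTensorData (skelRed N) skelRedIso skelRep_injective

instance skelMonoidal : MonoidalCategory (Skel N).FullSubcategory := (skelTensor N).monoidalCategory

instance skelBraided : BraidedCategory (Skel N).FullSubcategory := (skelTensor N).braidedCategory

instance skelRedBraided : (skelRed N).Braided := (skelTensor N).braided

theorem isGenTensor_skel : IsGenTensor (skelRed N) (skelRedIso (N := N)) :=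
  isGenTensor_genTensorData (skelRed N) skelRep_injective

variable (N) in
/-- The inclusion of the skeleton is braided. -/
instance skelInclBraided : (Skel N).ι.Braided :=
  braidedOfIso (F := skelRed N ⋙ (indEquiv N).functor)
    (Functor.associator _ _ _ ≪≫ Functor.isoWhiskerLeft _ (indEquiv N).counitIso ≪≫
      (Skel N).ι.rightUnitor)

variable (N) in
/-- The twist of the skeleton. -/
def skelTwist : Twist (Skel N).FullSubcategory := (repTwist N).restrict (Skel N).ι

theorem skelTwist_hom (X : (Skel N).FullSubcategory) :
    ((skelTwist N).app X).hom.hom = ((repTwist N).app X.obj).hom :=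
  (Skel N).ι.map_preimage _

/-- The weights of this module are $l+x$, and $e^{\pi i(l+x)^2}=e^{\pi i x^2}$ because $l^2$ is even
and $lx$ is an integer. -/
theorem repTwist_indRep (x : Reps N) :
    ((repTwist N).app (indRep x)).hom = braidScalar x.val x.val • 𝟙 (indRep x) := by
  refine rep0_hom_ext ?_
  show (ambientTwist (indObj (Pt.single x))).hom =
    braidScalar x.val x.val • 𝟙 (indObj (Pt.single x))
  refine indObj_hom_ext fun l s => ?_
  have hs := tens_mem_weightSpace (e_mem l) (fockObj_bs_mem (Pt.single x) s)
  have hb : braidScalar (l + x.val) (l + x.val) = braidScalar x.val x.val := by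
    rw [braidScalar_add_left, braidScalar_add_right, braidScalar_add_right,
      braidScalar_mem_lattice l.2 l.2, braidScalar_comm l, one_mul, ← mul_assoc,
      Reps.braidScalar_sq _ l.2, one_mul]
  rw [lin_twist hs, lin_smul_fock, LinearMap.smul_apply, lin_id_apply]
  exact congrArg (· • _) hb

theorem skelTwist_skelRep (x : Reps N) :
    ((skelTwist N).app (skelRep x)).hom = braidScalar x.val x.val • 𝟙 (skelRep x) :=
  ObjectProperty.hom_ext _ ((skelTwist_hom (skelRep x)).trans (repTwist_indRep x))

theorem skel_tensorObj (x y : Reps N) : skelRep x ⊗ skelRep y = skelRep (x.add y) :=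
  isGenTensor_skel.obj x y

theorem skel_associator (x y z : Reps N) :
    ∃ h : (skelRep x ⊗ skelRep y) ⊗ skelRep z = skelRep x ⊗ (skelRep y ⊗ skelRep z),
      (α_ (skelRep x) (skelRep y) (skelRep z)).hom =
        ((-1 : ℂ) ^ ((x.val * Reps.k y z : ℝ) : ℂ)) • eqToHom h := by
  have h := isGenTensor_skel.associator_hom x y z
  rw [Reps.assocScalar_eq] at h
  exact ⟨_, h⟩

theorem skel_braiding (x y : Reps N) : ∃ h : skelRep x ⊗ skelRep y = skelRep y ⊗ skelRep x,
    (β_ (skelRep x) (skelRep y)).hom =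
      Complex.exp (Real.pi * Complex.I * x.val * y.val) • eqToHom h :=
  ⟨_, isGenTensor_skel.braiding_hom (fun X Y => skelRedBraided.braided X Y) x y⟩

theorem skel_twist (x : Reps N) : ((skelTwist N).app (skelRep x)).hom =
    Complex.exp (Real.pi * Complex.I * x.val ^ 2) • 𝟙 (skelRep x) := by
  have h : Complex.exp (Real.pi * Complex.I * x.val ^ 2) = braidScalar x.val x.val := by
    rw [braidScalar, mul_assoc _ (x.val : ℂ), sq]
  rw [h]
  exact skelTwist_skelRep x

theorem exists_isMonoidal_rigid :
    ∃ _ : (isFiniteSumOfSimples (Skel N).FullSubcategory).IsMonoidal,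
      Nonempty (RigidCategory (isFiniteSumOfSimples (Skel N).FullSubcategory).FullSubcategory) :=
  have h := Pt.isFiniteSumOfSimples_isMonoidal (skelRed N)
  ⟨h, Pt.nonempty_rigidCategory (skelRed N)⟩

end HeisenbergLattice

end

/-! ### Assembly of the classification, the relative tensor product and the skeleton. -/

theorem mainTheorem1 (N : ℕ) (hN : 0 < N) :
    ∃ hloc : ∀ x : Reps N, IsLocal (VL N) (inducedFock x),
      -- the simple objects of `Rep⁰ V_L`
      (∀ x : Reps N, Simple (⟨inducedFock x, hloc x⟩ : RepVL N)) ∧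
      (∀ x y : Reps N, Nonempty ((⟨inducedFock x, hloc x⟩ : RepVL N) ≅ ⟨inducedFock y, hloc y⟩) →
        x = y) ∧
      (∀ M : RepVL N, Simple M → ∃ x : Reps N, Nonempty (M ≅ ⟨inducedFock x, hloc x⟩)) ∧
      -- the braided tensor category with twist `(Rep⁰ V_L, ⊗_{V_L})`
      ∃ (_ : MonoidalCategory (RepVL N)) (_ : BraidedCategory (RepVL N)) (θ : Twist (RepVL N)),
        Nonempty (Rep0.RelTensor (VL N)) ∧
        (∀ M : RepVL N, Rep0.toHom (θ.app M).hom =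
          ((SumCompletion.twist fockTwist).app (Rep0.carrier M)).hom) ∧
        -- its skeleton
        ∃ (S : ObjectProperty (RepVL N)) (hS : ∀ x : Reps N, S ⟨inducedFock x, hloc x⟩),
          IsSkeletonOf (RepVL N) S.FullSubcategory S.ι ∧
          ∃ (_ : MonoidalCategory S.FullSubcategory) (_ : BraidedCategory S.FullSubcategory)
            (θS : Twist S.FullSubcategory),
            Nonempty S.ι.Braided ∧
            (∀ X : S.FullSubcategory, (θS.app X).hom.hom = (θ.app X.obj).hom) ∧
            (∃ _ : (isFiniteSumOfSimples S.FullSubcategory).IsMonoidal,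
              Nonempty (RigidCategory (isFiniteSumOfSimples S.FullSubcategory).FullSubcategory)) ∧
            let F : Reps N → S.FullSubcategory := fun x => ⟨⟨inducedFock x, hloc x⟩, hS x⟩
            (∀ x y : Reps N, F x ⊗ F y = F (x.add y)) ∧
            (∀ x y z : Reps N, ∃ h : (F x ⊗ F y) ⊗ F z = F x ⊗ (F y ⊗ F z),
              (α_ (F x) (F y) (F z)).hom =
                ((-1 : ℂ) ^ ((x.val * Reps.k y z : ℝ) : ℂ)) • eqToHom h) ∧
            (∀ x y : Reps N, ∃ h : F x ⊗ F y = F y ⊗ F x,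
              (β_ (F x) (F y)).hom =
                Complex.exp (Real.pi * Complex.I * x.val * y.val) • eqToHom h) ∧
            (∀ x : Reps N, (θS.app (F x)).hom =
              Complex.exp (Real.pi * Complex.I * x.val ^ 2) • 𝟙 (F x)) := by
  have : NeZero N := ⟨hN.ne'⟩
  exact ⟨fun x => isLocal_induction_fockObj (Pt.single x), fun x => simple_obj ind (Pt.single x),
    indRep_injective, fun M hM => Pt.exists_iso_obj_single ind M, repMonoidal, repBraided,
    repTwist N, ⟨relTensor N⟩, fun M => rfl, Skel N, skeletonContaining_apply indRep,
    isSkeletonOf_skeletonContaining indRep indRep_injective, skelMonoidal, skelBraided,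
    skelTwist N, ⟨skelInclBraided N⟩, skelTwist_hom, exists_isMonoidal_rigid, skel_tensorObj,
    skel_associator, skel_braiding, skel_twist⟩
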